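/- Let $(M,g)$ be a smooth pseudo-Riemannian manifold of signature $(n-1,1)$, $n\ge 3$, with Levi-Civita connection $\nabla$ and curvature $R$, and let $V\subset M$ be an immersed smooth lightlike hypersurface: $\dim V=n-1$, and at each point $x\in V$ the hyperplane $T_xV$ contains an isotropic vector $e_1\neq 0$ orthogonal to $T_xV$. An isotropic frame on $V$ consists of local smooth fields $e_1$ (as above), $e_a$ $(a=2,\dots,n-1)$, such that $e_1,e_a$ is a basis of $T_xV$, and an isotropic $e_n\in T_xM$ with $(e_a,e_n)=0$, $(e_1,e_n)=-1$; write $dx=\omega^1e_1+\omega^ae_a$ on $V$, let $\omega_1^1(v)$ be the $e_1$-component of $\nabla_ve_1$, and let $R^1_{1ab}$ be the $e_1$-component of $R(e_a,e_b)e_1$. Assume that $V$ is totally umbilical, i.e. for every local nonvanishing isotropic field $e_1$ on $V$ one has $(\nabla_ue_1,w)=\lambda\,(u,w)$ for all $u,w\in T_xV$, with a function $\lambda$ that vanishes nowhere; and that the isotropic sectional curvature $K_N(\sigma)=(R(P,N)N,P)/(P,P)$ is nonzero for every isotropic $2$-plane $\sigma=N\wedge P$ tangent to $V$ ($N$ isotropic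 and nonzero, $P$ nonisotropic). Call a point $x+se_1$ of the isotropic line through $x$ (a point of the affine tangent space $T_xM$, onto which $M$ is developed) singular if $w\mapsto w+s\nabla_we_1$ is degenerate on $T_xV$ modulo $e_1$. Then: (1) Each isotropic line $x+\mathbb R e_1$ carries exactly one singular point $F=x-\frac1\lambda e_1$, which depends smoothly on $x$ and describes an isotropic curve: the image of $dF=dx+\nabla(-\frac1\lambda e_1)$ on $T_xV$ is exactly the isotropic line $\mathbb Re_1$, and when $x$ moves along a smooth curve in $V$, the point $F$ describes in the development of $M$ along this curve a curve with isotropic velocity, which vanishes exactly when $dF=0$ on the tangent vector of the curve. (2) $S_x=\{v\in T_xV: dF(v)=0\}$ defines a smooth screen distribution $S$ on $V$ (a complement of $\mathbb Re_1$ in $T_xV$). It is intrinsic and invariant: an isotropic frame describes $S$ by the equation $\omega^1=0$ (i.e. the $e_a$ span $S$) if and only if $d\lambda-\lambda\omega_1^1+\lambda^2\omega^1=\mu\,\omega^1$ for some function $\mu$, and $S$ is the only screen distribution with this property for all isotropic frames. (3) $S$ is integrable (an integral manifold of dimension $n-2$ passes through each point of $V$) if and only if $R^1_{1ab}=0$ on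 $V$ for all $a,b$, in the isotropic frames whose $e_a$ span $S$. -/

import Mathlib

open scoped Manifold ContDiff Topology
open Bundle

noncomputable section

namespace Lightlike

/-! ### Flat formulas: Christoffel symbols and curvature of a matrix-valued function -/

section Coordinates

variable {E : Type*} [NormedAddCommGroup E] [NormedSpace ℝ E]

/-- Christoffel symbols of the second kind of the metric coefficients `G`: `Γ_y(u, w)` is the vector
with `G_y(Γ_y(u, w), t) = (∂_u G(w, t) + ∂_w G(u, t) - ∂_t G(u, w)) / 2` for all `t`. -/
def christoffel (G : E → E →L[ℝ] E →L[ℝ] ℝ) (y u w : E) : E :=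
  (G y).inverse ((1 / 2 : ℝ) •
    (fderiv ℝ G y u w + fderiv ℝ G y w u - ((fderiv ℝ G y).flip u).flip w))

/-- The curvature `R(u, v) w = ∇_u ∇_v w - ∇_v ∇_u w - ∇_[u,v] w` in coordinates. -/
def curvatureCoord (G : E → E →L[ℝ] E →L[ℝ] ℝ) (y u v w : E) : E :=
  fderiv ℝ (fun z => christoffel G z v w) y u - fderiv ℝ (fun z => christoffel G z u w) y v
    + christoffel G y u (christoffel G y v w) - christoffel G y v (christoffel G y u w)

end Coordinates

/-! ### Lorentzian manifolds -/

/-- A smooth metric of signature `(n - 1, 1)` on an `n`-dimensional manifold. -/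
structure LorentzMetric (n : ℕ) (M : Type*) [TopologicalSpace M]
    [ChartedSpace (EuclideanSpace ℝ (Fin n)) M] [IsManifold (𝓡 n) ∞ M] where
  /-- the scalar product on each tangent space -/
  val (x : M) : TangentSpace (𝓡 n) x →L[ℝ] TangentSpace (𝓡 n) x →L[ℝ] ℝ
  symm (x : M) (u v : TangentSpace (𝓡 n) x) : val x u v = val x v u
  /-- there is a timelike vector, and its orthogonal complement is positive definite -/
  signature (x : M) : ∃ t : TangentSpace (𝓡 n) x, val x t t < 0 ∧
    ∀ v : TangentSpace (𝓡 n) x, val x t v = 0 → v ≠ 0 → 0 < val x v v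
  smooth : ContMDiff (𝓡 n)
    ((𝓡 n).prod 𝓘(ℝ, EuclideanSpace ℝ (Fin n) →L[ℝ] EuclideanSpace ℝ (Fin n) →L[ℝ] ℝ)) ∞
    (fun x => TotalSpace.mk'
      (EuclideanSpace ℝ (Fin n) →L[ℝ] EuclideanSpace ℝ (Fin n) →L[ℝ] ℝ)
      (E := fun x : M => TangentSpace (𝓡 n) x →L[ℝ] TangentSpace (𝓡 n) x →L[ℝ] ℝ) x (val x))

section Ambient

variable {n : ℕ} {M : Type*} [TopologicalSpace M]
  [ChartedSpace (EuclideanSpace ℝ (Fin n)) M] [IsManifold (𝓡 n) ∞ M]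

/-- The differential at `y` of the preferred chart at `x`: coordinates of tangent vectors at `y`. -/
def chartDeriv (x y : M) : TangentSpace (𝓡 n) y →L[ℝ] EuclideanSpace ℝ (Fin n) :=
  mfderiv (𝓡 n) 𝓘(ℝ, EuclideanSpace ℝ (Fin n)) (extChartAt (𝓡 n) x) y

/-- The differential at `y` of the inverse of the preferred chart at `x`. -/
def chartSymmDeriv (x : M) (y : EuclideanSpace ℝ (Fin n)) :
    EuclideanSpace ℝ (Fin n) →L[ℝ] TangentSpace (𝓡 n) ((extChartAt (𝓡 n) x).symm y) :=
  mfderiv 𝓘(ℝ, EuclideanSpace ℝ (Fin n)) (𝓡 n) (extChartAt (𝓡 n) x).symm y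

/-- The coefficients of the metric in the preferred chart at `x`, as a function on the model space:
`(u, w) ↦ g(Dφ⁻¹ u, Dφ⁻¹ w)`. -/
def chartMetric (g : LorentzMetric n M) (x : M) (y : EuclideanSpace ℝ (Fin n)) :
    EuclideanSpace ℝ (Fin n) →L[ℝ] EuclideanSpace ℝ (Fin n) →L[ℝ] ℝ :=
  ContinuousLinearMap.bilinearComp (E := EuclideanSpace ℝ (Fin n)) (F := EuclideanSpace ℝ (Fin n))
    (g.val ((extChartAt (𝓡 n) x).symm y)) (chartSymmDeriv x y) (chartSymmDeriv x y)

/-- The curvature operator `R(u, v) w` of the Levi-Civita connection at `x`. -/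
def curvature (g : LorentzMetric n M) (x : M) (u v w : TangentSpace (𝓡 n) x) :
    TangentSpace (𝓡 n) x :=
  (chartDeriv x x).inverse (curvatureCoord (chartMetric g x) (extChartAt (𝓡 n) x x)
    (chartDeriv x x u) (chartDeriv x x v) (chartDeriv x x w))

/-- The isotropic sectional curvature of the plane spanned by an isotropic `N` and a nonisotropic
`P`: `K_N = (R(P, N) N, P) / (P, P)`. -/
def isotropicSectionalCurvature (g : LorentzMetric n M) (x : M) (N P : TangentSpace (𝓡 n) x) : ℝ :=
  g.val x (curvature g x P N N) P / g.val x P P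

variable {F : Type*} [NormedAddCommGroup F] [NormedSpace ℝ F]
  {W : Type*} [TopologicalSpace W] [ChartedSpace F W]

/-- The Levi-Civita covariant derivative `∇_v Y` of a vector field `Y` along a map `c : W → M`:
in the chart at `c p` it is `∂_v Y + Γ(dc v, Y)`. -/
def covAlong (g : LorentzMetric n M) (c : W → M) (Y : (q : W) → TangentSpace (𝓡 n) (c q))
    (p : W) (v : TangentSpace 𝓘(ℝ, F) p) : TangentSpace (𝓡 n) (c p) :=
  (chartDeriv (c p) (c p)).inverse
    (mvfderiv 𝓘(ℝ, F) (fun q => chartDeriv (c p) (c q) (Y q)) p v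
      + christoffel (chartMetric g (c p)) (extChartAt (𝓡 n) (c p) (c p))
          (chartDeriv (c p) (c p) (mfderiv 𝓘(ℝ, F) (𝓡 n) c p v)) (chartDeriv (c p) (c p) (Y p)))

/-- The differential `dy = dx + ∇Y` of the moving point `y = x + Y` of the affine tangent space
`T_x M`, where `x = c p` runs over the map `c` and `Y` is a vector field along `c`. -/
def pointDifferential (g : LorentzMetric n M) (c : W → M)
    (Y : (q : W) → TangentSpace (𝓡 n) (c q)) (p : W) (v : TangentSpace 𝓘(ℝ, F) p) :
    TangentSpace (𝓡 n) (c p) :=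
  (mfderiv 𝓘(ℝ, F) (𝓡 n) c p v : TangentSpace (𝓡 n) (c p)) + covAlong g c Y p v

/-- `b` is a field of bases of the tangent spaces of `M` that is parallel along the curve `c` on
the open interval `J`. -/
structure IsParallelFrameOn (g : LorentzMetric n M) (c : ℝ → M) (J : Set ℝ)
    (b : Fin n → (t : ℝ) → TangentSpace (𝓡 n) (c t)) : Prop where
  smooth (i : Fin n) : ContMDiffOn 𝓘(ℝ, ℝ) (𝓡 n).tangent ∞
    (fun t => (⟨c t, b i t⟩ : TangentBundle (𝓡 n) M)) J
  independent (t : ℝ) (ht : t ∈ J) : LinearIndependent ℝ (fun i => b i t)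
  parallel (i : Fin n) (t : ℝ) (ht : t ∈ J) : covAlong (F := ℝ) g c (b i) t (1 : ℝ) = 0

/-- `y` is the development, onto the tangent space at the point `c t₀`, of the moving point
`c t + Y t` along the curve `c`: the initial value is `Y t₀`, and the velocity of `y` at time `t` is
the parallel translate, from `c t` to `c t₀` along `c`, of `dc/dt + ∇Y/dt`. -/
def IsDevelopment (g : LorentzMetric n M) (c : ℝ → M) (Y : (t : ℝ) → TangentSpace (𝓡 n) (c t))
    (J : Set ℝ) (t₀ : ℝ) (y : ℝ → TangentSpace (𝓡 n) (c t₀)) : Prop :=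
  ∃ b : Fin n → (t : ℝ) → TangentSpace (𝓡 n) (c t), IsParallelFrameOn g c J b ∧ y t₀ = Y t₀ ∧
    ∀ t ∈ J, ∀ a : Fin n → ℝ,
      pointDifferential (F := ℝ) g c Y t (1 : ℝ) = ∑ i, a i • b i t →
        HasDerivAt y (∑ i, a i • b i t₀) t

end Ambient

/-! ### Lightlike hypersurfaces -/

section Hypersurface

variable {m : ℕ}
  {M : Type*} [TopologicalSpace M] [ChartedSpace (EuclideanSpace ℝ (Fin (m + 2))) M]
  [IsManifold (𝓡 (m + 2)) ∞ M]
  {V : Type*} [TopologicalSpace V] [ChartedSpace (EuclideanSpace ℝ (Fin (m + 1))) V]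
  [IsManifold (𝓡 (m + 1)) ∞ V]

/-- The differential `T_p V → T_{f p} M`. -/
def pushforward (f : V → M) (p : V) :
    TangentSpace (𝓡 (m + 1)) p →L[ℝ] TangentSpace (𝓡 (m + 2)) (f p) :=
  mfderiv (𝓡 (m + 1)) (𝓡 (m + 2)) f p

/-- The radical of the induced form on `T_p V`: the vectors orthogonal to all of `T_p V`. -/
def radical (g : LorentzMetric (m + 2) M) (f : V → M) (p : V) :
    Submodule ℝ (TangentSpace (𝓡 (m + 1)) p) where
  carrier := {N | ∀ w, g.val (f p) (pushforward f p N) (pushforward f p w) = 0}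
  add_mem' := by
    intro a b ha hb w
    have h := congrArg₂ (· + ·) (ha w) (hb w)
    simpa using h
  zero_mem' := by
    intro w
    simp
  smul_mem' := by
    intro r a ha w
    have h := congrArg (r * ·) (ha w)
    simpa using h

/-- An immersed hypersurface all of whose tangent hyperplanes are isotropic (tangent to the
isotropic cone), i.e. the induced form is degenerate on each of them. -/
structure IsLightlikeHypersurface (g : LorentzMetric (m + 2) M) (f : V → M) : Prop where
  smooth : ContMDiff (𝓡 (m + 1)) (𝓡 (m + 2)) ∞ f
  immersion (p : V) : Function.Injective (pushforward (m := m) f p)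
  lightlike (p : V) : radical g f p ≠ ⊥

/-- A nowhere zero smooth field `e₁` of isotropic vectors tangent to the hypersurface, on an open
set `O`. -/
structure IsNullFieldOn (g : LorentzMetric (m + 2) M) (f : V → M) (O : Set V)
    (e₁ : (q : V) → TangentSpace (𝓡 (m + 1)) q) : Prop where
  isOpen : IsOpen O
  smooth : ContMDiffOn (𝓡 (m + 1)) (𝓡 (m + 1)).tangent ∞
    (fun q => (⟨q, e₁ q⟩ : TangentBundle (𝓡 (m + 1)) V)) O
  ne_zero (q : V) (hq : q ∈ O) : e₁ q ≠ 0
  null (q : V) (hq : q ∈ O) : e₁ q ∈ radical g f q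

/-- The covariant derivative `∇_v e₁` in `M` of a tangent field `e₁` of the hypersurface. -/
def nablaTangent (g : LorentzMetric (m + 2) M) (f : V → M)
    (e₁ : (q : V) → TangentSpace (𝓡 (m + 1)) q) (p : V) (v : TangentSpace (𝓡 (m + 1)) p) :
    TangentSpace (𝓡 (m + 2)) (f p) :=
  covAlong (F := EuclideanSpace ℝ (Fin (m + 1))) g f (fun q => pushforward f q (e₁ q)) p v

/-- At `q` the second fundamental form `(u, w) ↦ (∇_u e₁, w)` belonging to `e₁` is `r` times the
first fundamental form. -/
def IsUmbilicFactorAt (g : LorentzMetric (m + 2) M) (f : V → M)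
    (e₁ : (q : V) → TangentSpace (𝓡 (m + 1)) q) (q : V) (r : ℝ) : Prop :=
  ∀ u w : TangentSpace (𝓡 (m + 1)) q,
    g.val (f q) (nablaTangent g f e₁ q u) (pushforward f q w)
      = r * g.val (f q) (pushforward f q u) (pushforward f q w)

/-- Totally umbilical: `λ_ab = λ g_ab` with `λ ≠ 0` (the totally geodesic case is excluded). -/
def IsTotallyUmbilical (g : LorentzMetric (m + 2) M) (f : V → M) : Prop :=
  ∀ (O : Set V) (e₁ : (q : V) → TangentSpace (𝓡 (m + 1)) q), IsNullFieldOn g f O e₁ →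
    ∀ q ∈ O, ∃ r : ℝ, r ≠ 0 ∧ IsUmbilicFactorAt g f e₁ q r

/-- The isotropic sectional curvature does not vanish on any isotropic 2-plane tangent to the
hypersurface. -/
def HasNonvanishingIsotropicCurvature (g : LorentzMetric (m + 2) M) (f : V → M) : Prop :=
  ∀ (p : V) (N P : TangentSpace (𝓡 (m + 1)) p), N ∈ radical g f p → N ≠ 0 → P ∉ radical g f p →
    isotropicSectionalCurvature g (f p) (pushforward f p N) (pushforward f p P) ≠ 0

/-- The point `x + Y`, `x = f p`, of the isotropic line `x + s e₁` is a singular point: for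
`Y = s e₁`, the differential `w ↦ w + s ∇_w e₁` of `x + s e₁` is degenerate modulo `e₁`, i.e.
`det (δ_b^a + s λ_b^a) = 0`. -/
def IsSingularPoint (g : LorentzMetric (m + 2) M) (f : V → M) (p : V)
    (Y : TangentSpace (𝓡 (m + 2)) (f p)) : Prop :=
  ∃ (O : Set V) (e₁ : (q : V) → TangentSpace (𝓡 (m + 1)) q) (s : ℝ),
    p ∈ O ∧ IsNullFieldOn g f O e₁ ∧ Y = s • pushforward f p (e₁ p) ∧
    ∃ w : TangentSpace (𝓡 (m + 1)) p, w ∉ radical g f p ∧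
      pushforward f p w + s • nablaTangent g f e₁ p w
        ∈ Submodule.span ℝ {pushforward f p (e₁ p)}

/-- A smooth isotropic frame `e₁, e_a, eₙ` along the hypersurface on an open set `O`: `e₁, e_a` is a
basis of the tangent hyperplane, `e₁` and `eₙ` are isotropic and orthogonal to the `e_a`, and
`(e₁, eₙ) = -1`. -/
structure IsIsotropicFrameOn (g : LorentzMetric (m + 2) M) (f : V → M) (O : Set V)
    (e₁ : (q : V) → TangentSpace (𝓡 (m + 1)) q)
    (e : Fin m → (q : V) → TangentSpace (𝓡 (m + 1)) q)
    (eₙ : (q : V) → TangentSpace (𝓡 (m + 2)) (f q)) : Prop where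
  nullField : IsNullFieldOn g f O e₁
  smooth_screen (a : Fin m) : ContMDiffOn (𝓡 (m + 1)) (𝓡 (m + 1)).tangent ∞
    (fun q => (⟨q, e a q⟩ : TangentBundle (𝓡 (m + 1)) V)) O
  smooth_transversal : ContMDiffOn (𝓡 (m + 1)) (𝓡 (m + 2)).tangent ∞
    (fun q => (⟨f q, eₙ q⟩ : TangentBundle (𝓡 (m + 2)) M)) O
  independent (q : V) (hq : q ∈ O) : LinearIndependent ℝ (Fin.cons (e₁ q) (fun a => e a q) :
    Fin (m + 1) → TangentSpace (𝓡 (m + 1)) q)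
  isotropic (q : V) (hq : q ∈ O) : g.val (f q) (eₙ q) (eₙ q) = 0
  conjugate (q : V) (hq : q ∈ O) (a : Fin m) : g.val (f q) (pushforward f q (e a q)) (eₙ q) = 0
  normalized (q : V) (hq : q ∈ O) : g.val (f q) (pushforward f q (e₁ q)) (eₙ q) = -1

/-- The `e₁`-component of a vector `X` in an isotropic frame; it is `-(X, eₙ)` because `eₙ` is
orthogonal to `e_a` and `eₙ`, and `(e₁, eₙ) = -1`. -/
def component₁ (g : LorentzMetric (m + 2) M) (f : V → M)
    (eₙ : (q : V) → TangentSpace (𝓡 (m + 2)) (f q)) (q : V)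
    (X : TangentSpace (𝓡 (m + 2)) (f q)) : ℝ :=
  -g.val (f q) X (eₙ q)

/-- The basis form `ω¹` of an isotropic frame. -/
def omega₁ (g : LorentzMetric (m + 2) M) (f : V → M)
    (eₙ : (q : V) → TangentSpace (𝓡 (m + 2)) (f q)) (q : V)
    (v : TangentSpace (𝓡 (m + 1)) q) : ℝ :=
  component₁ g f eₙ q (pushforward f q v)

/-- The connection form `ω₁¹` of an isotropic frame: the `e₁`-component of `∇_v e₁`. -/
def omega₁₁ (g : LorentzMetric (m + 2) M) (f : V → M)
    (e₁ : (q : V) → TangentSpace (𝓡 (m + 1)) q)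
    (eₙ : (q : V) → TangentSpace (𝓡 (m + 2)) (f q)) (q : V)
    (v : TangentSpace (𝓡 (m + 1)) q) : ℝ :=
  component₁ g f eₙ q (nablaTangent g f e₁ q v)

/-- The components `R¹_{1ab}` of the curvature tensor in an isotropic frame: the `e₁`-component of
`R(e_a, e_b) e₁`. -/
def curvatureComponent (g : LorentzMetric (m + 2) M) (f : V → M)
    (e₁ : (q : V) → TangentSpace (𝓡 (m + 1)) q)
    (e : Fin m → (q : V) → TangentSpace (𝓡 (m + 1)) q)
    (eₙ : (q : V) → TangentSpace (𝓡 (m + 2)) (f q)) (q : V) (a b : Fin m) : ℝ :=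
  component₁ g f eₙ q (curvature g (f q) (pushforward f q (e a q)) (pushforward f q (e b q))
    (pushforward f q (e₁ q)))

/-- On `O` the distribution `S` is given by the equation `ω¹ = 0`, i.e. it is spanned by the
vectors `e_a` of the frame. -/
def IsGivenByOmega (g : LorentzMetric (m + 2) M) (f : V → M)
    (S : (q : V) → Submodule ℝ (TangentSpace (𝓡 (m + 1)) q)) (O : Set V)
    (eₙ : (q : V) → TangentSpace (𝓡 (m + 2)) (f q)) : Prop :=
  ∀ q ∈ O, ∀ v : TangentSpace (𝓡 (m + 1)) q, v ∈ S q ↔ omega₁ g f eₙ q v = 0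

/-- A smooth screen distribution: near each point it is spanned by the vectors `e_a` of a smooth
isotropic frame. -/
def IsScreenDistribution (g : LorentzMetric (m + 2) M) (f : V → M)
    (S : (q : V) → Submodule ℝ (TangentSpace (𝓡 (m + 1)) q)) : Prop :=
  ∀ p : V, ∃ (O : Set V) (e₁ : (q : V) → TangentSpace (𝓡 (m + 1)) q)
    (e : Fin m → (q : V) → TangentSpace (𝓡 (m + 1)) q)
    (eₙ : (q : V) → TangentSpace (𝓡 (m + 2)) (f q)),
    p ∈ O ∧ IsIsotropicFrameOn g f O e₁ e eₙ ∧
      ∀ q ∈ O, S q = Submodule.span ℝ (Set.range fun a => e a q)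

/-- The frame is adapted to the umbilic factor `lam` of `e₁`: the 1-form
`dλ - λ ω₁¹ + λ² ω¹` is a multiple `μ ω¹` of `ω¹` on `O`. -/
def IsReducedFrameOn (g : LorentzMetric (m + 2) M) (f : V → M) (O : Set V)
    (e₁ : (q : V) → TangentSpace (𝓡 (m + 1)) q)
    (eₙ : (q : V) → TangentSpace (𝓡 (m + 2)) (f q)) (lam : V → ℝ) : Prop :=
  ∃ mu : V → ℝ, ∀ q ∈ O, ∀ v : TangentSpace (𝓡 (m + 1)) q,
    mvfderiv (𝓡 (m + 1)) lam q v - lam q * omega₁₁ g f e₁ eₙ q v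
      + lam q ^ 2 * omega₁ g f eₙ q v = mu q * omega₁ g f eₙ q v

/-- The screen distribution singled out by the geometry of an umbilical hypersurface: an isotropic
frame describes `S` by `ω¹ = 0` exactly if it is reduced. -/
def IsIntrinsicScreen (g : LorentzMetric (m + 2) M) (f : V → M)
    (S : (q : V) → Submodule ℝ (TangentSpace (𝓡 (m + 1)) q)) : Prop :=
  IsScreenDistribution g f S ∧
  ∀ (O : Set V) (e₁ : (q : V) → TangentSpace (𝓡 (m + 1)) q)
    (e : Fin m → (q : V) → TangentSpace (𝓡 (m + 1)) q)
    (eₙ : (q : V) → TangentSpace (𝓡 (m + 2)) (f q)) (lam : V → ℝ),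
    IsIsotropicFrameOn g f O e₁ e eₙ → (∀ q ∈ O, IsUmbilicFactorAt g f e₁ q (lam q)) →
      (IsGivenByOmega g f S O eₙ ↔ IsReducedFrameOn g f O e₁ eₙ lam)

/-- Through every point passes an `m`-dimensional smooth integral manifold of the
`m`-dimensional distribution `S`. -/
def IsIntegrable (S : (q : V) → Submodule ℝ (TangentSpace (𝓡 (m + 1)) q)) : Prop :=
  ∀ p : V, ∃ (U : Set (EuclideanSpace ℝ (Fin m))) (φ : EuclideanSpace ℝ (Fin m) → V),
    IsOpen U ∧ 0 ∈ U ∧ φ 0 = p ∧ ContMDiffOn (𝓡 m) (𝓡 (m + 1)) ∞ φ U ∧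
    ∀ u ∈ U, Set.range (mfderiv (𝓡 m) (𝓡 (m + 1)) φ u)
      = (S (φ u) : Set (TangentSpace (𝓡 (m + 1)) (φ u)))

end Hypersurface

end Lightlike

end

/-! Rescaling a null field `e₁` by a function rescales its umbilic factor `λ` by the same function,
because the derivative of the function only contributes a multiple of `e₁`, which is orthogonal to
the hypersurface. Hence `N = e₁ / λ` does not depend on `e₁`; it is a global smooth null field of
umbilic factor `1`. Only multiples of `N` are orthogonal to the tangent hyperplane, so `∇_v N = v +
θ(v) N` for a smooth 1-form `θ` on `V` (`IsLightlikeHypersurface.exists_canonicalField`). Every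
assertion is read off from `θ`.

Modulo `e₁`, the map `w ↦ w + s ∇_w e₁` is multiplication by `1 + s λ`, so the singular point is `F
= x - N`, and `dF(v) = v - ∇_v N = -θ(v) N`. Its values are null, and it vanishes exactly on `S =
ker θ`. A development preserves scalar products, because the Gram matrix of a parallel frame is
constant; this gives the statement about curves.

Differentiating once more, `R(u, v) N = dθ(u, v) N + θ(v) u - θ(u) v` (`curvature_of_covDir_eq`).
With `u = P` and `v = N` this makes the isotropic sectional curvature equal to `θ(N)` for every `P`.
So the curvature hypothesis says `θ(N) ≠ 0`: the kernel of `θ` is a complement of the null line, and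
`dF` maps onto that line. For an isotropic frame with `e₁ = λ N` one computes `dλ - λ ω₁¹ + λ² ω¹ =
-λ θ` (`reduced_form_eq`), so the frame is reduced exactly when `ω¹` and `θ` have the same kernel.

On `S` the curvature formula shrinks to `R(e_a, e_b) e₁ = dθ(e_a, e_b) e₁`. Thus `R¹_{1ab} = 0`
means that `dθ` vanishes on `ker θ`, which by Frobenius is integrability. The Frobenius theorem for
one form is proved directly, by solving `dz = a(x, z)` along rays
(`exists_hasFDerivAt_of_integrable`, `exists_integral_graph`). -/

set_option maxSynthPendingDepth 3
set_option linter.unusedSectionVars false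

noncomputable section

namespace Lightlike

/-! ### Levi-Civita calculus in coordinates. -/

section Coordinates

variable {E : Type*} [NormedAddCommGroup E] [NormedSpace ℝ E]
  {E' : Type*} [NormedAddCommGroup E'] [NormedSpace ℝ E']

lemma christoffel_add_left (G : E → E →L[ℝ] E →L[ℝ] ℝ) (y u u' w : E) :
    christoffel G y (u + u') w = christoffel G y u w + christoffel G y u' w := by
  unfold christoffel
  rw [← map_add, ← smul_add]
  congr 2
  ext t
  simp only [sub_apply, add_apply, map_add, ContinuousLinearMap.flip_apply]
  ring

lemma christoffel_smul_left (G : E → E →L[ℝ] E →L[ℝ] ℝ) (y u w : E) (r : ℝ) :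
    christoffel G y (r • u) w = r • christoffel G y u w := by
  unfold christoffel
  rw [← map_smul, smul_comm r (1 / 2 : ℝ)]
  congr 2
  ext t
  simp only [sub_apply, add_apply, map_smul, ContinuousLinearMap.flip_apply, smul_apply,
    smul_eq_mul]
  ring

lemma christoffel_add_right (G : E → E →L[ℝ] E →L[ℝ] ℝ) (y u w w' : E) :
    christoffel G y u (w + w') = christoffel G y u w + christoffel G y u w' := by
  unfold christoffel
  rw [← map_add, ← smul_add]
  congr 2
  ext t
  simp only [sub_apply, add_apply, map_add, ContinuousLinearMap.flip_apply]
  ring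

lemma christoffel_smul_right (G : E → E →L[ℝ] E →L[ℝ] ℝ) (y u w : E) (r : ℝ) :
    christoffel G y u (r • w) = r • christoffel G y u w := by
  unfold christoffel
  rw [← map_smul, smul_comm r (1 / 2 : ℝ)]
  congr 2
  ext t
  simp only [sub_apply, add_apply, map_smul, ContinuousLinearMap.flip_apply, smul_apply,
    smul_eq_mul]
  ring

/-- The Christoffel symbols as a continuous bilinear map. -/
def christoffelMap [FiniteDimensional ℝ E] (G : E → E →L[ℝ] E →L[ℝ] ℝ) (y : E) :
    E →L[ℝ] E →L[ℝ] E :=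
  LinearMap.toContinuousLinearMap
    ((LinearMap.toContinuousLinearMap : (E →ₗ[ℝ] E) ≃ₗ[ℝ] (E →L[ℝ] E)).toLinearMap ∘ₗ
      LinearMap.mk₂ ℝ (christoffel G y) (christoffel_add_left G y)
        (fun r u w => christoffel_smul_left G y u w r) (christoffel_add_right G y)
        (fun r u w => christoffel_smul_right G y u w r))

@[simp]
lemma christoffelMap_apply [FiniteDimensional ℝ E] (G : E → E →L[ℝ] E →L[ℝ] ℝ) (y u w : E) :
    christoffelMap G y u w = christoffel G y u w := by
  simp [christoffelMap]

lemma contDiffAt_inverse_clm {F : Type*} [NormedAddCommGroup F] [NormedSpace ℝ F]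
    [CompleteSpace E] {A : E' → E →L[ℝ] F} {y : E'}
    (hA : ContDiffAt ℝ ∞ A y) (hi : (A y).IsInvertible) :
    ContDiffAt ℝ ∞ (fun z => (A z).inverse) y := by
  obtain ⟨e, he⟩ := hi
  have h : ContDiffAt ℝ ∞ (ContinuousLinearMap.inverse : (E →L[ℝ] F) → F →L[ℝ] E) (A y) := by
    rw [← he]; exact contDiffAt_map_inverse e
  exact h.comp y hA

/-- Evaluation on a basis identifies `E →L[ℝ] F` with a finite power of `F`, so smoothness may be
tested on single vectors. -/
lemma contDiffAt_clm_of_apply [FiniteDimensional ℝ E] {F : Type*} [NormedAddCommGroup F]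
    [NormedSpace ℝ F] {A : E' → E →L[ℝ] F} {y : E'}
    (h : ∀ u, ContDiffAt ℝ ∞ (fun z => A z u) y) : ContDiffAt ℝ ∞ A y := by
  have hd : Module.finrank ℝ E = Module.finrank ℝ (Fin (Module.finrank ℝ E) → ℝ) :=
    (Module.finrank_fin_fun ℝ).symm
  let e₁ := ContinuousLinearEquiv.ofFinrankEq hd
  let e₂ := (e₁.arrowCongr (1 : F ≃L[ℝ] F)).trans
    (ContinuousLinearEquiv.piRing (Fin (Module.finrank ℝ E)))
  rw [← Function.id_comp A, ← e₂.symm_comp_self]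
  exact e₂.symm.contDiff.contDiffAt.comp y (contDiffAt_pi.2 fun i => h _)

lemma contDiffAt_christoffelMap [FiniteDimensional ℝ E] {G : E → E →L[ℝ] E →L[ℝ] ℝ} {y : E}
    (hG : ContDiffAt ℝ ∞ G y) (hi : (G y).IsInvertible) :
    ContDiffAt ℝ ∞ (christoffelMap G) y := by
  have : CompleteSpace E := FiniteDimensional.complete ℝ E
  have h2 : ContDiffAt ℝ ∞ (fderiv ℝ G) y := hG.fderiv_right (by simp)
  refine contDiffAt_clm_of_apply fun u => contDiffAt_clm_of_apply fun w => ?_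
  simp only [christoffelMap_apply, christoffel]
  refine (contDiffAt_inverse_clm hG hi).clm_apply (ContDiffAt.const_smul _ ?_)
  refine contDiffAt_clm_of_apply fun t => ?_
  simp only [sub_apply, add_apply, ContinuousLinearMap.flip_apply]
  have h3 : ∀ a b c : E, ContDiffAt ℝ ∞ (fun z => fderiv ℝ G z a b c) y := fun a b c =>
    ((h2.clm_apply contDiffAt_const).clm_apply contDiffAt_const).clm_apply contDiffAt_const
  exact ((h3 u w t).add (h3 w u t)).sub (h3 t u w)

lemma metric_christoffel {G : E → E →L[ℝ] E →L[ℝ] ℝ} {y : E} (hi : (G y).IsInvertible)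
    (u w t : E) :
    G y (christoffel G y u w) t
      = (1 / 2 : ℝ) * (fderiv ℝ G y u w t + fderiv ℝ G y w u t - fderiv ℝ G y t u w) := by
  have : G y (christoffel G y u w) = (1 / 2 : ℝ) •
      (fderiv ℝ G y u w + fderiv ℝ G y w u - ((fderiv ℝ G y).flip u).flip w) := by
    obtain ⟨e, he⟩ := hi
    rw [christoffel, ← he]; simp
  rw [this]; simp

lemma fderiv_metric_symm {G : E → E →L[ℝ] E →L[ℝ] ℝ} {y : E} (hG : DifferentiableAt ℝ G y)
    (hs : ∀ᶠ z in 𝓝 y, ∀ a b, G z a b = G z b a) (v a b : E) :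
    fderiv ℝ G y v a b = fderiv ℝ G y v b a := by
  have key : ∀ a b, fderiv ℝ (fun z => G z a b) y v = fderiv ℝ G y v a b := by
    intro a b
    have := ((hG.hasFDerivAt.clm_apply (hasFDerivAt_const a y)).clm_apply
      (hasFDerivAt_const b y)).fderiv
    rw [this]; simp
  rw [← key, ← key]
  have : (fun z => G z a b) =ᶠ[𝓝 y] fun z => G z b a := hs.mono fun z hz => hz a b
  rw [this.fderiv_eq]

lemma christoffel_symm {G : E → E →L[ℝ] E →L[ℝ] ℝ} {y : E} (hG : DifferentiableAt ℝ G y)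
    (hs : ∀ᶠ z in 𝓝 y, ∀ a b, G z a b = G z b a) (u w : E) :
    christoffel G y u w = christoffel G y w u := by
  unfold christoffel
  congr 2
  ext t
  simp only [sub_apply, add_apply,
    ContinuousLinearMap.flip_apply]
  rw [fderiv_metric_symm hG hs t u w]; ring

/-- Metric compatibility: in the sum of the two Koszul expressions the terms differentiated along
`a` and `b` cancel, and the `v`-terms add up. -/
lemma fderiv_metric_eq {G : E → E →L[ℝ] E →L[ℝ] ℝ} {y : E} (hG : DifferentiableAt ℝ G y)
    (hi : (G y).IsInvertible) (hs : ∀ᶠ z in 𝓝 y, ∀ a b, G z a b = G z b a) (v a b : E) :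
    fderiv ℝ G y v a b = G y (christoffel G y v a) b + G y a (christoffel G y v b) := by
  rw [hs.self_of_nhds a, metric_christoffel hi, metric_christoffel hi,
    fderiv_metric_symm hG hs v b a, fderiv_metric_symm hG hs a v b,
    fderiv_metric_symm hG hs b v a]
  ring

/-- Differentiating `G = τ^* G'` gives three terms. In the Koszul combination the second derivatives
of `τ` cancel by symmetry, except for `fderiv (fderiv τ) u w`, which occurs twice and absorbs the
factor `1 / 2`. This inhomogeneous term makes covariant derivatives independent of the chart. -/
lemma christoffel_pullback {G : E → E →L[ℝ] E →L[ℝ] ℝ} {G' : E' → E' →L[ℝ] E' →L[ℝ] ℝ}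
    {τ : E → E'} {y : E} (hτ : ContDiffAt ℝ ∞ τ y) (hτi : (fderiv ℝ τ y).IsInvertible)
    (hG' : DifferentiableAt ℝ G' (τ y)) (hGd : DifferentiableAt ℝ G y) (hi :
        (G y).IsInvertible) (hi' : (G' (τ y)).IsInvertible)
    (hs : ∀ᶠ z in 𝓝 (τ y), ∀ a b, G' z a b = G' z b a)
    (hG : ∀ᶠ z in 𝓝 y, ∀ a b, G z a b = G' (τ z) (fderiv ℝ τ z a) (fderiv ℝ τ z b)) (u w : E) :
    fderiv ℝ τ y (christoffel G y u w)
      = fderiv ℝ (fderiv ℝ τ) y u w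
        + christoffel G' (τ y) (fderiv ℝ τ y u) (fderiv ℝ τ y w) := by
  have hd : DifferentiableAt ℝ (fderiv ℝ τ) y :=
    (hτ.fderiv_right (m := 1) (by norm_cast)).differentiableAt (by simp)
  have hsym : ∀ a b, fderiv ℝ (fderiv ℝ τ) y a b = fderiv ℝ (fderiv ℝ τ) y b a := by
    intro a b
    exact (hτ.isSymmSndFDerivAt (by
      rw [minSmoothness_of_isRCLikeNormedField]; exact WithTop.coe_le_coe.2 le_top)) a b
  have hD : ∀ v a b, fderiv ℝ G y v a b = fderiv ℝ G' (τ y) (fderiv ℝ τ y v) (fderiv ℝ τ y a)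
      (fderiv ℝ τ y b) + G' (τ y) (fderiv ℝ (fderiv ℝ τ) y v a) (fderiv ℝ τ y b)
      + G' (τ y) (fderiv ℝ τ y a) (fderiv ℝ (fderiv ℝ τ) y v b) := by
    intro v a b
    have hl : ∀ (a b : E), HasFDerivAt (fun z => G z a b) _ y := fun a b =>
      ((hGd.hasFDerivAt.clm_apply (hasFDerivAt_const a y)).clm_apply (hasFDerivAt_const b y))
    have hτd := (hτ.differentiableAt (by simp)).hasFDerivAt
    have hr := ((hG'.hasFDerivAt.comp y hτd).clm_apply
      (hd.hasFDerivAt.clm_apply (hasFDerivAt_const a y))).clm_apply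
      (hd.hasFDerivAt.clm_apply (hasFDerivAt_const b y))
    have he : (fun z => G z a b) =ᶠ[𝓝 y]
        fun z => G' (τ z) (fderiv ℝ τ z a) (fderiv ℝ τ z b) := hG.mono fun z hz => hz a b
    have := congrArg (fun L => L v) ((hl a b).unique (hr.congr_of_eventuallyEq he))
    simp at this
    rw [this]; ring
  obtain ⟨e, he⟩ := hi'
  apply e.injective
  obtain ⟨T, hT⟩ := hτi
  ext t'
  obtain ⟨t, rfl⟩ := T.surjective t'
  have hTt : T t = fderiv ℝ τ y t := by rw [← hT]; rfl
  have hee : ∀ x, e x = G' (τ y) x := by intro x; rw [← he]; rfl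
  rw [hTt, hee, hee, map_add, add_apply,
    metric_christoffel (he ▸ ⟨e, rfl⟩ : (G' (τ y)).IsInvertible),
    ← hG.self_of_nhds, metric_christoffel hi, hD, hD, hD, hsym t u, hsym t w, hsym w u,
    hs.self_of_nhds (fderiv ℝ (fderiv ℝ τ) y u t), hs.self_of_nhds (fderiv ℝ τ y u)]
  ring

/-- Coordinate expression of the covariant derivative, in the direction `v`, of a vector field `X`
along a map `c`. -/
def coordCov (G : E → E →L[ℝ] E →L[ℝ] ℝ) (c X : E' → E) (v y : E') : E :=
  fderiv ℝ X y v + christoffel G (c y) (fderiv ℝ c y v) (X y)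

lemma contDiffAt_coordCov [FiniteDimensional ℝ E] {G : E → E →L[ℝ] E →L[ℝ] ℝ} {c X : E' → E}
    {y : E'} (hG : ContDiffAt ℝ ∞ G (c y)) (hi : (G (c y)).IsInvertible)
    (hc : ContDiffAt ℝ ∞ c y) (hX : ContDiffAt ℝ ∞ X y) (v : E') :
    ContDiffAt ℝ ∞ (coordCov G c X v) y := by
  unfold coordCov
  simp only [← christoffelMap_apply]
  have hΓ : ContDiffAt ℝ ∞ (fun z => christoffelMap G (c z)) y :=
    (contDiffAt_christoffelMap hG hi).comp y hc
  exact ((hX.fderiv_right (by simp)).clm_apply contDiffAt_const).add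
    ((hΓ.clm_apply ((hc.fderiv_right (by simp)).clm_apply contDiffAt_const)).clm_apply hX)

/-- The directions `u`, `v` are constant, so no bracket term occurs. The second derivatives of `c`
and `X` are symmetric and drop out of the difference, as do the mixed terms `Γ(∂c, ∂X)`; what
remains is `∂Γ` and `ΓΓ`. -/
lemma coordCov_comm [FiniteDimensional ℝ E] {G : E → E →L[ℝ] E →L[ℝ] ℝ} {c X : E' → E}
    {y : E'} (hG : ContDiffAt ℝ ∞ G (c y)) (hi : (G (c y)).IsInvertible)
    (hs : ∀ᶠ z in 𝓝 (c y), ∀ a b, G z a b = G z b a)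
    (hc : ContDiffAt ℝ ∞ c y) (hX : ContDiffAt ℝ ∞ X y) (u v : E') :
    coordCov G c (coordCov G c X v) u y - coordCov G c (coordCov G c X u) v y
      = curvatureCoord G (c y) (fderiv ℝ c y u) (fderiv ℝ c y v) (X y) := by
  have hΓ : ContDiffAt ℝ ∞ (christoffelMap G) (c y) := contDiffAt_christoffelMap hG hi
  have hΓd := (hΓ.differentiableAt (by simp)).hasFDerivAt
  have hcd := (hc.differentiableAt (by simp)).hasFDerivAt
  have hXd := (hX.differentiableAt (by simp)).hasFDerivAt
  have hc2 := ((hc.fderiv_right (m := ∞) (by simp)).differentiableAt (by simp)).hasFDerivAt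
  have hX2 := ((hX.fderiv_right (m := ∞) (by simp)).differentiableAt (by simp)).hasFDerivAt
  have h2 : (2 : WithTop ℕ∞) ≤ ∞ := WithTop.coe_le_coe.2 le_top
  have hcs : ∀ a b, fderiv ℝ (fderiv ℝ c) y a b = fderiv ℝ (fderiv ℝ c) y b a := fun a b =>
    (hc.isSymmSndFDerivAt (by rwa [minSmoothness_of_isRCLikeNormedField])) a b
  have hXs : ∀ a b, fderiv ℝ (fderiv ℝ X) y a b = fderiv ℝ (fderiv ℝ X) y b a := fun a b =>
    (hX.isSymmSndFDerivAt (by rwa [minSmoothness_of_isRCLikeNormedField])) a b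
  have hD : ∀ u v, fderiv ℝ (coordCov G c X v) y u = fderiv ℝ (fderiv ℝ X) y u v
      + fderiv ℝ (christoffelMap G) (c y) (fderiv ℝ c y u) (fderiv ℝ c y v) (X y)
      + christoffelMap G (c y) (fderiv ℝ (fderiv ℝ c) y u v) (X y)
      + christoffelMap G (c y) (fderiv ℝ c y v) (fderiv ℝ X y u) := by
    intro u v
    have h := (hX2.clm_apply (hasFDerivAt_const v y)).add
      (((hΓd.comp y hcd).clm_apply (hc2.clm_apply (hasFDerivAt_const v y))).clm_apply hXd)
    have h' := congrArg (fun L => L u) h.fderiv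
    have e : coordCov G c X v = (fun z => fderiv ℝ X z v) + fun z =>
        ((christoffelMap G ∘ c) z (fderiv ℝ c z v)) (X z) := by
      funext z; simp [coordCov]
    rw [e]
    refine h'.trans ?_
    simp
    abel
  have hR : ∀ a b w, fderiv ℝ (fun z => christoffel G z a w) (c y) b
      = fderiv ℝ (christoffelMap G) (c y) b a w := by
    intro a b w
    have h := (hΓd.clm_apply (hasFDerivAt_const a _)).clm_apply (hasFDerivAt_const w _)
    have h' := congrArg (fun L => L b) h.fderiv
    simpa using h'
  have hsym := christoffel_symm (hG.differentiableAt (by simp)) hs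
  unfold curvatureCoord
  rw [hR, hR]
  have h1 : ∀ (Y : E' → E) (a : E'), coordCov G c Y a y
      = fderiv ℝ Y y a + christoffel G (c y) (fderiv ℝ c y a) (Y y) := fun _ _ => rfl
  rw [h1 (coordCov G c X v) u, h1 (coordCov G c X u) v, hD, hD, hXs u v, hcs u v]
  simp only [coordCov, christoffelMap_apply, christoffel_add_right]
  abel

lemma coordCov_fderiv_comm {G : E → E →L[ℝ] E →L[ℝ] ℝ} {c : E' → E}
    {y : E'} (hG : DifferentiableAt ℝ G (c y))
    (hs : ∀ᶠ z in 𝓝 (c y), ∀ a b, G z a b = G z b a)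
    (hc : ContDiffAt ℝ ∞ c y) (u v : E') :
    coordCov G c (fun z => fderiv ℝ c z v) u y = coordCov G c (fun z => fderiv ℝ c z u) v y := by
  have hc2 := ((hc.fderiv_right (m := ∞) (by simp)).differentiableAt (by simp)).hasFDerivAt
  have h2 : (2 : WithTop ℕ∞) ≤ ∞ := WithTop.coe_le_coe.2 le_top
  have hcs : ∀ a b, fderiv ℝ (fderiv ℝ c) y a b = fderiv ℝ (fderiv ℝ c) y b a := fun a b =>
    (hc.isSymmSndFDerivAt (by rwa [minSmoothness_of_isRCLikeNormedField])) a b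
  have hD : ∀ u v, fderiv ℝ (fun z => fderiv ℝ c z v) y u = fderiv ℝ (fderiv ℝ c) y u v := by
    intro u v
    have h' := congrArg (fun L => L u) (hc2.clm_apply (hasFDerivAt_const v y)).fderiv
    simpa using h'
  unfold coordCov
  rw [hD, hD, hcs, christoffel_symm hG hs]

lemma curvatureCoord_smul (G : E → E →L[ℝ] E →L[ℝ] ℝ) (y u v w : E) (r : ℝ) :
    curvatureCoord G y u v (r • w) = r • curvatureCoord G y u v w := by
  unfold curvatureCoord
  simp only [christoffel_smul_right]
  have h : ∀ a : E, (fun z => r • christoffel G z a w) = r • fun z => christoffel G z a w :=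
    fun a => rfl
  rw [h, h, fderiv_const_smul_field, fderiv_const_smul_field]
  simp [smul_sub, smul_add]

end Coordinates

/-! ### Tangent vectors and smooth fields in the preferred charts. -/

section Charts

variable {n : ℕ} {M : Type*} [TopologicalSpace M]
  [ChartedSpace (EuclideanSpace ℝ (Fin n)) M] [IsManifold (𝓡 n) ∞ M]

lemma isManifold_one : IsManifold (𝓡 n) 1 M := IsManifold.of_le (n := ∞) (by norm_cast)

/-- The tangent space at `x` is modelled through the preferred chart at `x` itself, whose
differential there is the identity. -/
lemma chartDeriv_self (x : M) (v : TangentSpace (𝓡 n) x) : chartDeriv x x v = v := by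
  have := isManifold_one (n := n) (M := M)
  unfold chartDeriv
  rw [mfderiv_extChartAt_self]
  rfl

lemma inverse_chartDeriv_self (x : M) (v : EuclideanSpace ℝ (Fin n)) :
    (chartDeriv x x).inverse v = (v : EuclideanSpace ℝ (Fin n)) := by
  have := isManifold_one (n := n) (M := M)
  unfold chartDeriv
  rw [mfderiv_extChartAt_self]
  erw [ContinuousLinearMap.inverse_id]
  rfl

lemma chartDeriv_isInvertible {x y : M} (hy : y ∈ (extChartAt (𝓡 n) x).source) :
    (chartDeriv (n := n) x y).IsInvertible := by
  have := isManifold_one (n := n) (M := M)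
  exact isInvertible_mfderiv_extChartAt hy

lemma chartDeriv_injective {x y : M} (hy : y ∈ (extChartAt (𝓡 n) x).source) :
    Function.Injective (chartDeriv (n := n) x y) := by
  obtain ⟨e, he⟩ := chartDeriv_isInvertible (n := n) hy
  rw [← he]; exact e.injective

lemma chartSymmDeriv_chartDeriv {x y : M} (hy : y ∈ (extChartAt (𝓡 n) x).source)
    (v : TangentSpace (𝓡 n) y) :
    chartSymmDeriv x (extChartAt (𝓡 n) x y) (chartDeriv x y v) = (v : EuclideanSpace ℝ (Fin n)) :=
        by
  have := isManifold_one (n := n) (M := M)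
  have h := mfderivWithin_extChartAt_symm_comp_mfderiv_extChartAt' hy
  rw [ModelWithCorners.range_eq_univ, mfderivWithin_univ] at h
  exact congrArg (fun L => L v) h

lemma chartDeriv_chartSymmDeriv {x : M} {z : EuclideanSpace ℝ (Fin n)}
    (hz : z ∈ (extChartAt (𝓡 n) x).target) (v : EuclideanSpace ℝ (Fin n)) :
    chartDeriv x ((extChartAt (𝓡 n) x).symm z) (chartSymmDeriv x z v) = v := by
  have := isManifold_one (n := n) (M := M)
  have h := mfderiv_extChartAt_comp_mfderivWithin_extChartAt_symm hz
  rw [ModelWithCorners.range_eq_univ, mfderivWithin_univ] at h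
  exact congrArg (fun L => L v) h

lemma trivializationAt_apply_snd (x y : M) (hy : y ∈ (extChartAt (𝓡 n) x).source)
    (v : TangentSpace (𝓡 n) y) :
    (trivializationAt (EuclideanSpace ℝ (Fin n)) (TangentSpace (𝓡 n)) x
      (⟨y, v⟩ : TangentBundle (𝓡 n) M)).2 = chartDeriv x y v := by
  have := isManifold_one (n := n) (M := M)
  rw [extChartAt_source] at hy
  have h := TangentBundle.continuousLinearMapAt_trivializationAt (𝕜 := ℝ) (I := 𝓡 n) hy
  unfold chartDeriv
  rw [← h, Trivialization.continuousLinearMapAt_apply, Trivialization.linearMapAt_apply,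
    if_pos (by simpa using hy)]

variable {F : Type*} [NormedAddCommGroup F] [NormedSpace ℝ F]
  {W : Type*} [TopologicalSpace W] [ChartedSpace F W]

lemma contMDiffAt_totalSpace_iff (x : M) {c : W → M} {X : (q : W) → TangentSpace (𝓡 n) (c q)}
    {p : W} (hp : c p ∈ (extChartAt (𝓡 n) x).source) :
    ContMDiffAt 𝓘(ℝ, F) (𝓡 n).tangent ∞ (fun q => (⟨c q, X q⟩ : TangentBundle (𝓡 n) M)) p ↔
      ContMDiffAt 𝓘(ℝ, F) (𝓡 n) ∞ c p ∧
        ContMDiffAt 𝓘(ℝ, F) 𝓘(ℝ, EuclideanSpace ℝ (Fin n)) ∞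
          (fun q => chartDeriv x (c q) (X q)) p := by
  have hp' : (⟨c p, X p⟩ : TangentBundle (𝓡 n) M) ∈
      (trivializationAt (EuclideanSpace ℝ (Fin n)) (TangentSpace (𝓡 n)) x).source := by
    rw [Trivialization.mem_source]
    simpa using hp
  have h := Trivialization.contMDiffAt_iff (IB := 𝓡 n) (IM := 𝓘(ℝ, F)) (n := ∞)
    (e := trivializationAt (EuclideanSpace ℝ (Fin n)) (TangentSpace (𝓡 n)) x)
    (f := fun q => (⟨c q, X q⟩ : TangentBundle (𝓡 n) M)) hp'
  refine h.trans ?_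
  refine and_congr_right fun hc => ?_
  apply Filter.EventuallyEq.contMDiffAt_iff
  filter_upwards [hc.continuousAt.preimage_mem_nhds
    ((isOpen_extChartAt_source x).mem_nhds hp)] with q hq
  exact trivializationAt_apply_snd x (c q) hq (X q)

end Charts

/-! ### Changes of charts. -/

section Transition

variable {n : ℕ} {M : Type*} [TopologicalSpace M]
  [ChartedSpace (EuclideanSpace ℝ (Fin n)) M] [IsManifold (𝓡 n) ∞ M]

lemma contMDiffAt_chart {x y : M} (hy : y ∈ (extChartAt (𝓡 n) x).source) :
    ContMDiffAt (𝓡 n) 𝓘(ℝ, EuclideanSpace ℝ (Fin n)) ∞ (extChartAt (𝓡 n) x) y :=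
  contMDiffAt_extChartAt' (by rwa [extChartAt_source] at hy)

lemma contMDiffAt_chart_symm {x : M} {z : EuclideanSpace ℝ (Fin n)}
    (hz : z ∈ (extChartAt (𝓡 n) x).target) :
    ContMDiffAt 𝓘(ℝ, EuclideanSpace ℝ (Fin n)) (𝓡 n) ∞ (extChartAt (𝓡 n) x).symm z :=
  (contMDiffOn_extChartAt_symm x).contMDiffAt ((isOpen_extChartAt_target x).mem_nhds hz)

/-- The transition map from the preferred chart at `x` to the preferred chart at `x'`. -/
def transition (x x' : M) (z : EuclideanSpace ℝ (Fin n)) : EuclideanSpace ℝ (Fin n) :=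
  extChartAt (𝓡 n) x' ((extChartAt (𝓡 n) x).symm z)

lemma transition_chart {x x' y : M} (hy : y ∈ (extChartAt (𝓡 n) x).source) :
    transition x x' (extChartAt (𝓡 n) x y) = extChartAt (𝓡 n) x' y := by
  rw [transition, (extChartAt (𝓡 n) x).left_inv hy]

lemma contDiffAt_transition {x x' y : M} (hy : y ∈ (extChartAt (𝓡 n) x).source)
    (hy' : y ∈ (extChartAt (𝓡 n) x').source) :
    ContDiffAt ℝ ∞ (transition x x') (extChartAt (𝓡 n) x y) := by
  rw [← contMDiffAt_iff_contDiffAt]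
  refine ContMDiffAt.comp (I' := 𝓡 n) _ (contMDiffAt_chart ?_)
    (contMDiffAt_chart_symm ((extChartAt (𝓡 n) x).map_source hy))
  rwa [(extChartAt (𝓡 n) x).left_inv hy]

lemma fderiv_transition_chartDeriv {x x' y : M} (hy : y ∈ (extChartAt (𝓡 n) x).source)
    (hy' : y ∈ (extChartAt (𝓡 n) x').source) (v : TangentSpace (𝓡 n) y) :
    fderiv ℝ (transition x x') (extChartAt (𝓡 n) x y) (chartDeriv x y v) = chartDeriv x' y v := by
  have h1 : extChartAt (𝓡 n) x' =ᶠ[𝓝 y] transition x x' ∘ extChartAt (𝓡 n) x := by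
    filter_upwards [(isOpen_extChartAt_source x).mem_nhds hy] with q hq
    exact (transition_chart hq).symm
  unfold chartDeriv
  rw [h1.mfderiv_eq, ← mfderiv_eq_fderiv]
  exact (mfderiv_comp_apply (I' := 𝓘(ℝ, EuclideanSpace ℝ (Fin n))) y
    ((contDiffAt_transition hy hy').contMDiffAt.mdifferentiableAt (by simp))
    ((contMDiffAt_chart hy).mdifferentiableAt (by simp)) v).symm

lemma fderiv_transition_isInvertible {x x' y : M} (hy : y ∈ (extChartAt (𝓡 n) x).source)
    (hy' : y ∈ (extChartAt (𝓡 n) x').source) :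
    (fderiv ℝ (transition x x') (extChartAt (𝓡 n) x y)).IsInvertible := by
  obtain ⟨e, he⟩ := chartDeriv_isInvertible (n := n) hy
  obtain ⟨e', he'⟩ := chartDeriv_isInvertible (n := n) hy'
  refine ⟨e.symm.trans e', ?_⟩
  ext1 v
  obtain ⟨w, rfl⟩ := e.surjective v
  have h := fderiv_transition_chartDeriv hy hy' w
  rw [← he, ← he'] at h
  simpa using h.symm

variable {F : Type*} [NormedAddCommGroup F] [NormedSpace ℝ F]
  {W : Type*} [TopologicalSpace W] [ChartedSpace F W]

lemma chartDeriv_mfderiv {c : W → M} {p : W} (hc : MDifferentiableAt 𝓘(ℝ, F) (𝓡 n) c p) {x : M}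
    (hx : c p ∈ (extChartAt (𝓡 n) x).source) (v : TangentSpace 𝓘(ℝ, F) p) :
    chartDeriv x (c p) (mfderiv 𝓘(ℝ, F) (𝓡 n) c p v)
      = mvfderiv 𝓘(ℝ, F) (fun q => extChartAt (𝓡 n) x (c q)) p v := by
  unfold chartDeriv
  exact (mfderiv_comp_apply p ((contMDiffAt_chart hx).mdifferentiableAt (by simp)) hc v).symm

lemma mvfderiv_eq_fderiv {E : Type*} [NormedAddCommGroup E] [NormedSpace ℝ E] (f : F → E) (p v :
    F) :
    mvfderiv 𝓘(ℝ, F) f p v = fderiv ℝ f p v := by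
  unfold mvfderiv
  rw [mfderiv_eq_fderiv]
  rfl

end Transition

/-! ### Chart coefficients of the metric: nondegeneracy and smoothness. -/

section Metric

variable {n : ℕ} {M : Type*} [TopologicalSpace M]
  [ChartedSpace (EuclideanSpace ℝ (Fin n)) M] [IsManifold (𝓡 n) ∞ M] (g : LorentzMetric n M)

/-- Such a `v` is orthogonal to the timelike `t`, where the form is positive, yet it is also
orthogonal to itself. -/
lemma LorentzMetric.nondegenerate {x : M} {v : TangentSpace (𝓡 n) x}
    (h : ∀ w, g.val x v w = 0) : v = 0 := by
  obtain ⟨t, -, ht⟩ := g.signature x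
  by_contra hv
  exact (ht v (by rw [g.symm]; exact h t) hv).ne' (h v)

lemma chartMetric_apply {x y : M} (hy : y ∈ (extChartAt (𝓡 n) x).source)
    (u v : TangentSpace (𝓡 n) y) :
    chartMetric g x (extChartAt (𝓡 n) x y) (chartDeriv x y u) (chartDeriv x y v)
      = g.val y u v := by
  -- All tangent spaces are the model space by definition, so scalar products at the two equal base
  -- points can be compared on the same vectors.
  have h : ∀ (q : M), q = y → ∀ a b : EuclideanSpace ℝ (Fin n), g.val q a b = g.val y a b := by
    rintro q rfl a b; rfl
  refine (h _ ((extChartAt (𝓡 n) x).left_inv hy) _ _).trans ?_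
  exact congrArg₂ (fun a b : EuclideanSpace ℝ (Fin n) => g.val y a b)
    (chartSymmDeriv_chartDeriv hy u) (chartSymmDeriv_chartDeriv hy v)

lemma chartMetric_symm (x : M) (z a b : EuclideanSpace ℝ (Fin n)) :
    chartMetric g x z a b = chartMetric g x z b a := g.symm _ _ _

lemma chartMetric_isInvertible {x y : M} (hy : y ∈ (extChartAt (𝓡 n) x).source) :
    (chartMetric g x (extChartAt (𝓡 n) x y)).IsInvertible := by
  set G := chartMetric g x (extChartAt (𝓡 n) x y) with hG
  have hinj : Function.Injective G := by
    refine (injective_iff_map_eq_zero G).2 fun a ha => ?_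
    obtain ⟨e, he⟩ := chartDeriv_isInvertible (n := n) hy
    obtain ⟨a', rfl⟩ := e.surjective a
    have : a' = 0 := by
      refine g.nondegenerate fun w => ?_
      rw [← chartMetric_apply g hy, ← he]
      exact congrArg (fun L => L (e w)) ha
    rw [this, map_zero]
  have hfr : Module.finrank ℝ (EuclideanSpace ℝ (Fin n))
      = Module.finrank ℝ (EuclideanSpace ℝ (Fin n) →L[ℝ] ℝ) := by
    rw [← (LinearMap.toContinuousLinearMap :
      (EuclideanSpace ℝ (Fin n) →ₗ[ℝ] ℝ) ≃ₗ[ℝ] _).finrank_eq]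
    exact (Subspace.dual_finrank_eq).symm
  refine ⟨(LinearEquiv.ofInjectiveOfFinrankEq (G : EuclideanSpace ℝ (Fin n) →ₗ[ℝ] _) hinj
    hfr).toContinuousLinearEquiv, ?_⟩
  ext1 v
  rfl

variable {g} in
lemma contMDiffAt_metric {F : Type*} [NormedAddCommGroup F] [NormedSpace ℝ F]
    {W : Type*} [TopologicalSpace W] [ChartedSpace F W] {c : W → M}
    {X Y : (q : W) → TangentSpace (𝓡 n) (c q)} {p : W}
    (hX : ContMDiffAt 𝓘(ℝ, F) (𝓡 n).tangent ∞ (fun q => (⟨c q, X q⟩ : TangentBundle (𝓡 n) M)) p)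
    (hY : ContMDiffAt 𝓘(ℝ, F) (𝓡 n).tangent ∞ (fun q => (⟨c q, Y q⟩ : TangentBundle (𝓡 n) M)) p) :
    ContMDiffAt 𝓘(ℝ, F) 𝓘(ℝ, ℝ) ∞ (fun q => g.val (c q) (X q) (Y q)) p := by
  have hc := ((contMDiffAt_totalSpace_iff (c p) (mem_extChartAt_source _)).1 hX).1
  have : IsManifold (𝓡 n) (∞ + 1) M := inferInstanceAs (IsManifold (𝓡 n) ∞ M)
  have : ContMDiffAt 𝓘(ℝ, F) ((𝓡 n).prod 𝓘(ℝ, ℝ)) ∞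
      (fun q => TotalSpace.mk' ℝ (E := Bundle.Trivial M ℝ) (c q) (g.val (c q) (X q) (Y q))) p := by
    apply ContMDiffAt.clm_bundle_apply₂ (F₁ := EuclideanSpace ℝ (Fin n))
      (F₂ := EuclideanSpace ℝ (Fin n)) (E₁ := TangentSpace (𝓡 n)) (E₂ := TangentSpace (𝓡 n))
    · exact (g.smooth.contMDiffAt).comp p hc
    · exact hX
    · exact hY
  rw [contMDiffAt_totalSpace] at this
  exact this.2

lemma contDiffAt_chartMetric {x : M} {z : EuclideanSpace ℝ (Fin n)}
    (hz : z ∈ (extChartAt (𝓡 n) x).target) : ContDiffAt ℝ ∞ (chartMetric g x) z := by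
  refine contDiffAt_clm_of_apply fun a => contDiffAt_clm_of_apply fun b => ?_
  rw [← contMDiffAt_iff_contDiffAt]
  have h : ∀ a : EuclideanSpace ℝ (Fin n),
      ContMDiffAt 𝓘(ℝ, EuclideanSpace ℝ (Fin n)) (𝓡 n).tangent ∞
        (fun q => (⟨(extChartAt (𝓡 n) x).symm q, chartSymmDeriv x q a⟩ :
          TangentBundle (𝓡 n) M)) z := by
    intro a
    rw [contMDiffAt_totalSpace_iff x ((extChartAt (𝓡 n) x).map_target hz)]
    refine ⟨contMDiffAt_chart_symm hz, ?_⟩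
    refine (contMDiffAt_const (c := a)).congr_of_eventuallyEq ?_
    filter_upwards [(isOpen_extChartAt_target x).mem_nhds hz] with q hq
    exact chartDeriv_chartSymmDeriv hq a
  exact contMDiffAt_metric (h a) (h b)

lemma chartMetric_transition {x x' y : M} (hy : y ∈ (extChartAt (𝓡 n) x).source)
    (hy' : y ∈ (extChartAt (𝓡 n) x').source) (a b : EuclideanSpace ℝ (Fin n)) :
    chartMetric g x (extChartAt (𝓡 n) x y) a b
      = chartMetric g x' (transition x x' (extChartAt (𝓡 n) x y))
        (fderiv ℝ (transition x x') (extChartAt (𝓡 n) x y) a)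
        (fderiv ℝ (transition x x') (extChartAt (𝓡 n) x y) b) := by
  obtain ⟨e, he⟩ := chartDeriv_isInvertible (n := n) hy
  obtain ⟨a, rfl⟩ := e.surjective a
  obtain ⟨b, rfl⟩ := e.surjective b
  have h : ∀ v, e v = chartDeriv x y v := fun v => by rw [← he]; rfl
  rw [h, h, chartMetric_apply g hy, fderiv_transition_chartDeriv hy hy',
    fderiv_transition_chartDeriv hy hy', transition_chart hy, chartMetric_apply g hy']

end Metric

/-! ### The Levi-Civita connection along a map: Leibniz rules, chart independence, torsion, metric
compatibility, curvature. -/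

section CovariantDerivative

variable {n : ℕ} {M : Type*} [TopologicalSpace M]
  [ChartedSpace (EuclideanSpace ℝ (Fin n)) M] [IsManifold (𝓡 n) ∞ M] (g : LorentzMetric n M)
  {F : Type*} [NormedAddCommGroup F] [NormedSpace ℝ F]
  {W : Type*} [TopologicalSpace W] [ChartedSpace F W]

/-- The vector field `X` along the map `c` is smooth at `p`. -/
abbrev SmoothFieldAt (c : W → M) (X : (q : W) → TangentSpace (𝓡 n) (c q)) (p : W) : Prop :=
  ContMDiffAt 𝓘(ℝ, F) (𝓡 n).tangent ∞ (fun q => (⟨c q, X q⟩ : TangentBundle (𝓡 n) M)) p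

lemma SmoothFieldAt.map {c : W → M} {X : (q : W) → TangentSpace (𝓡 n) (c q)} {p : W}
    (h : SmoothFieldAt (F := F) c X p) : ContMDiffAt 𝓘(ℝ, F) (𝓡 n) ∞ c p :=
  ((contMDiffAt_totalSpace_iff (c p) (mem_extChartAt_source _)).1 h).1

lemma SmoothFieldAt.coord {c : W → M} {X : (q : W) → TangentSpace (𝓡 n) (c q)} {p : W}
    (h : SmoothFieldAt (F := F) c X p) {x : M} (hx : c p ∈ (extChartAt (𝓡 n) x).source) :
    ContMDiffAt 𝓘(ℝ, F) 𝓘(ℝ, EuclideanSpace ℝ (Fin n)) ∞ (fun q => chartDeriv x (c q) (X q)) p :=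
  ((contMDiffAt_totalSpace_iff x hx).1 h).2

lemma covAlong_eq (c : W → M) (X : (q : W) → TangentSpace (𝓡 n) (c q)) (p : W)
    (v : TangentSpace 𝓘(ℝ, F) p) :
    covAlong g c X p v = (mvfderiv 𝓘(ℝ, F) (fun q => chartDeriv (c p) (c q) (X q)) p v
      + christoffel (chartMetric g (c p)) (extChartAt (𝓡 n) (c p) (c p))
          (chartDeriv (c p) (c p) (mfderiv 𝓘(ℝ, F) (𝓡 n) c p v)) (chartDeriv (c p) (c p) (X p)) :
        EuclideanSpace ℝ (Fin n)) :=
  inverse_chartDeriv_self _ _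

lemma covAlong_congr {c : W → M} {X Y : (q : W) → TangentSpace (𝓡 n) (c q)} {p : W}
    (h : ∀ᶠ q in 𝓝 p, X q = Y q) (v : TangentSpace 𝓘(ℝ, F) p) :
    covAlong g c X p v = covAlong g c Y p v := by
  have h1 : (fun q => chartDeriv (c p) (c q) (X q)) =ᶠ[𝓝 p]
      fun q => chartDeriv (c p) (c q) (Y q) := h.mono fun q hq => by simp only [hq]
  rw [covAlong_eq, covAlong_eq, h.self_of_nhds]
  unfold mvfderiv
  rw [h1.mfderiv_eq]
  rfl

lemma covAlong_add_dir (c : W → M) (X : (q : W) → TangentSpace (𝓡 n) (c q)) (p : W)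
    (u v : TangentSpace 𝓘(ℝ, F) p) :
    covAlong g c X p (u + v) = covAlong g c X p u + covAlong g c X p v := by
  have e1 : chartDeriv (c p) (c p) (mfderiv 𝓘(ℝ, F) (𝓡 n) c p (u + v))
      = chartDeriv (c p) (c p) (mfderiv 𝓘(ℝ, F) (𝓡 n) c p u)
        + chartDeriv (c p) (c p) (mfderiv 𝓘(ℝ, F) (𝓡 n) c p v) := by
    rw [map_add]; exact map_add _ _ _
  have key : ∀ a b d e : EuclideanSpace ℝ (Fin n), a + b + (d + e) = a + d + (b + e) := by
    intros; abel
  rw [covAlong_eq, covAlong_eq, covAlong_eq, e1, christoffel_add_left, map_add]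
  exact key _ _ _ _

lemma covAlong_smul_dir (c : W → M) (X : (q : W) → TangentSpace (𝓡 n) (c q)) (p : W)
    (r : ℝ) (v : TangentSpace 𝓘(ℝ, F) p) :
    covAlong g c X p (r • v) = r • covAlong g c X p v := by
  have e1 : chartDeriv (c p) (c p) (mfderiv 𝓘(ℝ, F) (𝓡 n) c p (r • v))
      = r • chartDeriv (c p) (c p) (mfderiv 𝓘(ℝ, F) (𝓡 n) c p v) := by
    rw [map_smul]; exact map_smul _ _ _
  rw [covAlong_eq, covAlong_eq, e1, christoffel_smul_left, map_smul]
  exact (smul_add _ _ _).symm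

lemma covAlong_add {c : W → M} {X Y : (q : W) → TangentSpace (𝓡 n) (c q)} {p : W}
    (hX : SmoothFieldAt (F := F) c X p) (hY : SmoothFieldAt (F := F) c Y p)
    (v : TangentSpace 𝓘(ℝ, F) p) :
    covAlong g c (fun q => X q + Y q) p v = covAlong g c X p v + covAlong g c Y p v := by
  have h1 : (fun q => chartDeriv (c p) (c q) (X q + Y q))
      = (fun q => chartDeriv (c p) (c q) (X q)) + fun q => chartDeriv (c p) (c q) (Y q) := by
    funext q; exact map_add _ _ _
  have e1 : chartDeriv (c p) (c p) (X p + Y p)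
      = chartDeriv (c p) (c p) (X p) + chartDeriv (c p) (c p) (Y p) := map_add _ _ _
  have key : ∀ a b d e : EuclideanSpace ℝ (Fin n), a + b + (d + e) = a + d + (b + e) := by
    intros; abel
  rw [covAlong_eq, covAlong_eq, covAlong_eq, h1,
    mvfderiv_add ((hX.coord (mem_extChartAt_source _)).mdifferentiableAt (by simp))
    ((hY.coord (mem_extChartAt_source _)).mdifferentiableAt (by simp)), e1,
    christoffel_add_right, add_apply]
  exact key _ _ _ _

lemma covAlong_smul {c : W → M} {X : (q : W) → TangentSpace (𝓡 n) (c q)} {h : W → ℝ} {p : W}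
    (hX : SmoothFieldAt (F := F) c X p) (hh : ContMDiffAt 𝓘(ℝ, F) 𝓘(ℝ, ℝ) ∞ h p)
    (v : TangentSpace 𝓘(ℝ, F) p) :
    covAlong g c (fun q => h q • X q) p v
      = mvfderiv 𝓘(ℝ, F) h p v • X p + h p • covAlong g c X p v := by
  have h1 : (fun q => chartDeriv (c p) (c q) (h q • X q))
      = h • fun q => chartDeriv (c p) (c q) (X q) := by
    funext q; exact map_smul _ _ _
  rw [covAlong_eq, covAlong_eq]
  rw [h1, mvfderiv_smul (hh.mdifferentiableAt (by simp))
    ((hX.coord (mem_extChartAt_source _)).mdifferentiableAt (by simp)), map_smul,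
    christoffel_smul_right, add_apply, smul_apply, ContinuousLinearMap.smulRight_apply,
    chartDeriv_self]
  have key : ∀ (a b d : EuclideanSpace ℝ (Fin n)) (r s : ℝ),
      r • a + s • b + r • d = s • b + r • (a + d) := by
    intro a b d r s; rw [smul_add]; abel
  exact key _ _ _ _ _

lemma covAlong_neg {c : W → M} {X : (q : W) → TangentSpace (𝓡 n) (c q)} {p : W}
    (v : TangentSpace 𝓘(ℝ, F) p) :
    covAlong g c (fun q => -X q) p v = -covAlong g c X p v := by
  have h1 : (fun q => chartDeriv (c p) (c q) (-X q))
      = -fun q => chartDeriv (c p) (c q) (X q) := by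
    funext q; exact map_neg _ _
  unfold covAlong
  have h2 : ∀ (G : EuclideanSpace ℝ (Fin n) → EuclideanSpace ℝ (Fin n) →L[ℝ]
      EuclideanSpace ℝ (Fin n) →L[ℝ] ℝ) (y u w : EuclideanSpace ℝ (Fin n)),
      christoffel G y u (-w) = -christoffel G y u w := by
    intro G y u w
    rw [← neg_one_smul ℝ w, christoffel_smul_right, neg_one_smul]
  rw [h1, mvfderiv_neg, map_neg, h2, ← map_neg, neg_apply, neg_add]

section Comp

variable {F' : Type*} [NormedAddCommGroup F'] [NormedSpace ℝ F']
  {W' : Type*} [TopologicalSpace W'] [ChartedSpace F' W']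

/-- Chain rule. It reduces derivatives on `V` to derivatives on a chart domain, and derivatives
along a curve to derivatives on `V`. -/
lemma covAlong_comp {c : W → M} {X : (q : W) → TangentSpace (𝓡 n) (c q)} {γ : W' → W} {t : W'}
    (hγ : MDifferentiableAt 𝓘(ℝ, F') 𝓘(ℝ, F) γ t) (hX : SmoothFieldAt (F := F) c X (γ t))
    (v : TangentSpace 𝓘(ℝ, F') t) :
    covAlong g (fun s => c (γ s)) (fun s => X (γ s)) t v
      = covAlong g c X (γ t) (mfderiv 𝓘(ℝ, F') 𝓘(ℝ, F) γ t v) := by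
  have h1 : mvfderiv 𝓘(ℝ, F') (fun s => chartDeriv (c (γ t)) (c (γ s)) (X (γ s))) t v
      = mvfderiv 𝓘(ℝ, F) (fun q => chartDeriv (c (γ t)) (c q) (X q)) (γ t)
        (mfderiv 𝓘(ℝ, F') 𝓘(ℝ, F) γ t v) :=
    mfderiv_comp_apply t ((hX.coord (mem_extChartAt_source _)).mdifferentiableAt (by simp)) hγ v
  have h2 : mfderiv 𝓘(ℝ, F') (𝓡 n) (fun s => c (γ s)) t v
      = mfderiv 𝓘(ℝ, F) (𝓡 n) c (γ t) (mfderiv 𝓘(ℝ, F') 𝓘(ℝ, F) γ t v) :=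
    mfderiv_comp_apply t (hX.map.mdifferentiableAt (by simp)) hγ v
  unfold covAlong
  rw [h1, h2]

lemma SmoothFieldAt.comp {c : W → M} {X : (q : W) → TangentSpace (𝓡 n) (c q)} {γ : W' → W} {t : W'}
    (hX : SmoothFieldAt (F := F) c X (γ t)) (hγ : ContMDiffAt 𝓘(ℝ, F') 𝓘(ℝ, F) ∞ γ t) :
    SmoothFieldAt (F := F') (fun s => c (γ s)) (fun s => X (γ s)) t :=
  ContMDiffAt.comp (g := fun q => (⟨c q, X q⟩ : TangentBundle (𝓡 n) M)) t hX hγ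

end Comp

section Flat

/-- The covariant derivative of `X` in the constant direction `v`. -/
def covDir (c : F → M) (X : (q : F) → TangentSpace (𝓡 n) (c q)) (v : F) :
    (q : F) → TangentSpace (𝓡 n) (c q) :=
  fun q => covAlong (F := F) g c X q v

/-- The derivative of the map `c` in the constant direction `v`. -/
def mapDir (c : F → M) (v : F) : (q : F) → TangentSpace (𝓡 n) (c q) :=
  fun q => mfderiv 𝓘(ℝ, F) (𝓡 n) c q v

lemma chartDeriv_mapDir {c : F → M} {p : F} (hc : MDifferentiableAt 𝓘(ℝ, F) (𝓡 n) c p) {x : M}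
    (hx : c p ∈ (extChartAt (𝓡 n) x).source) (v : F) :
    chartDeriv x (c p) (mapDir (n := n) c v p)
      = fderiv ℝ (fun q => extChartAt (𝓡 n) x (c q)) p v :=
  (chartDeriv_mfderiv hc hx v).trans (mvfderiv_eq_fderiv _ _ _)

lemma coordCov_congr {E E' : Type*} [NormedAddCommGroup E] [NormedSpace ℝ E]
    [NormedAddCommGroup E'] [NormedSpace ℝ E'] (G : E → E →L[ℝ] E →L[ℝ] ℝ) {c X Y : E' → E}
    {y : E'} (h : X =ᶠ[𝓝 y] Y) (v : E') : coordCov G c X v y = coordCov G c Y v y := by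
  unfold coordCov
  rw [h.fderiv_eq, h.eq_of_nhds]

variable {c : F → M} {X : (q : F) → TangentSpace (𝓡 n) (c q)} {p : F}

lemma contDiffAt_chart_comp {c : F → M} {p : F} (hc : ContMDiffAt 𝓘(ℝ, F) (𝓡 n) ∞ c p) {x : M}
    (hx : c p ∈ (extChartAt (𝓡 n) x).source) :
    ContDiffAt ℝ ∞ (fun q => extChartAt (𝓡 n) x (c q)) p := by
  rw [← contMDiffAt_iff_contDiffAt]
  exact (contMDiffAt_chart hx).comp p hc

/-- `covAlong` uses at each point the preferred chart at the image point, a chart that changes with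
the point. A second differentiation needs one chart `x` for a whole neighbourhood. The second
derivative of the transition map, produced by differentiating the components, is the inhomogeneous
term of `christoffel_pullback`, so the expression has the same form in every chart. -/
lemma chartDeriv_covDir (hX : SmoothFieldAt (F := F) c X p) {x : M}
    (hx : c p ∈ (extChartAt (𝓡 n) x).source) (v : F) :
    chartDeriv x (c p) (covDir g c X v p)
      = coordCov (chartMetric g x) (fun q => extChartAt (𝓡 n) x (c q))
        (fun q => chartDeriv x (c q) (X q)) v p := by
  have h0 := mem_extChartAt_source (I := 𝓡 n) (c p)
  have hcd : MDifferentiableAt 𝓘(ℝ, F) (𝓡 n) c p := hX.map.mdifferentiableAt (by simp)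
  set κ := fun q => extChartAt (𝓡 n) (c p) (c q) with hκ
  set Y := fun q => chartDeriv (c p) (c q) (X q) with hY
  set τ := transition (n := n) (c p) x with hτ
  have hτs : ContDiffAt ℝ ∞ τ (κ p) := contDiffAt_transition h0 hx
  have hτ2 : DifferentiableAt ℝ (fderiv ℝ τ) (κ p) :=
    (hτs.fderiv_right (m := ∞) (by simp)).differentiableAt (by simp)
  have hκs : DifferentiableAt ℝ κ p :=
    (contDiffAt_chart_comp hX.map h0).differentiableAt (by simp)
  have hYs : DifferentiableAt ℝ Y p := by
    have := hX.coord h0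
    rw [contMDiffAt_iff_contDiffAt] at this
    exact this.differentiableAt (by simp)
  have hnear : ∀ᶠ q in 𝓝 p, c q ∈ (extChartAt (𝓡 n) (c p)).source ∧
      c q ∈ (extChartAt (𝓡 n) x).source :=
    (hX.map.continuousAt.eventually_mem ((isOpen_extChartAt_source _).mem_nhds h0)).and
      (hX.map.continuousAt.eventually_mem ((isOpen_extChartAt_source _).mem_nhds hx))
  have e1 : (fun q => extChartAt (𝓡 n) x (c q)) =ᶠ[𝓝 p] τ ∘ κ :=
    hnear.mono fun q hq => (transition_chart hq.1).symm
  have e2 : (fun q => chartDeriv x (c q) (X q)) =ᶠ[𝓝 p] fun q => fderiv ℝ τ (κ q) (Y q) :=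
    hnear.mono fun q hq => (fderiv_transition_chartDeriv hq.1 hq.2 _).symm
  have d1 : fderiv ℝ (fun q => extChartAt (𝓡 n) x (c q)) p v
      = fderiv ℝ τ (κ p) (fderiv ℝ κ p v) := by
    rw [e1.fderiv_eq, fderiv_comp p (hτs.differentiableAt (by simp)) hκs]
    rfl
  have d2 : fderiv ℝ (fun q => chartDeriv x (c q) (X q)) p v
      = fderiv ℝ (fderiv ℝ τ) (κ p) (fderiv ℝ κ p v) (Y p) + fderiv ℝ τ (κ p) (fderiv ℝ Y p v) := by
    rw [e2.fderiv_eq]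
    have h := ((hτ2.hasFDerivAt.comp p hκs.hasFDerivAt).clm_apply hYs.hasFDerivAt).fderiv
    refine (congrArg (fun L => L v) h).trans ?_
    simp [add_comm]
  have hcov : chartDeriv (c p) (c p) (covDir g c X v p)
      = coordCov (chartMetric g (c p)) κ Y v p := by
    refine (chartDeriv_self _ _).trans ((covAlong_eq g c X p v).trans ?_)
    exact congrArg₂ (fun a b => a + christoffel (chartMetric g (c p)) (κ p) b (Y p))
      (mvfderiv_eq_fderiv _ _ _) (chartDeriv_mapDir hcd h0 v)
  have hsrc : ∀ᶠ z in 𝓝 (κ p), ∀ a b, chartMetric g (c p) z a b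
      = chartMetric g x (τ z) (fderiv ℝ τ z a) (fderiv ℝ τ z b) := by
    have ht : κ p ∈ (extChartAt (𝓡 n) (c p)).target := (extChartAt (𝓡 n) (c p)).map_source h0
    have hcont : ContinuousAt (extChartAt (𝓡 n) (c p)).symm (κ p) :=
      (contMDiffAt_chart_symm ht).continuousAt
    have hx' : (extChartAt (𝓡 n) (c p)).symm (κ p) ∈ (extChartAt (𝓡 n) x).source := by
      rw [hκ]; simp only; rwa [(extChartAt (𝓡 n) (c p)).left_inv h0]
    filter_upwards [(isOpen_extChartAt_target (c p)).mem_nhds ht,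
      hcont.eventually_mem ((isOpen_extChartAt_source x).mem_nhds hx')] with z hz hz' a b
    have := chartMetric_transition g ((extChartAt (𝓡 n) (c p)).map_target hz) hz' a b
    rwa [(extChartAt (𝓡 n) (c p)).right_inv hz] at this
  have hτκ : τ (κ p) = extChartAt (𝓡 n) x (c p) := transition_chart h0
  have hpb := christoffel_pullback (G := chartMetric g (c p)) (G' := chartMetric g x) hτs
    (fderiv_transition_isInvertible h0 hx)
    (by
      rw [hτκ]
      exact (contDiffAt_chartMetric g ((extChartAt (𝓡 n) x).map_source hx)).differentiableAt
          (by simp))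
    ((contDiffAt_chartMetric g ((extChartAt (𝓡 n) (c p)).map_source h0)).differentiableAt (by simp))
    (chartMetric_isInvertible g h0) (by rw [hτκ]; exact chartMetric_isInvertible g hx)
    (Filter.Eventually.of_forall fun z a b => chartMetric_symm g x z a b) hsrc
    (fderiv ℝ κ p v) (Y p)
  rw [← fderiv_transition_chartDeriv h0 hx, hcov]
  unfold coordCov
  rw [d1, d2, map_add]
  refine (congrArg₂ (· + ·) rfl hpb).trans ?_
  have e3 : (fun q => chartDeriv x (c q) (X q)) p = fderiv ℝ τ (κ p) (Y p) := e2.eq_of_nhds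
  rw [hτκ, e3, ← add_assoc]
  congr 1
  exact add_comm _ _

lemma covDir_flat (hX : SmoothFieldAt (F := F) c X p) (v : F) :
    covDir g c X v p
      = coordCov (chartMetric g (c p)) (fun q => extChartAt (𝓡 n) (c p) (c q))
        (fun q => chartDeriv (c p) (c q) (X q)) v p := by
  rw [← chartDeriv_covDir g hX (mem_extChartAt_source _), chartDeriv_self]

lemma eventually_chartDeriv_covDir (hX : ∀ᶠ q in 𝓝 p, SmoothFieldAt (F := F) c X q) {x : M}
    (hx : c p ∈ (extChartAt (𝓡 n) x).source) (v : F) :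
    (fun q => chartDeriv x (c q) (covDir g c X v q)) =ᶠ[𝓝 p]
      coordCov (chartMetric g x) (fun q => extChartAt (𝓡 n) x (c q))
        (fun q => chartDeriv x (c q) (X q)) v := by
  filter_upwards [hX, hX.self_of_nhds.map.continuousAt.eventually_mem
    ((isOpen_extChartAt_source x).mem_nhds hx)] with q hq hqx
  exact chartDeriv_covDir g hq hqx v

lemma smoothFieldAt_covDir (hX : ∀ᶠ q in 𝓝 p, SmoothFieldAt (F := F) c X q) (v : F) :
    SmoothFieldAt (F := F) c (covDir g c X v) p := by
  have h0 := mem_extChartAt_source (I := 𝓡 n) (c p)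
  have hXp := hX.self_of_nhds
  refine (contMDiffAt_totalSpace_iff (c p) h0).2 ⟨hXp.map, ?_⟩
  rw [contMDiffAt_iff_contDiffAt]
  refine ContDiffAt.congr_of_eventuallyEq ?_ (eventually_chartDeriv_covDir g hX h0 v)
  refine contDiffAt_coordCov (contDiffAt_chartMetric g ((extChartAt (𝓡 n) (c p)).map_source h0))
    (chartMetric_isInvertible g h0) (c := fun q => extChartAt (𝓡 n) (c p) (c q))
        (contDiffAt_chart_comp hXp.map h0) ?_ v
  rw [← contMDiffAt_iff_contDiffAt]
  exact hXp.coord h0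

lemma smoothFieldAt_mapDir (hc : ∀ᶠ q in 𝓝 p, ContMDiffAt 𝓘(ℝ, F) (𝓡 n) ∞ c q) (v : F) :
    SmoothFieldAt (F := F) c (mapDir (n := n) c v) p := by
  have h0 := mem_extChartAt_source (I := 𝓡 n) (c p)
  have hcp := hc.self_of_nhds
  refine (contMDiffAt_totalSpace_iff (c p) h0).2 ⟨hcp, ?_⟩
  rw [contMDiffAt_iff_contDiffAt]
  refine ContDiffAt.congr_of_eventuallyEq
    (f := fun q => fderiv ℝ (fun q => extChartAt (𝓡 n) (c p) (c q)) q v) ?_ ?_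
  · exact ((contDiffAt_chart_comp hcp h0).fderiv_right (by simp)).clm_apply contDiffAt_const
  · filter_upwards [hc, hcp.continuousAt.eventually_mem
      ((isOpen_extChartAt_source _).mem_nhds h0)] with q hq hqx
    exact chartDeriv_mapDir (hq.mdifferentiableAt (by simp)) hqx v

/-- The curvature operator measures the failure of covariant derivatives to commute. -/
lemma covDir_comm (hX : ∀ᶠ q in 𝓝 p, SmoothFieldAt (F := F) c X q) (u v : F) :
    covDir g c (covDir g c X v) u p
        - covDir g c (covDir g c X u) v p
      = curvature g (c p) (mapDir (n := n) c u p) (mapDir (n := n) c v p) (X p) := by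
  have h0 := mem_extChartAt_source (I := 𝓡 n) (c p)
  have hXp := hX.self_of_nhds
  have hcd : MDifferentiableAt 𝓘(ℝ, F) (𝓡 n) c p := hXp.map.mdifferentiableAt (by simp)
  have h1 : ∀ u v, covDir g c (covDir g c X v) u p
      = coordCov (chartMetric g (c p)) (fun q => extChartAt (𝓡 n) (c p) (c q))
        (coordCov (chartMetric g (c p)) (fun q => extChartAt (𝓡 n) (c p) (c q))
        (fun q => chartDeriv (c p) (c q) (X q)) v) u p := by
    intro u v
    rw [covDir_flat g (smoothFieldAt_covDir g hX v)]
    exact coordCov_congr _ (eventually_chartDeriv_covDir g hX h0 v) u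
  have hXc := hXp.coord h0
  rw [contMDiffAt_iff_contDiffAt] at hXc
  have h2 := coordCov_comm (G := chartMetric g (c p))
    (c := fun q => extChartAt (𝓡 n) (c p) (c q)) (y := p)
    (contDiffAt_chartMetric g ((extChartAt (𝓡 n) (c p)).map_source h0))
    (chartMetric_isInvertible g h0)
    (Filter.Eventually.of_forall fun z a b => chartMetric_symm g _ z a b)
    (contDiffAt_chart_comp hXp.map h0) hXc u v
  rw [h1, h1]
  refine h2.trans ?_
  unfold curvature
  rw [inverse_chartDeriv_self, chartDeriv_mapDir hcd h0, chartDeriv_mapDir hcd h0]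

/-- The Levi-Civita connection is torsion free. -/
lemma covDir_mapDir_comm (hc : ∀ᶠ q in 𝓝 p, ContMDiffAt 𝓘(ℝ, F) (𝓡 n) ∞ c q) (u v : F) :
    covDir g c (mapDir (n := n) c v) u p
      = covDir g c (mapDir (n := n) c u) v p := by
  have h0 := mem_extChartAt_source (I := 𝓡 n) (c p)
  have hcp := hc.self_of_nhds
  have h1 : ∀ u v, covDir g c (mapDir (n := n) c v) u p
      = coordCov (chartMetric g (c p)) (fun q => extChartAt (𝓡 n) (c p) (c q))
        (fun q => fderiv ℝ (fun q => extChartAt (𝓡 n) (c p) (c q)) q v) u p := by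
    intro u v
    rw [covDir_flat g (smoothFieldAt_mapDir hc v)]
    refine coordCov_congr (E := EuclideanSpace ℝ (Fin n)) _ ?_ u
    filter_upwards [hc, hcp.continuousAt.eventually_mem
      ((isOpen_extChartAt_source _).mem_nhds h0)] with q hq hqx
    exact chartDeriv_mapDir (hq.mdifferentiableAt (by simp)) hqx v
  rw [h1, h1]
  exact coordCov_fderiv_comm (c := fun q => extChartAt (𝓡 n) (c p) (c q)) (y := p)
    ((contDiffAt_chartMetric g ((extChartAt (𝓡 n) (c p)).map_source h0)).differentiableAt (by simp))
    (Filter.Eventually.of_forall fun z a b => chartMetric_symm g _ z a b)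
    (contDiffAt_chart_comp hcp h0) u v

/-- The Levi-Civita connection is compatible with the metric. -/
lemma fderiv_metric_along {Y : (q : F) → TangentSpace (𝓡 n) (c q)}
    (hX : SmoothFieldAt (F := F) c X p) (hY : SmoothFieldAt (F := F) c Y p) (v : F) :
    fderiv ℝ (fun q => g.val (c q) (X q) (Y q)) p v
      = g.val (c p) (covDir g c X v p) (Y p)
        + g.val (c p) (X p) (covDir g c Y v p) := by
  have h0 := mem_extChartAt_source (I := 𝓡 n) (c p)
  set G := chartMetric g (c p) with hG
  set κ := fun q => extChartAt (𝓡 n) (c p) (c q) with hκ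
  set x := fun q => chartDeriv (c p) (c q) (X q) with hx
  set y := fun q => chartDeriv (c p) (c q) (Y q) with hy
  have hxd : DifferentiableAt ℝ x p := by
    have := hX.coord h0
    rw [contMDiffAt_iff_contDiffAt] at this
    exact this.differentiableAt (by simp)
  have hyd : DifferentiableAt ℝ y p := by
    have := hY.coord h0
    rw [contMDiffAt_iff_contDiffAt] at this
    exact this.differentiableAt (by simp)
  have hκd : DifferentiableAt ℝ κ p :=
    (contDiffAt_chart_comp hX.map h0).differentiableAt (by simp)
  have hGd : DifferentiableAt ℝ G (κ p) :=
    (contDiffAt_chartMetric g ((extChartAt (𝓡 n) (c p)).map_source h0)).differentiableAt (by simp)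
  have e : (fun q => g.val (c q) (X q) (Y q)) =ᶠ[𝓝 p] fun q => (G ∘ κ) q (x q) (y q) := by
    filter_upwards [hX.map.continuousAt.eventually_mem
      ((isOpen_extChartAt_source _).mem_nhds h0)] with q hq
    exact (chartMetric_apply g hq _ _).symm
  have hd := (((hGd.hasFDerivAt.comp p hκd.hasFDerivAt).clm_apply hxd.hasFDerivAt).clm_apply
    hyd.hasFDerivAt).fderiv
  have hs : ∀ᶠ z in 𝓝 (κ p), ∀ a b, G z a b = G z b a :=
    Filter.Eventually.of_forall fun z a b => chartMetric_symm g _ z a b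
  have hcomp := fderiv_metric_eq hGd (chartMetric_isInvertible g h0) hs (fderiv ℝ κ p v) (x p) (y p)
  have e1 : chartDeriv (c p) (c p) (covDir g c X v p) = fderiv ℝ x p v
      + christoffel G (κ p) (fderiv ℝ κ p v) (x p) := chartDeriv_covDir g hX h0 v
  have e2 : chartDeriv (c p) (c p) (covDir g c Y v p) = fderiv ℝ y p v
      + christoffel G (κ p) (fderiv ℝ κ p v) (y p) := chartDeriv_covDir g hY h0 v
  have key : fderiv ℝ (fun q => g.val (c q) (X q) (Y q)) p v
      = G (κ p) (chartDeriv (c p) (c p) (covDir g c X v p)) (y p)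
        + G (κ p) (x p) (chartDeriv (c p) (c p) (covDir g c Y v p)) := by
    rw [e.fderiv_eq, hd, e1, e2]
    simp only [map_add, add_apply, ContinuousLinearMap.flip_apply,
      ContinuousLinearMap.comp_apply, Function.comp_apply]
    rw [hcomp]
    ring
  rw [key, ← chartMetric_apply g h0, ← chartMetric_apply g h0]

end Flat

end CovariantDerivative

/-! ### Linear algebra of null vectors. -/

section TangentAlgebra

variable {n : ℕ} {M : Type*} [TopologicalSpace M]
  [ChartedSpace (EuclideanSpace ℝ (Fin n)) M] [IsManifold (𝓡 n) ∞ M]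

instance (x : M) : FiniteDimensional ℝ (TangentSpace (𝓡 n) x) :=
  inferInstanceAs (FiniteDimensional ℝ (EuclideanSpace ℝ (Fin n)))

lemma finrank_tangentSpace_euclidean (x : M) : Module.finrank ℝ (TangentSpace (𝓡 n) x) = n :=
  finrank_euclideanSpace_fin (𝕜 := ℝ) (n := n)

/-- Subtract from `X` the multiple of `N` that makes the difference orthogonal to the timelike `t`.
The difference has the same square as `X`, and it is either zero or spacelike. -/
lemma LorentzMetric.orthogonal_null (g : LorentzMetric n M) {x : M}
    {N X : TangentSpace (𝓡 n) x} (hN0 : N ≠ 0) (hN : g.val x N N = 0) (hX : g.val x N X = 0) :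
    (∃ a : ℝ, X = a • N) ∨ 0 < g.val x X X := by
  obtain ⟨t, -, ht⟩ := g.signature x
  have hb : g.val x t N ≠ 0 := fun h => (ht N h hN0).ne' hN
  set a := g.val x t X / g.val x t N with ha
  by_cases h0 : X - a • N = 0
  · exact Or.inl ⟨a, sub_eq_zero.1 h0⟩
  · right
    have h := ht (X - a • N) (by
      rw [map_sub, map_smul, smul_eq_mul, ha, div_mul_cancel₀ _ hb, sub_self]) h0
    have hX' : g.val x X N = 0 := by rw [g.symm, hX]
    simpa [map_sub, sub_apply, smul_apply, hX, hX', hN] using h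

end TangentAlgebra

/-! ### The null line of a lightlike hypersurface and the umbilic factor. -/

section Radical

variable {m : ℕ}
  {M : Type*} [TopologicalSpace M] [ChartedSpace (EuclideanSpace ℝ (Fin (m + 2))) M]
  [IsManifold (𝓡 (m + 2)) ∞ M]
  {V : Type*} [TopologicalSpace V] [ChartedSpace (EuclideanSpace ℝ (Fin (m + 1))) V]
  [IsManifold (𝓡 (m + 1)) ∞ V]
  {g : LorentzMetric (m + 2) M} {f : V → M}

namespace IsLightlikeHypersurface

variable (hf : IsLightlikeHypersurface g f)
include hf

lemma exists_null (p : V) : ∃ N ∈ radical g f p, N ≠ 0 :=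
  Submodule.exists_mem_ne_zero_of_ne_bot (hf.lightlike p)

lemma pushforward_ne_zero {p : V} {N : TangentSpace (𝓡 (m + 1)) p} (h : N ≠ 0) :
    pushforward (m := m) f p N ≠ 0 := fun h' =>
  h (hf.immersion p (by rw [h', map_zero]))

lemma tangent_dichotomy {p : V} {N u : TangentSpace (𝓡 (m + 1)) p} (hN : N ∈ radical g f p)
    (hN0 : N ≠ 0) : (∃ a : ℝ, u = a • N) ∨ 0 < g.val (f p) (pushforward f p u) (pushforward f p u)
        := by
  refine (g.orthogonal_null (hf.pushforward_ne_zero hN0) (hN N) (hN u)).imp ?_ id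
  rintro ⟨a, ha⟩
  exact ⟨a, hf.immersion p (by rw [ha, map_smul])⟩

lemma mem_radical_iff {p : V} {N u : TangentSpace (𝓡 (m + 1)) p} (hN : N ∈ radical g f p)
    (hN0 : N ≠ 0) : u ∈ radical g f p ↔ ∃ a : ℝ, u = a • N := by
  constructor
  · intro hu
    exact (hf.tangent_dichotomy hN hN0).resolve_right fun h => h.ne' (hu u)
  · rintro ⟨a, rfl⟩
    exact Submodule.smul_mem _ a hN

lemma pos_of_notMem_radical {p : V} {u : TangentSpace (𝓡 (m + 1)) p} (hu : u ∉ radical g f p) :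
    0 < g.val (f p) (pushforward f p u) (pushforward f p u) := by
  obtain ⟨N, hN, hN0⟩ := hf.exists_null p
  refine (hf.tangent_dichotomy hN hN0).resolve_left fun h => hu ?_
  exact (hf.mem_radical_iff hN hN0).2 h

/-- Otherwise `X` is spacelike by `orthogonal_null`, hence not tangent. By dimension `T_pV` and `X`
then span the ambient space, and `N`, being orthogonal to both, contradicts nondegeneracy. -/
lemma orthogonal_tangent {p : V} {N : TangentSpace (𝓡 (m + 1)) p} (hN : N ∈ radical g f p)
    (hN0 : N ≠ 0) {X : TangentSpace (𝓡 (m + 2)) (f p)}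
    (hX : ∀ w, g.val (f p) X (pushforward f p w) = 0) : ∃ a : ℝ, X = a • pushforward f p N := by
  refine (g.orthogonal_null (hf.pushforward_ne_zero hN0) (hN N)
    (by rw [g.symm]; exact hX N)).resolve_right fun hpos => ?_
  let L : (TangentSpace (𝓡 (m + 1)) p × ℝ) →ₗ[ℝ] TangentSpace (𝓡 (m + 2)) (f p) :=
    LinearMap.coprod (pushforward f p).toLinearMap (LinearMap.toSpanSingleton ℝ _ X)
  have hL : ∀ w b, L (w, b) = pushforward f p w + b • X := fun w b => rfl
  have hinj : Function.Injective L := by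
    refine (injective_iff_map_eq_zero L).2 ?_
    rintro ⟨w, b⟩ h
    rw [hL] at h
    have h1 := congrArg (g.val (f p) X) h
    rw [map_add, hX, map_smul, zero_add, map_zero, smul_eq_mul] at h1
    have hb : b = 0 := (mul_eq_zero.1 h1).resolve_right hpos.ne'
    rw [hb, zero_smul, add_zero] at h
    have hw : w = 0 := hf.immersion p (by rw [h, map_zero])
    rw [hw, hb]; rfl
  have hfr : Module.finrank ℝ (TangentSpace (𝓡 (m + 1)) p × ℝ)
      = Module.finrank ℝ (TangentSpace (𝓡 (m + 2)) (f p)) := by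
    rw [Module.finrank_prod, finrank_tangentSpace_euclidean, finrank_tangentSpace_euclidean,
      Module.finrank_self]
  have hsurj := (LinearMap.injective_iff_surjective_of_finrank_eq_finrank hfr).1 hinj
  refine hf.pushforward_ne_zero hN0 (g.nondegenerate fun Y => ?_)
  obtain ⟨⟨w, b⟩, rfl⟩ := hsurj Y
  rw [hL, map_add, map_smul, hN w, g.symm, hX N, smul_zero, add_zero]

/-- The radical is a line and `T_pV` has dimension `m + 1 ≥ 2`. Such a vector has positive square,
which determines the umbilic factor. -/
lemma exists_notMem_radical (hm : 1 ≤ m) (p : V) :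
    ∃ u : TangentSpace (𝓡 (m + 1)) p, u ∉ radical g f p := by
  obtain ⟨N, hN, hN0⟩ := hf.exists_null p
  by_contra! h
  have htop : Submodule.span ℝ {N} = ⊤ := by
    rw [eq_top_iff]
    intro u _
    obtain ⟨a, rfl⟩ := (hf.mem_radical_iff hN hN0).1 (h u)
    exact Submodule.smul_mem _ _ (Submodule.mem_span_singleton_self N)
  have h1 := finrank_span_singleton (K := ℝ) hN0
  rw [htop, finrank_top, finrank_tangentSpace_euclidean] at h1
  omega

end IsLightlikeHypersurface

/-- `∇_v e₁ - r v` is orthogonal to the tangent hyperplane, so `orthogonal_tangent` applies. -/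
lemma IsUmbilicFactorAt.exists_eq (hf : IsLightlikeHypersurface g f)
    {e₁ : (q : V) → TangentSpace (𝓡 (m + 1)) q} {q : V} {r : ℝ}
    (h : IsUmbilicFactorAt g f e₁ q r) (h1 : e₁ q ∈ radical g f q) (h0 : e₁ q ≠ 0)
    (v : TangentSpace (𝓡 (m + 1)) q) :
    ∃ a : ℝ, nablaTangent g f e₁ q v = r • pushforward f q v + a • pushforward f q (e₁ q) := by
  obtain ⟨a, ha⟩ := hf.orthogonal_tangent h1 h0
    (X := nablaTangent g f e₁ q v - r • pushforward f q v) (fun w => by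
      rw [map_sub, sub_apply, h v w, map_smul, smul_apply, smul_eq_mul, sub_self])
  exact ⟨a, by rw [← ha]; abel⟩

lemma IsUmbilicFactorAt.unique (hf : IsLightlikeHypersurface g f) (hm : 1 ≤ m)
    {e₁ : (q : V) → TangentSpace (𝓡 (m + 1)) q} {q : V} {r r' : ℝ}
    (h : IsUmbilicFactorAt g f e₁ q r) (h' : IsUmbilicFactorAt g f e₁ q r') : r = r' := by
  obtain ⟨u, hu⟩ := hf.exists_notMem_radical hm q
  exact mul_right_cancel₀ (hf.pos_of_notMem_radical hu).ne' ((h u u).symm.trans (h' u u))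

end Radical

/-! ### Algebra of smooth fields along a map. -/

section Fields

variable {n : ℕ} {M : Type*} [TopologicalSpace M]
  [ChartedSpace (EuclideanSpace ℝ (Fin n)) M] [IsManifold (𝓡 n) ∞ M]
  {F : Type*} [NormedAddCommGroup F] [NormedSpace ℝ F]
  {W : Type*} [TopologicalSpace W] [ChartedSpace F W]
  {c : W → M} {X Y : (q : W) → TangentSpace (𝓡 n) (c q)} {p : W}

lemma SmoothFieldAt.of_coord (hc : ContMDiffAt 𝓘(ℝ, F) (𝓡 n) ∞ c p)
    (h : ContMDiffAt 𝓘(ℝ, F) 𝓘(ℝ, EuclideanSpace ℝ (Fin n)) ∞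
      (fun q => chartDeriv (c p) (c q) (X q)) p) : SmoothFieldAt (F := F) c X p :=
  (contMDiffAt_totalSpace_iff (c p) (mem_extChartAt_source _)).2 ⟨hc, h⟩

lemma SmoothFieldAt.congr (hX : SmoothFieldAt (F := F) c X p) (h : ∀ᶠ q in 𝓝 p, Y q = X q) :
    SmoothFieldAt (F := F) c Y p :=
  ContMDiffAt.congr_of_eventuallyEq hX (h.mono fun q hq => by simp only [hq])

lemma SmoothFieldAt.add (hX : SmoothFieldAt (F := F) c X p) (hY : SmoothFieldAt (F := F) c Y p) :
    SmoothFieldAt (F := F) c (fun q => X q + Y q) p := by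
  have h0 := mem_extChartAt_source (I := 𝓡 n) (c p)
  refine .of_coord hX.map (((hX.coord h0).add (hY.coord h0)).congr_of_eventuallyEq ?_)
  exact Filter.Eventually.of_forall fun q => map_add (chartDeriv (c p) (c q)) (X q) (Y q)

lemma SmoothFieldAt.smul {h : W → ℝ} (hh : ContMDiffAt 𝓘(ℝ, F) 𝓘(ℝ, ℝ) ∞ h p)
    (hX : SmoothFieldAt (F := F) c X p) : SmoothFieldAt (F := F) c (fun q => h q • X q) p := by
  have h0 := mem_extChartAt_source (I := 𝓡 n) (c p)
  refine .of_coord hX.map ((hh.smul (hX.coord h0)).congr_of_eventuallyEq ?_)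
  exact Filter.Eventually.of_forall fun q => map_smul (chartDeriv (c p) (c q)) (h q) (X q)

lemma SmoothFieldAt.neg (hX : SmoothFieldAt (F := F) c X p) :
    SmoothFieldAt (F := F) c (fun q => -X q) p :=
  (hX.smul (contMDiffAt_const (c := (-1 : ℝ)))).congr
    (Filter.Eventually.of_forall fun q => (neg_one_smul ℝ (X q)).symm)

lemma SmoothFieldAt.sub (hX : SmoothFieldAt (F := F) c X p) (hY : SmoothFieldAt (F := F) c Y p) :
    SmoothFieldAt (F := F) c (fun q => X q - Y q) p :=
  (hX.add hY.neg).congr (Filter.Eventually.of_forall fun q => sub_eq_add_neg (X q) (Y q))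

/-- The coefficient of a smooth multiple of a nonvanishing smooth field is smooth. -/
lemma contMDiffAt_coefficient {h : W → ℝ} (hX : SmoothFieldAt (F := F) c X p)
    (hY : SmoothFieldAt (F := F) c Y p) (h0 : X p ≠ 0) (he : ∀ᶠ q in 𝓝 p, Y q = h q • X q) :
    ContMDiffAt 𝓘(ℝ, F) 𝓘(ℝ, ℝ) ∞ h p := by
  have hs := mem_extChartAt_source (I := 𝓡 n) (c p)
  let x : W → EuclideanSpace ℝ (Fin n) := fun q => chartDeriv (c p) (c q) (X q)
  let y : W → EuclideanSpace ℝ (Fin n) := fun q => chartDeriv (c p) (c q) (Y q)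
  have hx : ContMDiffAt 𝓘(ℝ, F) 𝓘(ℝ, EuclideanSpace ℝ (Fin n)) ∞ x p := hX.coord hs
  have hy : ContMDiffAt 𝓘(ℝ, F) 𝓘(ℝ, EuclideanSpace ℝ (Fin n)) ∞ y p := hY.coord hs
  have hx0 : x p ≠ 0 := fun h => h0 (chartDeriv_injective hs (h.trans (map_zero _).symm))
  -- Pairing with the constant vector `x p` keeps `ℓ (x q)` nonzero near `p`, so the coefficient is
  -- a quotient of smooth functions.
  let ℓ := innerSL ℝ (x p)
  have hlx : ContMDiffAt 𝓘(ℝ, F) 𝓘(ℝ, ℝ) ∞ (fun q => ℓ (x q)) p :=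
    ℓ.contMDiff.contMDiffAt.comp p hx
  have hly : ContMDiffAt 𝓘(ℝ, F) 𝓘(ℝ, ℝ) ∞ (fun q => ℓ (y q)) p :=
    ℓ.contMDiff.contMDiffAt.comp p hy
  have hne : ℓ (x p) ≠ 0 := by
    simp only [ℓ, innerSL_apply_apply]
    exact inner_self_ne_zero.2 hx0
  refine (hly.div₀ hlx hne).congr_of_eventuallyEq ?_
  filter_upwards [he, hlx.continuousAt.eventually_ne hne] with q hq hq'
  have h1 : y q = h q • x q := by
    show chartDeriv (c p) (c q) (Y q) = h q • chartDeriv (c p) (c q) (X q)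
    rw [hq, map_smul]
  rw [Pi.div_apply, h1, map_smul, smul_eq_mul, mul_div_cancel_right₀ _ hq']

end Fields

/-! ### Fields with prescribed chart components. -/

section FieldFromCoordinates

variable {n : ℕ} {M : Type*} [TopologicalSpace M]
  [ChartedSpace (EuclideanSpace ℝ (Fin n)) M] [IsManifold (𝓡 n) ∞ M]

/-- The vector field with given components in the preferred chart at `x`. -/
def fieldOfCoord (x : M) (ν : EuclideanSpace ℝ (Fin n) → EuclideanSpace ℝ (Fin n)) (q : M) :
    TangentSpace (𝓡 n) q :=
  (chartDeriv x q).inverse (ν (extChartAt (𝓡 n) x q))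

lemma chartDeriv_inverse {x q : M} (hq : q ∈ (extChartAt (𝓡 n) x).source)
    (v : EuclideanSpace ℝ (Fin n)) : chartDeriv x q ((chartDeriv x q).inverse v) = v := by
  obtain ⟨e, he⟩ := chartDeriv_isInvertible (n := n) hq
  rw [← he]; simp

lemma chartDeriv_fieldOfCoord {x q : M} (hq : q ∈ (extChartAt (𝓡 n) x).source)
    (ν : EuclideanSpace ℝ (Fin n) → EuclideanSpace ℝ (Fin n)) :
    chartDeriv x q (fieldOfCoord x ν q) = ν (extChartAt (𝓡 n) x q) :=
  chartDeriv_inverse hq _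

lemma contMDiffAt_fieldOfCoord {x q : M} (hq : q ∈ (extChartAt (𝓡 n) x).source)
    {ν : EuclideanSpace ℝ (Fin n) → EuclideanSpace ℝ (Fin n)}
    (hν : ContDiffAt ℝ ∞ ν (extChartAt (𝓡 n) x q)) :
    ContMDiffAt (𝓡 n) (𝓡 n).tangent ∞
      (fun q => (⟨q, fieldOfCoord x ν q⟩ : TangentBundle (𝓡 n) M)) q := by
  refine (contMDiffAt_totalSpace_iff (c := fun q : M => q) x hq).2 ⟨contMDiffAt_id, ?_⟩
  refine ((contMDiffAt_iff_contDiffAt.2 hν).comp q (contMDiffAt_chart hq)).congr_of_eventuallyEq ?_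
  filter_upwards [(isOpen_extChartAt_source x).mem_nhds hq] with z hz
  exact chartDeriv_fieldOfCoord hz ν

lemma mfderiv_comp_chart_symm {m : ℕ} {M' : Type*} [TopologicalSpace M']
    [ChartedSpace (EuclideanSpace ℝ (Fin m)) M'] [IsManifold (𝓡 m) ∞ M'] {f : M → M'} {x : M}
    {y : EuclideanSpace ℝ (Fin n)} (hy : y ∈ (extChartAt (𝓡 n) x).target)
    (hf : MDifferentiableAt (𝓡 n) (𝓡 m) f ((extChartAt (𝓡 n) x).symm y))
    (v : EuclideanSpace ℝ (Fin n)) :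
    mapDir (n := m) (fun z => f ((extChartAt (𝓡 n) x).symm z)) v y
      = mfderiv (𝓡 n) (𝓡 m) f ((extChartAt (𝓡 n) x).symm y) (chartSymmDeriv x y v) :=
  mfderiv_comp_apply y hf ((contMDiffAt_chart_symm hy).mdifferentiableAt (by simp)) v

end FieldFromCoordinates

/-! ### The curvature identity behind the theorem. -/

section Identity

variable {n : ℕ} {M : Type*} [TopologicalSpace M]
  [ChartedSpace (EuclideanSpace ℝ (Fin n)) M] [IsManifold (𝓡 n) ∞ M] (g : LorentzMetric n M)
  {F : Type*} [NormedAddCommGroup F] [NormedSpace ℝ F]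
  {c : F → M} {X : (q : F) → TangentSpace (𝓡 n) (c q)} {p : F}

/-- The curvature of a field `X` with `∇_v X = v + θ(v) X`. -/
lemma curvature_of_covDir_eq {θ : F → F →L[ℝ] ℝ} (hX : ∀ᶠ q in 𝓝 p, SmoothFieldAt (F := F) c X q)
    (hθ : ContDiffAt ℝ ∞ θ p)
    (h : ∀ᶠ q in 𝓝 p, ∀ v, covDir g c X v q = mapDir (n := n) c v q + θ q v • X q) (u v : F) :
    curvature g (c p) (mapDir c u p) (mapDir c v p) (X p)
      = (fderiv ℝ θ p u v - fderiv ℝ θ p v u) • X p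
        + (θ p v • mapDir (n := n) c u p - θ p u • mapDir (n := n) c v p) := by
  have hXp := hX.self_of_nhds
  have hc : ∀ᶠ q in 𝓝 p, ContMDiffAt 𝓘(ℝ, F) (𝓡 n) ∞ c q := hX.mono fun q hq => hq.map
  have hs : ∀ v, ContMDiffAt 𝓘(ℝ, F) 𝓘(ℝ, ℝ) ∞ (fun q => θ q v) p := fun v =>
    contMDiffAt_iff_contDiffAt.2 (hθ.clm_apply contDiffAt_const)
  have hd : ∀ u v, fderiv ℝ (fun q => θ q v) p u = fderiv ℝ θ p u v := by
    intro u v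
    have h' := ((hθ.differentiableAt (by simp)).hasFDerivAt.clm_apply
      (hasFDerivAt_const v p)).fderiv
    refine (congrArg (fun L => L u) h').trans ?_
    simp
  -- Antisymmetrising in `u`, `v` removes the first term, because the connection is torsion free,
  -- and also the term `θ(u) θ(v) X`.
  have key : ∀ u v, covDir g c (covDir g c X v) u p = covDir g c (mapDir (n := n) c v) u p
      + (fderiv ℝ θ p u v • X p + θ p v • (mapDir (n := n) c u p + θ p u • X p)) := by
    intro u v
    have e1 : covDir g c (covDir g c X v) u p
        = covDir g c (fun q => mapDir (n := n) c v q + θ q v • X q) u p :=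
      covAlong_congr g (h.mono fun q hq => hq v) u
    have e2 : covDir g c (fun q => mapDir (n := n) c v q + θ q v • X q) u p
        = covDir g c (mapDir (n := n) c v) u p + covDir g c (fun q => θ q v • X q) u p :=
      covAlong_add g (smoothFieldAt_mapDir hc v) (hXp.smul (hs v)) u
    have e3 : covDir g c (fun q => θ q v • X q) u p
        = mvfderiv 𝓘(ℝ, F) (fun q => θ q v) p u • X p + θ p v • covDir g c X u p :=
      covAlong_smul g hXp (hs v) u
    rw [e1, e2, e3, mvfderiv_eq_fderiv, hd, h.self_of_nhds u]
  rw [← covDir_comm g hX u v, key u v, key v u, covDir_mapDir_comm g hc u v, smul_add, smul_add,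
    smul_smul, smul_smul, mul_comm (θ p u) (θ p v), sub_smul]
  abel

end Identity

/-! ### The induced form on the domain of a map. -/

section Pullback

lemma isInvertible_of_injective {E E' : Type*} [NormedAddCommGroup E] [NormedSpace ℝ E]
    [NormedAddCommGroup E'] [NormedSpace ℝ E'] [FiniteDimensional ℝ E] [FiniteDimensional ℝ E']
    (A : E →L[ℝ] E') (hA : Function.Injective A)
    (h : Module.finrank ℝ E = Module.finrank ℝ E') : A.IsInvertible :=
  ⟨(LinearEquiv.ofInjectiveOfFinrankEq (A : E →ₗ[ℝ] E') hA h).toContinuousLinearEquiv, by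
    ext1 v; rfl⟩

lemma finrank_clm_real {E : Type*} [NormedAddCommGroup E] [NormedSpace ℝ E]
    [FiniteDimensional ℝ E] : Module.finrank ℝ E = Module.finrank ℝ (E →L[ℝ] ℝ) := by
  rw [← (LinearMap.toContinuousLinearMap : (E →ₗ[ℝ] ℝ) ≃ₗ[ℝ] _).finrank_eq]
  exact (Subspace.dual_finrank_eq).symm

lemma eventually_isInvertible {E E' F : Type*} [NormedAddCommGroup E] [NormedSpace ℝ E]
    [NormedAddCommGroup E'] [NormedSpace ℝ E'] [CompleteSpace E] [TopologicalSpace F]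
    {A : F → E →L[ℝ] E'} {y : F} (hA : ContinuousAt A y) (h : (A y).IsInvertible) :
    ∀ᶠ z in 𝓝 y, (A z).IsInvertible := by
  obtain ⟨e, he⟩ := h
  have := hA.eventually (he ▸ e.nhds)
  exact this

variable {n : ℕ} {M : Type*} [TopologicalSpace M]
  [ChartedSpace (EuclideanSpace ℝ (Fin n)) M] [IsManifold (𝓡 n) ∞ M] (g : LorentzMetric n M)
  {F : Type*} [NormedAddCommGroup F] [NormedSpace ℝ F]

/-- The form induced on the domain of a map into a Lorentzian manifold. -/
def pullbackForm (c : F → M) (y : F) : F →L[ℝ] F →L[ℝ] ℝ :=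
  ContinuousLinearMap.bilinearComp (E := EuclideanSpace ℝ (Fin n)) (F := EuclideanSpace ℝ (Fin n))
    (E' := F) (F' := F) (g.val (c y)) (mfderiv 𝓘(ℝ, F) (𝓡 n) c y) (mfderiv 𝓘(ℝ, F) (𝓡 n) c y)

lemma pullbackForm_apply (c : F → M) (y u v : F) :
    pullbackForm g c y u v = g.val (c y) (mapDir c u y) (mapDir c v y) := rfl

lemma contDiffAt_pullbackForm [FiniteDimensional ℝ F] {c : F → M} {y : F}
    (hc : ∀ᶠ q in 𝓝 y, ContMDiffAt 𝓘(ℝ, F) (𝓡 n) ∞ c q) :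
    ContDiffAt ℝ ∞ (pullbackForm g c) y := by
  refine contDiffAt_clm_of_apply fun u => contDiffAt_clm_of_apply fun v => ?_
  rw [← contMDiffAt_iff_contDiffAt]
  exact contMDiffAt_metric (smoothFieldAt_mapDir hc u) (smoothFieldAt_mapDir hc v)

lemma chartSymmDeriv_chartDeriv_symm {x : M} {y : EuclideanSpace ℝ (Fin n)}
    (hy : y ∈ (extChartAt (𝓡 n) x).target)
    (u : TangentSpace (𝓡 n) ((extChartAt (𝓡 n) x).symm y)) :
    chartSymmDeriv x y (chartDeriv x ((extChartAt (𝓡 n) x).symm y) u) = u := by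
  have := isManifold_one (n := n) (M := M)
  have h := mfderivWithin_extChartAt_symm_comp_mfderiv_extChartAt hy
  rw [ModelWithCorners.range_eq_univ, mfderivWithin_univ] at h
  exact congrArg (fun L => L u) h

end Pullback

/-! ### Local smooth null fields. -/

section Hypersurface

variable {m : ℕ}
  {M : Type*} [TopologicalSpace M] [ChartedSpace (EuclideanSpace ℝ (Fin (m + 2))) M]
  [IsManifold (𝓡 (m + 2)) ∞ M]
  {V : Type*} [TopologicalSpace V] [ChartedSpace (EuclideanSpace ℝ (Fin (m + 1))) V]
  [IsManifold (𝓡 (m + 1)) ∞ V]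
  {g : LorentzMetric (m + 2) M} {f : V → M}

/-- The immersion in the preferred chart at `p`. -/
def chartMap (f : V → M) (p : V) (y : EuclideanSpace ℝ (Fin (m + 1))) : M :=
  f ((extChartAt (𝓡 (m + 1)) p).symm y)

lemma exists_chart_symm_eq {p q : V} (hq : q ∈ (extChartAt (𝓡 (m + 1)) p).source) :
    ∃ y ∈ (extChartAt (𝓡 (m + 1)) p).target, (extChartAt (𝓡 (m + 1)) p).symm y = q ∧
      extChartAt (𝓡 (m + 1)) p q = y :=
  ⟨_, (extChartAt (𝓡 (m + 1)) p).map_source hq, (extChartAt (𝓡 (m + 1)) p).left_inv hq, rfl⟩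

lemma eventually_mem_target {p : V} {y : EuclideanSpace ℝ (Fin (m + 1))}
    (hy : y ∈ (extChartAt (𝓡 (m + 1)) p).target) :
    ∀ᶠ z in 𝓝 y, z ∈ (extChartAt (𝓡 (m + 1)) p).target :=
  (isOpen_extChartAt_target p).mem_nhds hy

namespace IsLightlikeHypersurface

variable (hf : IsLightlikeHypersurface g f)
include hf

lemma contMDiffAt_chartMap {p : V} {y : EuclideanSpace ℝ (Fin (m + 1))}
    (hy : y ∈ (extChartAt (𝓡 (m + 1)) p).target) :
    ContMDiffAt 𝓘(ℝ, EuclideanSpace ℝ (Fin (m + 1))) (𝓡 (m + 2)) ∞ (chartMap f p) y :=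
  hf.smooth.contMDiffAt.comp y (contMDiffAt_chart_symm hy)

lemma eventually_contMDiffAt_chartMap {p : V} {y : EuclideanSpace ℝ (Fin (m + 1))}
    (hy : y ∈ (extChartAt (𝓡 (m + 1)) p).target) :
    ∀ᶠ z in 𝓝 y, ContMDiffAt 𝓘(ℝ, EuclideanSpace ℝ (Fin (m + 1))) (𝓡 (m + 2)) ∞ (chartMap f p) z :=
  (eventually_mem_target hy).mono fun _ hz => hf.contMDiffAt_chartMap hz

lemma mapDir_chartMap {p : V} {y : EuclideanSpace ℝ (Fin (m + 1))}
    (hy : y ∈ (extChartAt (𝓡 (m + 1)) p).target) (v : EuclideanSpace ℝ (Fin (m + 1))) :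
    mapDir (chartMap f p) v y
      = pushforward f ((extChartAt (𝓡 (m + 1)) p).symm y) (chartSymmDeriv p y v) :=
  mfderiv_comp_chart_symm hy (hf.smooth.contMDiffAt.mdifferentiableAt (by simp)) v

lemma mapDir_chartMap_chartDeriv {p : V} {y : EuclideanSpace ℝ (Fin (m + 1))}
    (hy : y ∈ (extChartAt (𝓡 (m + 1)) p).target)
    (v : TangentSpace (𝓡 (m + 1)) ((extChartAt (𝓡 (m + 1)) p).symm y)) :
    mapDir (chartMap f p) (chartDeriv p ((extChartAt (𝓡 (m + 1)) p).symm y) v) y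
      = pushforward f ((extChartAt (𝓡 (m + 1)) p).symm y) v := by
  rw [hf.mapDir_chartMap hy, chartSymmDeriv_chartDeriv_symm hy]

lemma radical_coord_iff {p : V} {y : EuclideanSpace ℝ (Fin (m + 1))}
    (hy : y ∈ (extChartAt (𝓡 (m + 1)) p).target)
    (v : TangentSpace (𝓡 (m + 1)) ((extChartAt (𝓡 (m + 1)) p).symm y)) :
    v ∈ radical g f ((extChartAt (𝓡 (m + 1)) p).symm y) ↔
      pullbackForm g (chartMap f p) y (chartDeriv p ((extChartAt (𝓡 (m + 1)) p).symm y) v) = 0 := by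
  constructor
  · intro h
    ext w
    rw [pullbackForm_apply, hf.mapDir_chartMap_chartDeriv hy, hf.mapDir_chartMap hy]
    exact h _
  · intro h w
    have := congrArg (fun L => L (chartDeriv p ((extChartAt (𝓡 (m + 1)) p).symm y) w)) h
    simp only [pullbackForm_apply] at this
    rw [hf.mapDir_chartMap_chartDeriv hy, hf.mapDir_chartMap_chartDeriv hy] at this
    exact this

/-- The induced form `h` is degenerate, so it is perturbed to `A = h + ℓ ⊗ ℓ`, where `ℓ` is nonzero
on a null vector at the base point. Then `A` is invertible nearby. A null vector `N` satisfies `A N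
= ℓ(N) ℓ`, so `A⁻¹ ℓ = N / ℓ(N)` is null; it is smooth because `A` is. -/
lemma exists_nullField (p : V) :
    ∃ (O : Set V) (e₁ : (q : V) → TangentSpace (𝓡 (m + 1)) q), p ∈ O ∧ IsNullFieldOn g f O e₁ := by
  set φ := extChartAt (𝓡 (m + 1)) p with hφ
  have hp0 : p ∈ φ.source := mem_extChartAt_source p
  obtain ⟨y₀, hy₀, hyp, hyp'⟩ := exists_chart_symm_eq hp0
  obtain ⟨N₀, hN₀, hN0⟩ := hf.exists_null (φ.symm y₀)
  let ν₀ : EuclideanSpace ℝ (Fin (m + 1)) := chartDeriv p (φ.symm y₀) N₀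
  have hν₀ : ν₀ ≠ 0 := fun h => hN0
    (chartDeriv_injective (φ.map_target hy₀) (h.trans (map_zero _).symm))
  let ℓ := innerSL ℝ ν₀
  have hℓ : ℓ ν₀ ≠ 0 := by
    simp only [ℓ, innerSL_apply_apply]
    exact inner_self_ne_zero.2 hν₀
  let A : EuclideanSpace ℝ (Fin (m + 1)) → EuclideanSpace ℝ (Fin (m + 1)) →L[ℝ]
      EuclideanSpace ℝ (Fin (m + 1)) →L[ℝ] ℝ :=
    fun y => pullbackForm g (chartMap f p) y + ℓ.smulRight ℓ
  have hAs : ∀ y ∈ φ.target, ContDiffAt ℝ ∞ A y := fun y hy =>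
    (contDiffAt_pullbackForm g (hf.eventually_contMDiffAt_chartMap hy)).add contDiffAt_const
  have hA0 : (A y₀).IsInvertible := by
    refine isInvertible_of_injective _ ((injective_iff_map_eq_zero (A y₀)).2 fun v hv => ?_)
      finrank_clm_real
    obtain ⟨e, he⟩ := chartDeriv_isInvertible (n := m + 1) (φ.map_target hy₀)
    obtain ⟨v, rfl⟩ := e.surjective v
    have hev : e v = chartDeriv p (φ.symm y₀) v := by rw [← he]; rfl
    rw [hev] at hv ⊢
    have h1 : ∀ w, pullbackForm g (chartMap f p) y₀ (chartDeriv p (φ.symm y₀) v) w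
        + ℓ (chartDeriv p (φ.symm y₀) v) * ℓ w = 0 := fun w => by
      have := congrArg (fun L => L w) hv
      simpa [A] using this
    -- Testing `A v = 0` on the null vector `ν₀` kills the form and leaves `ℓ(v) ℓ(ν₀) = 0`. So `v`
    -- is null with `ℓ(v) = 0`, hence zero.
    have h2 : pullbackForm g (chartMap f p) y₀ (chartDeriv p (φ.symm y₀) v) ν₀ = 0 := by
      have := (hf.radical_coord_iff hy₀ N₀).1 hN₀
      rw [pullbackForm_apply, g.symm, ← pullbackForm_apply]
      exact congrArg (fun L => L (chartDeriv p (φ.symm y₀) v)) this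
    have h3 : ℓ (chartDeriv p (φ.symm y₀) v) = 0 := by
      have := h1 ν₀
      rw [h2, zero_add] at this
      exact (mul_eq_zero.1 this).resolve_right hℓ
    have h4 : v ∈ radical g f (φ.symm y₀) := by
      rw [hf.radical_coord_iff hy₀]
      ext w
      have := h1 w
      rwa [h3, zero_mul, add_zero] at this
    obtain ⟨a, rfl⟩ := (hf.mem_radical_iff hN₀ hN0).1 h4
    rw [map_smul, map_smul, smul_eq_mul] at h3
    rw [(mul_eq_zero.1 h3).resolve_right hℓ, zero_smul, map_zero]
  have hnear : ∀ᶠ y in 𝓝 y₀, y ∈ φ.target ∧ (A y).IsInvertible :=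
    (eventually_mem_target hy₀).and (eventually_isInvertible (hAs y₀ hy₀).continuousAt hA0)
  obtain ⟨U, hU, hUo, hyU⟩ := eventually_nhds_iff.1 hnear
  let ν : EuclideanSpace ℝ (Fin (m + 1)) → EuclideanSpace ℝ (Fin (m + 1)) :=
    fun y => (A y).inverse ℓ
  have hνs : ∀ y ∈ U, ContDiffAt ℝ ∞ ν y := fun y hy =>
    (contDiffAt_inverse_clm (hAs y (hU y hy).1) (hU y hy).2).clm_apply contDiffAt_const
  refine ⟨φ.source ∩ φ ⁻¹' U, fieldOfCoord p ν, ⟨hp0, by rw [Set.mem_preimage, hyp']; exact hyU⟩,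
    isOpen_extChartAt_preimage' p hUo, ?_, ?_, ?_⟩
  · intro q hq
    exact (contMDiffAt_fieldOfCoord hq.1 (hνs _ hq.2)).contMDiffWithinAt
  all_goals
    intro q hq
    obtain ⟨hq1, hq2⟩ := hq
    obtain ⟨y, hy, rfl, hyy⟩ := exists_chart_symm_eq hq1
    have hyU' : y ∈ U := by rw [← hyy]; exact hq2
    obtain ⟨N, hN, hN1⟩ := hf.exists_null (φ.symm y)
    obtain ⟨e, he⟩ := (hU y hyU').2
    have hAN : A y (chartDeriv p (φ.symm y) N) = ℓ (chartDeriv p (φ.symm y) N) • ℓ := by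
      have : pullbackForm g (chartMap f p) y (chartDeriv p (φ.symm y) N) = 0 :=
        (hf.radical_coord_iff hy N).1 hN
      ext w
      have h2 := congrArg (fun L => L w) this
      simp only [zero_apply] at h2
      simp [A, h2]
    have hlN : ℓ (chartDeriv p (φ.symm y) N) ≠ 0 := by
      intro h
      rw [h, zero_smul, ← he] at hAN
      exact hN1 (chartDeriv_injective hq1 ((e.injective (hAN.trans (map_zero e).symm)).trans
        (map_zero _).symm))
    have hcoord : chartDeriv p (φ.symm y) (fieldOfCoord p ν (φ.symm y))
        = (ℓ (chartDeriv p (φ.symm y) N))⁻¹ • chartDeriv p (φ.symm y) N := by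
      rw [chartDeriv_fieldOfCoord hq1]
      simp only [ν]
      rw [hyy]
      have : A y ((ℓ (chartDeriv p (φ.symm y) N))⁻¹ • chartDeriv p (φ.symm y) N) = ℓ := by
        rw [map_smul, hAN, smul_smul, inv_mul_cancel₀ hlN, one_smul]
      rw [← he, ContinuousLinearMap.inverse_equiv]
      refine e.symm_apply_eq.2 ?_
      exact this.symm.trans (DFunLike.congr_fun he _).symm
    have hfield : fieldOfCoord p ν (φ.symm y) = (ℓ (chartDeriv p (φ.symm y) N))⁻¹ • N :=
      chartDeriv_injective hq1 (by rw [hcoord, map_smul])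
    rw [hfield]
  · exact smul_ne_zero (inv_ne_zero hlN) hN1
  · exact Submodule.smul_mem _ _ hN

end IsLightlikeHypersurface

end Hypersurface

/-! ### The canonical null field `N` and its connection form `θ`. -/

section Canonical

variable {m : ℕ}
  {M : Type*} [TopologicalSpace M] [ChartedSpace (EuclideanSpace ℝ (Fin (m + 2))) M]
  [IsManifold (𝓡 (m + 2)) ∞ M]
  {V : Type*} [TopologicalSpace V] [ChartedSpace (EuclideanSpace ℝ (Fin (m + 1))) V]
  [IsManifold (𝓡 (m + 1)) ∞ V]
  {g : LorentzMetric (m + 2) M} {f : V → M}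

instance (q : V) : T2Space (TangentSpace (𝓡 (m + 1)) q) :=
  inferInstanceAs (T2Space (EuclideanSpace ℝ (Fin (m + 1))))

/-- The vector field `X` of the hypersurface is smooth at `p`. -/
abbrev SmoothTangentAt (X : (q : V) → TangentSpace (𝓡 (m + 1)) q) (p : V) : Prop :=
  ContMDiffAt (𝓡 (m + 1)) (𝓡 (m + 1)).tangent ∞
    (fun q => (⟨q, X q⟩ : TangentBundle (𝓡 (m + 1)) V)) p

lemma IsNullFieldOn.smoothAt {O : Set V} {e₁ : (q : V) → TangentSpace (𝓡 (m + 1)) q}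
    (h : IsNullFieldOn g f O e₁) {q : V} (hq : q ∈ O) : SmoothTangentAt e₁ q :=
  h.smooth.contMDiffAt (h.isOpen.mem_nhds hq)

/-- The field along `f` defined by a tangent field. -/
def pushField (f : V → M) (X : (q : V) → TangentSpace (𝓡 (m + 1)) q) (q : V) :
    TangentSpace (𝓡 (m + 2)) (f q) := pushforward f q (X q)

/-- The field along `f` defined by a tangent field, in the preferred chart at `p`. -/
def chartField (f : V → M) (X : (q : V) → TangentSpace (𝓡 (m + 1)) q) (p : V)
    (y : EuclideanSpace ℝ (Fin (m + 1))) : TangentSpace (𝓡 (m + 2)) (chartMap f p y) :=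
  pushField f X ((extChartAt (𝓡 (m + 1)) p).symm y)

lemma exists_chart_point (q : V) : ∃ (p : V), ∃ y ∈ (extChartAt (𝓡 (m + 1)) p).target,
    (extChartAt (𝓡 (m + 1)) p).symm y = q :=
  ⟨q, _, (extChartAt (𝓡 (m + 1)) q).map_source (mem_extChartAt_source _),
    (extChartAt (𝓡 (m + 1)) q).left_inv (mem_extChartAt_source _)⟩

namespace IsLightlikeHypersurface

variable (hf : IsLightlikeHypersurface g f)
include hf

lemma smoothFieldAt_push {X : (q : V) → TangentSpace (𝓡 (m + 1)) q} {p : V}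
    (hX : SmoothTangentAt X p) :
    SmoothFieldAt (F := EuclideanSpace ℝ (Fin (m + 1))) f (pushField f X) p :=
  ((hf.smooth.contMDiff_tangentMap (m := ∞) (by simp)).contMDiffAt).comp p hX

/-- Local expression of the covariant derivative of a tangent field. -/
lemma covDir_chartMap {X : (q : V) → TangentSpace (𝓡 (m + 1)) q} {p : V}
    {y : EuclideanSpace ℝ (Fin (m + 1))} (hy : y ∈ (extChartAt (𝓡 (m + 1)) p).target)
    (hX : SmoothTangentAt X ((extChartAt (𝓡 (m + 1)) p).symm y))
    (v : EuclideanSpace ℝ (Fin (m + 1))) :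
    covDir g (chartMap f p) (chartField f X p) v y
      = nablaTangent g f X ((extChartAt (𝓡 (m + 1)) p).symm y) (chartSymmDeriv p y v) :=
  covAlong_comp g (γ := (extChartAt (𝓡 (m + 1)) p).symm)
      ((contMDiffAt_chart_symm hy).mdifferentiableAt (by simp))
    (hf.smoothFieldAt_push hX) v

lemma smoothFieldAt_chartMap {X : (q : V) → TangentSpace (𝓡 (m + 1)) q} {p : V}
    {y : EuclideanSpace ℝ (Fin (m + 1))} (hy : y ∈ (extChartAt (𝓡 (m + 1)) p).target)
    (hX : SmoothTangentAt X ((extChartAt (𝓡 (m + 1)) p).symm y)) :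
    SmoothFieldAt (F := EuclideanSpace ℝ (Fin (m + 1))) (chartMap f p)
      (chartField f X p) y :=
  SmoothFieldAt.comp (γ := (extChartAt (𝓡 (m + 1)) p).symm) (hf.smoothFieldAt_push hX)
    (contMDiffAt_chart_symm hy)

lemma nablaTangent_smul {X Y : (q : V) → TangentSpace (𝓡 (m + 1)) q} {h : V → ℝ} {p : V}
    (hX : SmoothTangentAt X p) (hh : ContMDiffAt (𝓡 (m + 1)) 𝓘(ℝ, ℝ) ∞ h p)
    (hY : ∀ᶠ q in 𝓝 p, Y q = h q • X q) (v : TangentSpace (𝓡 (m + 1)) p) :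
    nablaTangent g f Y p v
      = mvfderiv (𝓡 (m + 1)) h p v • pushforward f p (X p) + h p • nablaTangent g f X p v :=
  (covAlong_congr g (hY.mono fun q hq => by
      show pushforward f q (Y q) = h q • pushField f X q
      rw [hq, map_smul, pushField]) v).trans
    (covAlong_smul g (hf.smoothFieldAt_push hX) hh v)

/-- The derivative of `h` contributes a multiple of `X`, which is orthogonal to all tangent vectors.
-/
lemma isUmbilicFactorAt_smul {X Y : (q : V) → TangentSpace (𝓡 (m + 1)) q} {h : V → ℝ} {p : V}
    {r : ℝ} (hX : SmoothTangentAt X p) (hX0 : X p ∈ radical g f p)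
    (hh : ContMDiffAt (𝓡 (m + 1)) 𝓘(ℝ, ℝ) ∞ h p)
    (hY : ∀ᶠ q in 𝓝 p, Y q = h q • X q) (hr : IsUmbilicFactorAt g f X p r) :
    IsUmbilicFactorAt g f Y p (h p * r) := by
  intro u w
  rw [hf.nablaTangent_smul hX hh hY, map_add, map_smul, map_smul, add_apply, smul_apply,
    smul_apply, hX0 w, hr u w]
  simp [mul_assoc]

lemma contMDiffAt_ratio {X Y : (q : V) → TangentSpace (𝓡 (m + 1)) q} {h : V → ℝ} {p : V}
    (hX : SmoothTangentAt X p) (hY' : SmoothTangentAt Y p) (hX0 : X p ≠ 0)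
    (hY : ∀ᶠ q in 𝓝 p, Y q = h q • X q) : ContMDiffAt (𝓡 (m + 1)) 𝓘(ℝ, ℝ) ∞ h p :=
  contMDiffAt_coefficient (hf.smoothFieldAt_push hX) (hf.smoothFieldAt_push hY')
    (hf.pushforward_ne_zero hX0) (hY.mono fun q hq => by
      show pushforward f q (Y q) = h q • pushforward f q (X q)
      rw [hq, map_smul])

/-- The normalized null vector `e₁ / λ` does not depend on the null field. -/
lemma umbilic_ratio (hm : 1 ≤ m) {O O' : Set V} {X Y : (q : V) → TangentSpace (𝓡 (m + 1)) q}
    (hX : IsNullFieldOn g f O X) (hY : IsNullFieldOn g f O' Y) {q : V} (hq : q ∈ O) (hq' : q ∈ O')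
    {r s : ℝ} (hr : IsUmbilicFactorAt g f X q r) (hs : IsUmbilicFactorAt g f Y q s) :
    r • Y q = s • X q := by
  have h1 : ∀ z ∈ O ∩ O', ∃ a : ℝ, Y z = a • X z := fun z hz =>
    (hf.mem_radical_iff (hX.null z hz.1) (hX.ne_zero z hz.1)).1 (hY.null z hz.2)
  choose! h hh using h1
  have hev : ∀ᶠ z in 𝓝 q, Y z = h z • X z :=
    ((hX.isOpen.inter hY.isOpen).mem_nhds ⟨hq, hq'⟩ : O ∩ O' ∈ 𝓝 q) |> Filter.mem_of_superset <| hh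
  have hs' := hf.isUmbilicFactorAt_smul (hX.smoothAt hq) (hX.null q hq)
    (hf.contMDiffAt_ratio (hX.smoothAt hq) (hY.smoothAt hq') (hX.ne_zero q hq) hev) hev hr
  rw [hs.unique hf hm hs', hev.self_of_nhds, smul_smul, mul_comm]

/-- For a constant coordinate vector `b` that is not null at `q`, the factor is `(∇_b X, b) / (b,
b)` near `q`. -/
lemma contMDiffAt_umbilicFactor (hm : 1 ≤ m) {O : Set V} {X : (q : V) → TangentSpace (𝓡 (m + 1)) q}
    (hX : IsNullFieldOn g f O X) {lam : V → ℝ} (hl : ∀ q ∈ O, IsUmbilicFactorAt g f X q (lam q))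
    {q : V} (hq : q ∈ O) : ContMDiffAt (𝓡 (m + 1)) 𝓘(ℝ, ℝ) ∞ lam q := by
  set φ := extChartAt (𝓡 (m + 1)) q with hφ
  have hq0 : q ∈ φ.source := mem_extChartAt_source q
  obtain ⟨u, hu⟩ := hf.exists_notMem_radical hm (φ.symm (φ q))
  let b : EuclideanSpace ℝ (Fin (m + 1)) := chartDeriv q (φ.symm (φ q)) u
  let E : (y : EuclideanSpace ℝ (Fin (m + 1))) → TangentSpace (𝓡 (m + 2)) (chartMap f q y) :=
    chartField f X q
  have hy0 : φ q ∈ φ.target := φ.map_source hq0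
  have hsymm : φ.symm (φ q) = q := φ.left_inv hq0
  have hnear : ∀ᶠ y in 𝓝 (φ q), y ∈ φ.target ∧ φ.symm y ∈ O := by
    refine (eventually_mem_target hy0).and ((contMDiffAt_chart_symm hy0).continuousAt.eventually_mem
      ((hX.isOpen).mem_nhds ?_))
    rw [← hφ, hsymm]; exact hq
  have hE : ∀ᶠ y in 𝓝 (φ q), SmoothFieldAt (F := EuclideanSpace ℝ (Fin (m + 1)))
      (chartMap f q) E y :=
    hnear.mono fun y hy => hf.smoothFieldAt_chartMap hy.1 (hX.smoothAt hy.2)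
  have hU := smoothFieldAt_mapDir (hf.eventually_contMDiffAt_chartMap hy0) b
  have hnum := contMDiffAt_metric (g := g) (smoothFieldAt_covDir g hE b) hU
  have hden := contMDiffAt_metric (g := g) hU hU
  have hne : g.val (chartMap f q (φ q)) (mapDir (n := m + 2) (chartMap f q) b (φ q))
      (mapDir (n := m + 2) (chartMap f q) b (φ q)) ≠ 0 := by
    rw [hf.mapDir_chartMap_chartDeriv hy0]
    exact (hf.pos_of_notMem_radical hu).ne'
  have hq2 : ContMDiffAt 𝓘(ℝ, EuclideanSpace ℝ (Fin (m + 1))) 𝓘(ℝ, ℝ) ∞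
      (fun y => lam (φ.symm y)) (φ q) := by
    refine (hnum.div₀ hden hne).congr_of_eventuallyEq ?_
    filter_upwards [hnear, hden.continuousAt.eventually_ne hne] with y hy hy'
    refine (eq_div_iff hy').2 ?_
    have h1 : covDir g (chartMap f q) E b y
        = nablaTangent g f X (φ.symm y) (chartSymmDeriv q y b) :=
      hf.covDir_chartMap hy.1 (hX.smoothAt hy.2) b
    show _ = g.val (chartMap f q y) (covDir g (chartMap f q) E b y)
      (mapDir (n := m + 2) (chartMap f q) b y)
    rw [h1, hf.mapDir_chartMap hy.1]
    exact (hl _ hy.2 _ _).symm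
  have h3 := hq2.comp q (contMDiffAt_chart (x := q) hq0)
  refine h3.congr_of_eventuallyEq ?_
  filter_upwards [(isOpen_extChartAt_source q).mem_nhds hq0] with z hz
  exact congrArg lam (φ.left_inv hz).symm

end IsLightlikeHypersurface

/-- `N` is the null field of umbilic factor `1`, and `θ` its connection form:
`∇_v N = v + θ(v) N`. -/
structure IsCanonicalField (g : LorentzMetric (m + 2) M) (f : V → M)
    (N : (q : V) → TangentSpace (𝓡 (m + 1)) q)
    (θ : (q : V) → TangentSpace (𝓡 (m + 1)) q →L[ℝ] ℝ) : Prop where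
  null : IsNullFieldOn g f Set.univ N
  nabla (q : V) (v : TangentSpace (𝓡 (m + 1)) q) :
    nablaTangent g f N q v = pushforward f q v + θ q v • pushforward f q (N q)

/-- By `umbilic_ratio` the local fields `e₁ / λ` agree on overlaps, so they glue with no partition
of unity. -/
lemma IsLightlikeHypersurface.exists_canonicalField (hf : IsLightlikeHypersurface g f) (hm : 1 ≤ m)
    (humb : IsTotallyUmbilical g f) : ∃ N θ, IsCanonicalField g f N θ := by
  choose O X hO hX using hf.exists_nullField
  choose r hr0 hr using fun q => humb (O q) (X q) (hX q) q (hO q)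
  -- At each `q` the value comes from the null field chosen around `q`. Smoothness is not visible
  -- here; `hloc` compares with the single field chosen around a nearby `p`.
  let N : (q : V) → TangentSpace (𝓡 (m + 1)) q := fun q => (r q)⁻¹ • X q q
  have hloc : ∀ p : V, ∃ lam : V → ℝ, ContMDiffAt (𝓡 (m + 1)) 𝓘(ℝ, ℝ) ∞ lam p ∧ lam p ≠ 0 ∧
      IsUmbilicFactorAt g f (X p) p (lam p) ∧ ∀ᶠ q in 𝓝 p, N q = (lam q)⁻¹ • X p q := by
    intro p
    choose! lam hl0 hl using humb (O p) (X p) (hX p)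
    refine ⟨lam, hf.contMDiffAt_umbilicFactor hm (hX p) hl (hO p), hl0 p (hO p), hl p (hO p), ?_⟩
    filter_upwards [(hX p).isOpen.mem_nhds (hO p)] with q hq
    have := hf.umbilic_ratio hm (hX q) (hX p) (hO q) hq (hr q) (hl q hq)
    show (r q)⁻¹ • X q q = _
    rw [inv_smul_eq_iff₀ (hr0 q), smul_comm, this, inv_smul_smul₀ (hl0 q hq)]
  have hsm : ∀ p, SmoothTangentAt N p := by
    intro p
    obtain ⟨lam, hl, hl0, -, hN⟩ := hloc p
    exact SmoothFieldAt.congr (F := EuclideanSpace ℝ (Fin (m + 1))) (c := fun q : V => q)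
      (SmoothFieldAt.smul (hl.inv₀ hl0) ((hX p).smoothAt (hO p))) hN
  have hnull : IsNullFieldOn g f Set.univ N :=
    ⟨isOpen_univ, fun p _ => (hsm p).contMDiffWithinAt,
      fun q _ => smul_ne_zero (inv_ne_zero (hr0 q)) ((hX q).ne_zero q (hO q)),
      fun q _ => Submodule.smul_mem _ _ ((hX q).null q (hO q))⟩
  have hfac : ∀ p, IsUmbilicFactorAt g f N p 1 := by
    intro p
    obtain ⟨lam, hl, hl0, hlp, hN⟩ := hloc p
    have := hf.isUmbilicFactorAt_smul ((hX p).smoothAt (hO p)) ((hX p).null p (hO p)) (hl.inv₀ hl0)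
      hN hlp
    rwa [inv_mul_cancel₀ hl0] at this
  have hex : ∀ q (v : TangentSpace (𝓡 (m + 1)) q), ∃ a : ℝ,
      nablaTangent g f N q v = pushforward f q v + a • pushforward f q (N q) := by
    intro q v
    obtain ⟨a, ha⟩ := (hfac q).exists_eq hf (hnull.null q trivial) (hnull.ne_zero q trivial) v
    exact ⟨a, by rw [ha, one_smul]⟩
  choose θ hθ using hex
  have hinj : ∀ q (a b : ℝ), a • pushforward f q (N q) = b • pushforward f q (N q) → a = b :=
    fun q a b h => smul_left_injective ℝ (hf.pushforward_ne_zero (hnull.ne_zero q trivial)) h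
  -- The coefficient of the nonzero vector `N` is unique, so linearity of `θ` follows from linearity
  -- of `∇_v N` in `v`.
  let θl : (q : V) → TangentSpace (𝓡 (m + 1)) q →ₗ[ℝ] ℝ := fun q =>
    { toFun := θ q
      map_add' := fun u v => hinj q _ _ (by
        have h : nablaTangent g f N q (u + v) = nablaTangent g f N q u + nablaTangent g f N q v :=
          covAlong_add_dir g f _ q u v
        rw [hθ, hθ, hθ, map_add] at h
        rw [add_smul]
        have key : ∀ a b c d e : TangentSpace (𝓡 (m + 2)) (f q),
            a + b + c = a + d + (b + e) → c = d + e := by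
          intro a b c d e h
          have : a + b + c = a + b + (d + e) := by rw [h]; abel
          exact add_left_cancel this
        exact key _ _ _ _ _ h)
      map_smul' := fun a v => hinj q _ _ (by
        have h : nablaTangent g f N q (a • v) = a • nablaTangent g f N q v :=
          covAlong_smul_dir g f _ q a v
        rw [hθ, hθ, map_smul, smul_add] at h
        rw [RingHom.id_apply, smul_eq_mul, mul_smul]
        exact add_left_cancel h) }
  exact ⟨N, fun q => LinearMap.toContinuousLinearMap (θl q), hnull, hθ⟩

/-- The connection form of the canonical field in the preferred chart at `p`. -/
def thetaCoord (θ : (q : V) → TangentSpace (𝓡 (m + 1)) q →L[ℝ] ℝ) (p : V)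
    (y : EuclideanSpace ℝ (Fin (m + 1))) : EuclideanSpace ℝ (Fin (m + 1)) →L[ℝ] ℝ :=
  ContinuousLinearMap.comp (θ ((extChartAt (𝓡 (m + 1)) p).symm y)) (chartSymmDeriv p y)

/-- The components of a tangent field in the preferred chart at `p`. -/
def fieldCoord (N : (q : V) → TangentSpace (𝓡 (m + 1)) q) (p : V)
    (y : EuclideanSpace ℝ (Fin (m + 1))) : EuclideanSpace ℝ (Fin (m + 1)) :=
  chartDeriv p ((extChartAt (𝓡 (m + 1)) p).symm y) (N ((extChartAt (𝓡 (m + 1)) p).symm y))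

lemma contDiffAt_fieldCoord {N : (q : V) → TangentSpace (𝓡 (m + 1)) q} {p : V}
    {y : EuclideanSpace ℝ (Fin (m + 1))} (hy : y ∈ (extChartAt (𝓡 (m + 1)) p).target)
    (hN : SmoothTangentAt N ((extChartAt (𝓡 (m + 1)) p).symm y)) :
    ContDiffAt ℝ ∞ (fieldCoord N p) y := by
  rw [← contMDiffAt_iff_contDiffAt]
  have h := SmoothFieldAt.coord (F := EuclideanSpace ℝ (Fin (m + 1))) (c := fun q : V => q) hN
    (x := p) ((extChartAt (𝓡 (m + 1)) p).map_target hy)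
  exact ContMDiffAt.comp (g := fun q => chartDeriv p q (N q)) y h (contMDiffAt_chart_symm hy)

lemma thetaCoord_chartDeriv (θ : (q : V) → TangentSpace (𝓡 (m + 1)) q →L[ℝ] ℝ) {p : V}
    {y : EuclideanSpace ℝ (Fin (m + 1))} (hy : y ∈ (extChartAt (𝓡 (m + 1)) p).target)
    (v : TangentSpace (𝓡 (m + 1)) ((extChartAt (𝓡 (m + 1)) p).symm y)) :
    thetaCoord θ p y (chartDeriv p ((extChartAt (𝓡 (m + 1)) p).symm y) v)
      = θ ((extChartAt (𝓡 (m + 1)) p).symm y) v :=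
  congrArg (θ ((extChartAt (𝓡 (m + 1)) p).symm y)) (chartSymmDeriv_chartDeriv_symm hy v)

namespace IsCanonicalField

variable {N : (q : V) → TangentSpace (𝓡 (m + 1)) q}
  {θ : (q : V) → TangentSpace (𝓡 (m + 1)) q →L[ℝ] ℝ}

lemma smoothAt (hc : IsCanonicalField g f N θ) (q : V) : SmoothTangentAt N q :=
  hc.null.smoothAt trivial

lemma ne_zero (hc : IsCanonicalField g f N θ) (q : V) : N q ≠ 0 := hc.null.ne_zero q trivial

lemma mem_radical (hc : IsCanonicalField g f N θ) (q : V) : N q ∈ radical g f q :=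
  hc.null.null q trivial

lemma isUmbilicFactorAt (hc : IsCanonicalField g f N θ) (q : V) : IsUmbilicFactorAt g f N q 1 := by
  intro u w
  rw [hc.nabla, map_add, add_apply, map_smul, smul_apply, hc.mem_radical q w, smul_zero, add_zero,
    one_mul]

lemma eq_smul (hc : IsCanonicalField g f N θ) (hf : IsLightlikeHypersurface g f) (hm : 1 ≤ m)
    {O : Set V} {e₁ : (q : V) → TangentSpace (𝓡 (m + 1)) q} (h : IsNullFieldOn g f O e₁) {q : V}
    (hq : q ∈ O) {r : ℝ} (hr : IsUmbilicFactorAt g f e₁ q r) : e₁ q = r • N q := by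
  rw [← one_smul ℝ (e₁ q)]
  exact hf.umbilic_ratio hm hc.null h trivial hq (hc.isUmbilicFactorAt q) hr

lemma covDir_eq (hc : IsCanonicalField g f N θ) (hf : IsLightlikeHypersurface g f) {p : V}
    {y : EuclideanSpace ℝ (Fin (m + 1))} (hy : y ∈ (extChartAt (𝓡 (m + 1)) p).target)
    (v : EuclideanSpace ℝ (Fin (m + 1))) :
    covDir g (chartMap f p) (chartField f N p) v y
      = mapDir (n := m + 2) (chartMap f p) v y
        + thetaCoord θ p y v • chartField f N p y := by
  rw [hf.covDir_chartMap hy (hc.smoothAt _), hc.nabla, hf.mapDir_chartMap hy]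
  rfl

/-- `θ(v)` is the coefficient of the smooth field `∇_v N - v` along the nonvanishing field `N`. -/
lemma contDiffAt_thetaCoord (hc : IsCanonicalField g f N θ) (hf : IsLightlikeHypersurface g f)
    {p : V} {y : EuclideanSpace ℝ (Fin (m + 1))} (hy : y ∈ (extChartAt (𝓡 (m + 1)) p).target) :
    ContDiffAt ℝ ∞ (thetaCoord θ p) y := by
  refine contDiffAt_clm_of_apply fun v => ?_
  rw [← contMDiffAt_iff_contDiffAt]
  have hE : ∀ᶠ z in 𝓝 y, SmoothFieldAt (F := EuclideanSpace ℝ (Fin (m + 1))) (chartMap f p)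
      (chartField f N p) z :=
    (eventually_mem_target hy).mono fun z hz => hf.smoothFieldAt_chartMap hz (hc.smoothAt _)
  refine contMDiffAt_coefficient hE.self_of_nhds ((smoothFieldAt_covDir g hE v).sub
    (smoothFieldAt_mapDir (hf.eventually_contMDiffAt_chartMap hy) v))
    (hf.pushforward_ne_zero (hc.ne_zero _)) ?_
  filter_upwards [eventually_mem_target hy] with z hz
  rw [hc.covDir_eq hf hz, add_sub_cancel_left]

lemma curvature_eq (hc : IsCanonicalField g f N θ) (hf : IsLightlikeHypersurface g f)
    {p : V} {y : EuclideanSpace ℝ (Fin (m + 1))} (hy : y ∈ (extChartAt (𝓡 (m + 1)) p).target)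
    (u v : TangentSpace (𝓡 (m + 1)) ((extChartAt (𝓡 (m + 1)) p).symm y)) :
    curvature g (f ((extChartAt (𝓡 (m + 1)) p).symm y)) (pushforward f _ u) (pushforward f _ v)
        (pushforward f _ (N ((extChartAt (𝓡 (m + 1)) p).symm y)))
      = (fderiv ℝ (thetaCoord θ p) y (chartDeriv p _ u) (chartDeriv p _ v)
          - fderiv ℝ (thetaCoord θ p) y (chartDeriv p _ v) (chartDeriv p _ u))
          • pushforward f _ (N ((extChartAt (𝓡 (m + 1)) p).symm y))
        + (θ _ v • pushforward f _ u - θ _ u • pushforward f _ v) := by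
  have hE : ∀ᶠ z in 𝓝 y, SmoothFieldAt (F := EuclideanSpace ℝ (Fin (m + 1))) (chartMap f p)
      (chartField f N p) z :=
    (eventually_mem_target hy).mono fun z hz => hf.smoothFieldAt_chartMap hz (hc.smoothAt _)
  have h := curvature_of_covDir_eq g hE (hc.contDiffAt_thetaCoord hf hy)
    ((eventually_mem_target hy).mono fun z hz v => hc.covDir_eq hf hz v)
    (chartDeriv p _ u) (chartDeriv p _ v)
  rw [hf.mapDir_chartMap_chartDeriv hy, hf.mapDir_chartMap_chartDeriv hy,
    thetaCoord_chartDeriv θ hy, thetaCoord_chartDeriv θ hy] at h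
  exact h

/-- `R(u, N) N` is `θ(N) u` plus a multiple of `N`, and `N` is orthogonal to `u`. So the curvature
is the same for all planes through `N`. -/
lemma isotropicSectionalCurvature_eq (hc : IsCanonicalField g f N θ)
    (hf : IsLightlikeHypersurface g f) {q : V} {u : TangentSpace (𝓡 (m + 1)) q}
    (hu : u ∉ radical g f q) :
    isotropicSectionalCurvature g (f q) (pushforward f q (N q)) (pushforward f q u)
      = θ q (N q) := by
  obtain ⟨p, y, hy, rfl⟩ := exists_chart_point (m := m) q
  unfold isotropicSectionalCurvature
  rw [hc.curvature_eq hf hy]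
  simp only [map_add, map_sub, map_smul, add_apply, sub_apply, smul_apply, hc.mem_radical _ u,
    smul_eq_mul, mul_zero, zero_add, sub_zero]
  exact mul_div_cancel_right₀ _ (hf.pos_of_notMem_radical hu).ne'

lemma theta_ne_zero (hc : IsCanonicalField g f N θ) (hf : IsLightlikeHypersurface g f) (hm : 1 ≤ m)
    (hK : HasNonvanishingIsotropicCurvature g f) (q : V) : θ q (N q) ≠ 0 := by
  obtain ⟨u, hu⟩ := hf.exists_notMem_radical hm q
  rw [← hc.isotropicSectionalCurvature_eq hf hu]
  exact hK q (N q) u (hc.mem_radical q) (hc.ne_zero q) hu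

/-- The differential of the singular point `x - N`. -/
lemma pointDifferential_eq (hc : IsCanonicalField g f N θ) (q : V)
    (v : TangentSpace (𝓡 (m + 1)) q) :
    pointDifferential (F := EuclideanSpace ℝ (Fin (m + 1))) g f (fun q =>
        -pushforward f q (N q)) q v
      = -(θ q v • pushforward f q (N q)) := by
  have h : covAlong (F := EuclideanSpace ℝ (Fin (m + 1))) g f (fun q => -pushforward f q (N q)) q v
      = -nablaTangent g f N q v := covAlong_neg g v
  have e : pointDifferential (F := EuclideanSpace ℝ (Fin (m + 1))) g f
      (fun q => -pushforward f q (N q)) q v = pushforward f q v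
        + covAlong (F := EuclideanSpace ℝ (Fin (m + 1))) g f (fun q =>
            -pushforward f q (N q)) q v :=
    rfl
  rw [e, h, hc.nabla]
  abel

lemma isSingularPoint_iff (hc : IsCanonicalField g f N θ) (hf : IsLightlikeHypersurface g f)
    (hm : 1 ≤ m) (humb : IsTotallyUmbilical g f) (q : V) (Y : TangentSpace (𝓡 (m + 2)) (f q)) :
    IsSingularPoint g f q Y ↔ Y = -pushforward f q (N q) := by
  constructor
  · rintro ⟨O, e₁, s, hq, he, rfl, w, hw, hs⟩
    obtain ⟨r, hr0, hr⟩ := humb O e₁ he q hq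
    have hN := hc.eq_smul hf hm he hq hr
    obtain ⟨a, ha⟩ := hr.exists_eq hf (he.null q hq) (he.ne_zero q hq) w
    obtain ⟨b, hb⟩ := Submodule.mem_span_singleton.1 hs
    -- With `∇_w e₁ = r w + a e₁`, degeneracy modulo `e₁` puts `(1 + s r) w` on the null line. As
    -- `w` is not null, `s = -1 / r`.
    have h1 : (1 + s * r) • w = (b - s * a) • e₁ q := hf.immersion q (by
      rw [map_smul, map_smul, sub_smul, hb, ha]
      simp only [smul_add, add_smul, smul_smul, one_smul]
      abel)
    have h2 : 1 + s * r = 0 := by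
      by_contra h
      refine hw ((hf.mem_radical_iff (he.null q hq) (he.ne_zero q hq)).2
        ⟨(1 + s * r)⁻¹ * (b - s * a), ?_⟩)
      rw [mul_smul, ← h1, inv_smul_smul₀ h]
    rw [hN, map_smul, smul_smul, ← neg_one_smul ℝ]
    congr 1
    linarith
  · rintro rfl
    obtain ⟨w, hw⟩ := hf.exists_notMem_radical hm q
    refine ⟨Set.univ, N, -1, trivial, hc.null, (neg_one_smul ℝ _).symm, w, hw, ?_⟩
    rw [hc.nabla, neg_one_smul, neg_add, ← add_assoc, add_neg_cancel, zero_add, ← neg_smul]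
    exact Submodule.smul_mem _ _ (Submodule.mem_span_singleton_self _)

end IsCanonicalField

end Canonical

/-! ### The Frobenius theorem for the kernel of one form. -/

section Frobenius

open Set

variable {E : Type*} [NormedAddCommGroup E] [NormedSpace ℝ E]

/-- Restricted to the ray `t ↦ t x`, the equation `dz = a(x, z)` is a scalar ODE. The global bounds
on `a` give a solution on all of `[0, 1]`. -/
lemma exists_ray_solution {a : E × ℝ → E →L[ℝ] ℝ} {C : ℝ} {L : NNReal} (hC : ∀ P, ‖a P‖ ≤ C)
    (hL : LipschitzWith L a) (x : E) :
    ∃ w : ℝ → ℝ, w 0 = 0 ∧ (∀ t ∈ Icc (0 : ℝ) 1,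
      HasDerivWithinAt w (a (t • x, w t) x) (Icc 0 1) t) ∧
      ∀ t ∈ Icc (0 : ℝ) 1, |w t| ≤ C * ‖x‖ := by
  have hC0 : 0 ≤ C := (norm_nonneg _).trans (hC 0)
  have hb : ∀ t z : ℝ, ‖a (t • x, z) x‖ ≤ C * ‖x‖ := fun t z =>
    ((a _).le_opNorm x).trans (mul_le_mul_of_nonneg_right (hC _) (norm_nonneg _))
  -- The bound `C ‖x‖` on the speed is also the radius allowed for the solution, since the interval
  -- has length one.
  let C' : NNReal := ⟨C * ‖x‖, by positivity⟩
  have hpl : IsPicardLindelof (fun t z : ℝ => a (t • x, z) x) (⟨0, by simp⟩ : Icc (0 : ℝ) 1) (0 :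
      ℝ) C' 0
      C' (‖x‖₊ * L) := by
    refine ⟨fun t _ => LipschitzWith.lipschitzOnWith ?_, fun z _ => ?_, fun t _ z _ => hb t z, ?_⟩
    · refine LipschitzWith.of_dist_le_mul fun z z' => ?_
      rw [dist_eq_norm, ← sub_apply]
      refine ((a _ - a _).le_opNorm x).trans ?_
      have h := hL.dist_le_mul (t • x, z) (t • x, z')
      rw [dist_eq_norm, Prod.dist_eq, dist_self, max_eq_right dist_nonneg] at h
      push_cast
      nlinarith [norm_nonneg x]
    · have := hL.continuous
      fun_prop
    · simp
  obtain ⟨w, hw0, hw⟩ := hpl.exists_eq_forall_mem_Icc_hasDerivWithinAt₀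
  refine ⟨w, hw0, hw, fun t ht => ?_⟩
  have h := (convex_Icc (0 : ℝ) 1).norm_image_sub_le_of_norm_hasDerivWithin_le hw
    (fun s _ => hb s (w s)) (left_mem_Icc.2 zero_le_one) ht
  have hw0' : w 0 = 0 := hw0
  rw [hw0', sub_zero, sub_zero, Real.norm_eq_abs, Real.norm_eq_abs, abs_of_nonneg ht.1] at h
  refine h.trans ?_
  have : 0 ≤ C * ‖x‖ := by positivity
  nlinarith [ht.2]

lemma gronwallBound_zero_left (K ε t : ℝ) : gronwallBound 0 K ε t = ε * gronwallBound 0 K 1 t := by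
  unfold gronwallBound
  split_ifs <;> ring

/-- If the equation `dz = a(x, z)` satisfies the integrability condition near the origin, then the
solutions along the rays from the origin fit together to a solution. -/
lemma exists_hasFDerivAt_of_integrable {a : E × ℝ → E →L[ℝ] ℝ} {C : ℝ} {L K : NNReal}
    (hC : ∀ P, ‖a P‖ ≤ C) (hd : Differentiable ℝ a) (hL : LipschitzWith L a)
    (hK : LipschitzWith K (fderiv ℝ a))
    (hint : ∀ᶠ P in 𝓝 (0 : E × ℝ), ∀ ξ η : E, fderiv ℝ a P (ξ, a P ξ) η = fderiv ℝ a P (η,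
        a P η) ξ) :
    ∃ z : E → ℝ, z 0 = 0 ∧ ∀ᶠ x in 𝓝 (0 : E), HasFDerivAt z (a (x, z x)) x := by
  choose w hw0 hw hwb using exists_ray_solution hC hL
  have hC0 : 0 ≤ C := (norm_nonneg _).trans (hC 0)
  refine ⟨fun x => w x 1, ?_, ?_⟩
  · have := hwb 0 1 (right_mem_Icc.2 zero_le_one)
    rw [norm_zero, mul_zero] at this
    exact abs_nonpos_iff.1 this
  obtain ⟨δ, hδ, hint⟩ := Metric.eventually_nhds_iff.1 hint
  -- For such `x` the whole curve `(t x, w x t)` stays in the ball where the integrability condition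
  -- holds.
  have hx : ∀ᶠ x in 𝓝 (0 : E), (1 + C) * ‖x‖ < δ := by
    have : Filter.Tendsto (fun x : E => (1 + C) * ‖x‖) (𝓝 0) (𝓝 ((1 + C) * ‖(0 : E)‖)) :=
      (continuous_const.mul continuous_norm).tendsto 0
    rw [norm_zero, mul_zero] at this
    exact this.eventually_lt_const hδ
  filter_upwards [hx] with x hx
  have hLb : ∀ P, ‖fderiv ℝ a P‖ ≤ L := fun P => norm_fderiv_le_of_lipschitz ℝ hL
  let P : ℝ → E × ℝ := fun t => (t • x, w x t)
  have hP : ∀ t ∈ Icc (0 : ℝ) 1, dist (P t) 0 < δ := by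
    intro t ht
    rw [dist_zero_right, Prod.norm_def]
    refine max_lt ?_ ?_
    · show ‖t • x‖ < δ
      rw [norm_smul, Real.norm_eq_abs, abs_of_nonneg ht.1]
      nlinarith [norm_nonneg x, ht.2, mul_nonneg hC0 (norm_nonneg x)]
    · refine lt_of_le_of_lt (hwb x t ht) ?_
      nlinarith [norm_nonneg x]
  have hPd : ∀ t ∈ Icc (0 : ℝ) 1, HasDerivWithinAt P (x, a (P t) x) (Icc 0 1) t := by
    intro t ht
    refine HasDerivWithinAt.prodMk ?_ (hw x t ht)
    simpa using ((hasDerivAt_id t).smul_const x).hasDerivWithinAt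
  have had : ∀ ξ, ∀ t ∈ Icc (0 : ℝ) 1, HasDerivWithinAt (fun t => a (P t) ξ)
      (fderiv ℝ a (P t) (x, a (P t) x) ξ) (Icc 0 1) t := by
    intro ξ t ht
    have h1 := (hd (P t)).hasFDerivAt.comp_hasDerivWithinAt t (hPd t ht)
    simpa using h1.clm_apply (hasDerivWithinAt_const t _ ξ)
  -- This is the first-order guess for the solution along the neighbouring ray through `x + ξ`. Its
  -- value at `t = 1` is `z(x) + a(x, z(x)) ξ`, so showing that it is correct up to `‖ξ‖²` proves
  -- the claim.
  let v : E → ℝ → ℝ := fun ξ t => w x t + t * a (P t) ξ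
  have hv : ∀ ξ, ∀ t ∈ Icc (0 : ℝ) 1, HasDerivWithinAt (v ξ)
      (a (P t) x + (a (P t) ξ + t * fderiv ℝ a (P t) (x, a (P t) x) ξ)) (Icc 0 1) t := by
    intro ξ t ht
    refine ((hw x t ht).add ((hasDerivWithinAt_id t _).mul (had ξ t ht))).congr_deriv ?_
    simp [P]
  -- The first summand bounds `t Da(h) ξ`; the second bounds the Taylor remainder of `a` applied to
  -- `x + ξ`. Here `h = (ξ, a(P) ξ)` has norm at most `(1 + C) ‖ξ‖`.
  set Q : ℝ := L * (1 + C) + K * (1 + C) ^ 2 * (‖x‖ + 1) with hQ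
  have hrem : ∀ (A : E × ℝ) (h : E × ℝ), ‖a (A + h) - a A - fderiv ℝ a A h‖ ≤ K * ‖h‖ ^ 2 := by
    intro A h
    have := (convex_closedBall A ‖h‖).norm_image_sub_le_of_norm_fderiv_le' (f := a)
      (φ := fderiv ℝ a A) (C := K * ‖h‖) (x := A) (y := A + h) (fun B _ => hd B)
      (fun B hB => by
        rw [← dist_eq_norm]
        refine (hK.dist_le_mul B A).trans ?_
        exact mul_le_mul_of_nonneg_left (Metric.mem_closedBall.1 hB) K.2)
      (Metric.mem_closedBall_self (norm_nonneg _)) (by simp [dist_eq_norm])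
    rw [add_sub_cancel_left] at this
    refine this.trans (le_of_eq (by ring))
  have happrox : ∀ ξ : E, ‖ξ‖ ≤ 1 → ∀ t ∈ Icc (0 : ℝ) 1,
      dist (a (P t) x + (a (P t) ξ + t * fderiv ℝ a (P t) (x, a (P t) x) ξ))
        (a (t • (x + ξ), v ξ t) (x + ξ)) ≤ Q * ‖ξ‖ ^ 2 := by
    intro ξ hξ t ht
    set h : E × ℝ := (ξ, a (P t) ξ) with hh
    have haξ : |a (P t) ξ| ≤ C * ‖ξ‖ :=
      ((a _).le_opNorm ξ).trans (mul_le_mul_of_nonneg_right (hC _) (norm_nonneg _))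
    have hhn : ‖h‖ ≤ (1 + C) * ‖ξ‖ := by
      rw [hh, Prod.norm_def]
      refine max_le ?_ ?_
      · show ‖ξ‖ ≤ _
        nlinarith [norm_nonneg ξ, mul_nonneg hC0 (norm_nonneg ξ)]
      · refine haξ.trans ?_
        nlinarith [norm_nonneg ξ]
    have hpt : (t • (x + ξ), v ξ t) = P t + t • h := by
      simp only [P, v, hh, smul_add, Prod.smul_mk, Prod.mk_add_mk, smul_eq_mul]
    -- Integrability exchanges `ξ` and `x`. It turns the derivative of the guess into the linear
    -- part of the right-hand side for `x + ξ`, so only quadratic errors in `ξ` survive.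
    have hsym := hint (hP t ht) ξ x
    set R := a (P t + t • h) - a (P t) - fderiv ℝ a (P t) (t • h) with hR
    have hRn : ‖R‖ ≤ K * (1 + C) ^ 2 * ‖ξ‖ ^ 2 := by
      refine (hrem _ _).trans ?_
      have h1 : ‖t • h‖ ≤ (1 + C) * ‖ξ‖ := by
        rw [norm_smul, Real.norm_eq_abs, abs_of_nonneg ht.1]
        nlinarith [norm_nonneg h, ht.2]
      calc (K : ℝ) * ‖t • h‖ ^ 2 ≤ K * ((1 + C) * ‖ξ‖) ^ 2 := by gcongr
        _ = _ := by ring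
    have haP : a (P t + t • h) = R + a (P t) + t • fderiv ℝ a (P t) h := by
      rw [hR, map_smul]; abel
    have hdiff : a (P t) x + (a (P t) ξ + t * fderiv ℝ a (P t) (x, a (P t) x) ξ)
        - a (t • (x + ξ), v ξ t) (x + ξ) = -(t * fderiv ℝ a (P t) h ξ + R (x + ξ)) := by
      rw [hpt, haP]
      simp only [add_apply, smul_apply, map_add, smul_eq_mul]
      rw [← hsym]
      ring
    rw [dist_eq_norm, hdiff, norm_neg]
    have h1 : ‖t * fderiv ℝ a (P t) h ξ‖ ≤ L * (1 + C) * ‖ξ‖ ^ 2 := by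
      have e1 : ‖fderiv ℝ a (P t) h ξ‖ ≤ L * ((1 + C) * ‖ξ‖) * ‖ξ‖ := by
        refine ((fderiv ℝ a (P t) h).le_opNorm ξ).trans ?_
        gcongr
        refine ((fderiv ℝ a (P t)).le_opNorm h).trans ?_
        gcongr
        exact hLb _
      rw [norm_mul, Real.norm_eq_abs, abs_of_nonneg ht.1]
      nlinarith [norm_nonneg (fderiv ℝ a (P t) h ξ), ht.2]
    have h2 : ‖R (x + ξ)‖ ≤ K * (1 + C) ^ 2 * ‖ξ‖ ^ 2 * (‖x‖ + 1) := by
      refine (R.le_opNorm _).trans ?_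
      gcongr
      exact (norm_add_le _ _).trans (by linarith)
    refine (norm_add_le _ _).trans ((add_le_add h1 h2).trans (le_of_eq ?_))
    rw [hQ]; ring
  have hmain : ∀ ξ : E, ‖ξ‖ ≤ 1 → ‖w (x + ξ) 1 - w x 1 - a (x, w x 1) ξ‖
      ≤ gronwallBound 0 (L * (‖x‖₊ + 1) : NNReal) 1 1 * Q * ‖ξ‖ ^ 2 := by
    intro ξ hξ
    have hmem : ∀ t ∈ Ico (0 : ℝ) 1, t ∈ Icc (0 : ℝ) 1 := fun t ht => Ico_subset_Icc_self ht
    have hnb : ∀ t ∈ Ico (0 : ℝ) 1, Icc (0 : ℝ) 1 ∈ 𝓝[Ici t] t := fun t ht =>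
      Icc_mem_nhdsGE_of_mem ht
    -- Gronwall: the true solution (error `0`) and the guess (error `Q ‖ξ‖²`) both start at `0`, so
    -- their distance at `t = 1` is quadratic in `ξ`.
    have h := dist_le_of_approx_trajectories_ODE (v := fun t z => a (t • (x + ξ), z) (x + ξ))
      (f := w (x + ξ)) (g := v ξ) (K := L * (‖x‖₊ + 1)) (εf := 0) (εg := Q * ‖ξ‖ ^ 2) (δ := 0)
      (a := 0) (b := 1) (fun t => ?_) (fun t ht => (hw (x + ξ) t ht).continuousWithinAt)
      (fun t ht => (hw (x + ξ) t (hmem t ht)).mono_of_mem_nhdsWithin (hnb t ht))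
      (fun t ht => by rw [dist_self])
      (fun t ht => (hv ξ t ht).continuousWithinAt)
      (fun t ht => (hv ξ t (hmem t ht)).mono_of_mem_nhdsWithin (hnb t ht))
      (fun t ht => happrox ξ hξ t (hmem t ht))
      (by simp [v, hw0]) 1 (right_mem_Icc.2 zero_le_one)
    · rw [zero_add, sub_zero, gronwallBound_zero_left, dist_eq_norm] at h
      have e : w (x + ξ) 1 - v ξ 1 = w (x + ξ) 1 - w x 1 - a (x, w x 1) ξ := by
        simp only [v, P, one_smul, one_mul]; ring
      rw [e] at h
      refine h.trans (le_of_eq (by ring))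
    · refine LipschitzWith.of_dist_le_mul fun z z' => ?_
      rw [dist_eq_norm, ← sub_apply]
      refine ((a _ - a _).le_opNorm _).trans ?_
      have h1 := hL.dist_le_mul (t • (x + ξ), z) (t • (x + ξ), z')
      rw [dist_eq_norm, Prod.dist_eq, dist_self, max_eq_right dist_nonneg] at h1
      push_cast
      have h2 : ‖x + ξ‖ ≤ ‖x‖ + 1 := (norm_add_le _ _).trans (by linarith)
      calc _ ≤ (L * dist z z') * (‖x‖ + 1) := by gcongr
        _ = _ := by ring
  rw [hasFDerivAt_iff_isLittleO_nhds_zero]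
  refine Asymptotics.IsBigO.trans_isLittleO ?_ (Asymptotics.isLittleO_norm_pow_id one_lt_two)
  refine Asymptotics.IsBigO.of_bound (gronwallBound 0 (L * (‖x‖₊ + 1) : NNReal) 1 1 * Q) ?_
  filter_upwards [Metric.closedBall_mem_nhds (0 : E) one_pos] with ξ hξ
  rw [norm_pow, norm_norm]
  exact hmain ξ (by simpa using hξ)

/-- A solution of `dz = a(x, z)` with smooth `a` is smooth. -/
lemma contDiffOn_of_hasFDerivAt {a : E × ℝ → E →L[ℝ] ℝ} (ha : ContDiff ℝ ∞ a) {z : E → ℝ}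
    {U : Set E} (hU : IsOpen U) (hz : ∀ x ∈ U, HasFDerivAt z (a (x, z x)) x) :
    ContDiffOn ℝ ∞ z U := by
  rw [contDiffOn_infty]
  intro n
  induction n with
  | zero =>
    exact contDiffOn_zero.2 fun x hx => (hz x hx).continuousAt.continuousWithinAt
  | succ n ih =>
    -- Bootstrapping: if `z` is of class `C^n`, so is its derivative `a(x, z(x))`.
    push_cast
    rw [contDiffOn_succ_iff_fderiv_of_isOpen hU]
    refine ⟨fun x hx => (hz x hx).differentiableAt.differentiableWithinAt, by simp, ?_⟩
    refine ((ha.of_le (by exact_mod_cast le_top)).comp_contDiffOn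
      (contDiffOn_id.prodMk ih)).congr fun x hx => (hz x hx).fderiv

/-- A bump function cuts `a` off to a compactly supported form, which supplies the global bounds.
Integrability survives where the bump equals `1`, and the graph of `z` stays there near the origin
because `z 0 = 0`. -/
lemma exists_contDiffOn_of_integrable [FiniteDimensional ℝ E] {a : E × ℝ → E →L[ℝ] ℝ}
    (ha : ∀ᶠ P in 𝓝 (0 : E × ℝ), ContDiffAt ℝ ∞ a P)
    (hint : ∀ᶠ P in 𝓝 (0 : E × ℝ), ∀ ξ η : E, fderiv ℝ a P (ξ, a P ξ) η = fderiv ℝ a P (η,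
        a P η) ξ) :
    ∃ (z : E → ℝ) (U : Set E), IsOpen U ∧ 0 ∈ U ∧ z 0 = 0 ∧ ContDiffOn ℝ ∞ z U ∧
      ∀ x ∈ U, HasFDerivAt z (a (x, z x)) x := by
  obtain ⟨δ, hδ, hball⟩ := Metric.nhds_basis_closedBall.eventually_iff.1 ha
  let χ : ContDiffBump (0 : E × ℝ) := ⟨δ / 2, δ, by positivity, by linarith⟩
  let b : E × ℝ → E →L[ℝ] ℝ := fun P => χ P • a P
  have hb : ContDiff ℝ ∞ b := by
    rw [contDiff_iff_contDiffAt]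
    intro P
    by_cases hP : P ∈ Metric.closedBall (0 : E × ℝ) δ
    · exact χ.contDiffAt.smul (hball hP)
    · have hopen : IsOpen (Metric.closedBall (0 : E × ℝ) δ)ᶜ :=
        Metric.isClosed_closedBall.isOpen_compl
      refine (contDiffAt_const (c := (0 : E →L[ℝ] ℝ))).congr_of_eventuallyEq ?_
      filter_upwards [hopen.mem_nhds hP] with Q hQ
      have : χ Q = 0 := by
        by_contra h
        have h' : Q ∈ Function.support χ := h
        rw [χ.support_eq] at h'
        exact hQ (Metric.ball_subset_closedBall h')
      simp only [b, this, zero_smul]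
  have hbs : HasCompactSupport b := χ.hasCompactSupport.smul_right
  obtain ⟨C, hC⟩ := hbs.exists_bound_of_continuous hb.continuous
  obtain ⟨L, hL⟩ := hb.lipschitzWith_of_hasCompactSupport hbs (by simp)
  obtain ⟨K, hK⟩ := (hb.fderiv_right (m := ∞) (by simp)).lipschitzWith_of_hasCompactSupport
    (hbs.fderiv ℝ) (by simp)
  have heq : ∀ P ∈ Metric.ball (0 : E × ℝ) (δ / 2), b P = a P := fun P hP => by
    simp only [b]
    rw [χ.one_of_mem_closedBall (Metric.ball_subset_closedBall hP), one_smul]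
  have hnhds : Metric.ball (0 : E × ℝ) (δ / 2) ∈ 𝓝 (0 : E × ℝ) :=
    Metric.ball_mem_nhds _ (by positivity)
  obtain ⟨z, hz0, hz⟩ := exists_hasFDerivAt_of_integrable hC (hb.differentiable (by simp)) hL hK (by
    filter_upwards [hint, hnhds] with P hP hPb ξ η
    have : b =ᶠ[𝓝 P] a := by
      filter_upwards [Metric.isOpen_ball.mem_nhds hPb] with Q hQ using heq Q hQ
    rw [this.fderiv_eq, this.eq_of_nhds]
    exact hP ξ η)
  have hcont : ∀ᶠ x in 𝓝 (0 : E), (x, z x) ∈ Metric.ball (0 : E × ℝ) (δ / 2) := by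
    have h : ContinuousAt (fun x => (x, z x)) (0 : E) :=
      continuousAt_id.prodMk hz.self_of_nhds.continuousAt
    refine h.eventually_mem ?_
    rw [hz0]
    exact hnhds
  obtain ⟨U, hU, hUo, h0⟩ := eventually_nhds_iff.1 (hz.and hcont)
  refine ⟨z, U, hUo, h0, hz0, contDiffOn_of_hasFDerivAt hb hUo fun x hx => (hU x hx).1, ?_⟩
  intro x hx
  rw [← heq _ (hU x hx).2]
  exact (hU x hx).1

/-- The kernel of a form whose differential vanishes on it is integrable. -/
lemma exists_integral_graph {E₁ : Type*} [NormedAddCommGroup E₁] [NormedSpace ℝ E₁]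
    [FiniteDimensional ℝ E₁] [FiniteDimensional ℝ E]
    (hdim : Module.finrank ℝ E₁ = Module.finrank ℝ E + 1) {Θ : E₁ → E₁ →L[ℝ] ℝ} {y₀ : E₁}
    (hΘ : ∀ᶠ y in 𝓝 y₀, ContDiffAt ℝ ∞ Θ y) (h0 : Θ y₀ ≠ 0)
    (hint : ∀ᶠ y in 𝓝 y₀, ∀ u v, Θ y u = 0 → Θ y v = 0 → fderiv ℝ Θ y u v = fderiv ℝ Θ y v u) :
    ∃ (ψ : E → E₁) (U : Set E), IsOpen U ∧ 0 ∈ U ∧ ψ 0 = y₀ ∧ ContDiffOn ℝ ∞ ψ U ∧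
      ∀ x ∈ U, range (fderiv ℝ ψ x) = {v | Θ (ψ x) v = 0} := by
  obtain ⟨n, hn⟩ : ∃ n, Θ y₀ n ≠ 0 := by
    by_contra! h
    exact h0 (ContinuousLinearMap.ext h)
  have hker : ∀ y, Θ y ≠ 0 → Module.finrank ℝ (Θ y).toLinearMap.ker = Module.finrank ℝ E := by
    intro y hy
    have h := Module.Dual.finrank_ker_add_one_of_ne_zero (f := (Θ y).toLinearMap) (by
      intro h; exact hy (ContinuousLinearMap.coe_inj.1 h))
    omega
  -- The integral manifold is sought as a graph over `ker Θ y₀`, with height measured along the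
  -- transversal vector `n`.
  let e : E ≃ₗ[ℝ] (Θ y₀).toLinearMap.ker := LinearEquiv.ofFinrankEq _ _ (hker y₀ h0).symm
  let β : E →L[ℝ] E₁ :=
    LinearMap.toContinuousLinearMap ((Θ y₀).toLinearMap.ker.subtype ∘ₗ e.toLinearMap)
  have hβ : ∀ ξ, Θ y₀ (β ξ) = 0 := fun ξ => (e ξ).2
  have hβi : Function.Injective β := Subtype.val_injective.comp e.injective
  let B : E × ℝ →L[ℝ] E₁ := β.coprod (ContinuousLinearMap.toSpanSingleton ℝ n)
  have hB : ∀ ξ c, B (ξ, c) = β ξ + c • n := fun ξ c => by simp [B]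
  let Φ : E × ℝ → E₁ := fun P => y₀ + B P
  have hΦ0 : Φ 0 = y₀ := by simp [Φ]
  have hΦ : ContDiff ℝ ∞ Φ := contDiff_const.add B.contDiff
  have hΦd : ∀ P, HasFDerivAt Φ B P := fun P => B.hasFDerivAt.const_add y₀
  have hΦt : Filter.Tendsto Φ (𝓝 0) (𝓝 y₀) := by
    have := hΦ.continuous.tendsto 0
    rwa [hΦ0] at this
  have hne : ∀ᶠ y in 𝓝 y₀, Θ y n ≠ 0 :=
    ((hΘ.self_of_nhds.continuousAt.clm_apply continuousAt_const).eventually_ne hn)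
  -- The slope is forced by tangency: `Θ(β ξ + a(ξ) n) = 0` is solved for `a(ξ)`.
  let a : E × ℝ → E →L[ℝ] ℝ := fun P => (-(Θ (Φ P) n)⁻¹) • (Θ (Φ P)).comp β
  have ha : ∀ᶠ P in 𝓝 (0 : E × ℝ), ContDiffAt ℝ ∞ a P := by
    filter_upwards [hΦt.eventually hΘ, hΦt.eventually hne] with P hP hPn
    have h1 : ContDiffAt ℝ ∞ (fun P => Θ (Φ P)) P := hP.comp P hΦ.contDiffAt
    exact ((h1.clm_apply contDiffAt_const).inv hPn).neg.smul (h1.clm_comp contDiffAt_const)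
  have hrel : ∀ P, Θ (Φ P) n ≠ 0 → ∀ ξ, Θ (Φ P) (B (ξ, a P ξ)) = 0 := by
    intro P hP ξ
    rw [hB, map_add, map_smul]
    simp only [a, smul_apply, ContinuousLinearMap.comp_apply, smul_eq_mul]
    field_simp
    ring
  have hinta : ∀ᶠ P in 𝓝 (0 : E × ℝ), ∀ ξ η : E,
      fderiv ℝ a P (ξ, a P ξ) η = fderiv ℝ a P (η, a P η) ξ := by
    filter_upwards [(hΦt.eventually hΘ), hΦt.eventually hint, hΦt.eventually hne,
      (hΦt.eventually hne).eventually_nhds, ha] with P hP hPi hPn hPe haP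
    -- Differentiate the tangency relation `hrel` in the direction `h`. For `h = (ξ, a ξ)` the
    -- vector `B h` lies in the kernel of `Θ`, so the symmetry hypothesis on the kernel becomes the
    -- integrability condition for `a`.
    have hd : ∀ (h : E × ℝ) (ξ : E), fderiv ℝ (Θ) (Φ P) (B h) (B (ξ, a P ξ))
        + fderiv ℝ a P h ξ * Θ (Φ P) n = 0 := by
      intro h ξ
      have h1 : HasFDerivAt (fun P => Θ (Φ P)) ((fderiv ℝ Θ (Φ P)).comp B) P :=
        (hP.differentiableAt (by simp)).hasFDerivAt.comp P (hΦd P)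
      have h2 : HasFDerivAt a (fderiv ℝ a P) P := (haP.differentiableAt (by simp)).hasFDerivAt
      have h3 : HasFDerivAt (fun P => β ξ + a P ξ • n)
          ((ContinuousLinearMap.toSpanSingleton ℝ n).comp ((fderiv ℝ a P).flip ξ)) P := by
        have h4 : HasFDerivAt (fun P => a P ξ) ((fderiv ℝ a P).flip ξ) P := by
          refine (h2.clm_apply (hasFDerivAt_const ξ P)).congr_fderiv ?_
          ext <;> simp
        exact (((ContinuousLinearMap.toSpanSingleton ℝ n).hasFDerivAt.comp P h4).const_add (β ξ))
      have h5 := h1.clm_apply h3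
      have h6 : (fun P => Θ (Φ P) (β ξ + a P ξ • n)) =ᶠ[𝓝 P] fun _ => 0 := by
        filter_upwards [hPe] with Q hQ
        rw [← hB]; exact hrel Q hQ ξ
      have h7 := h5.unique ((hasFDerivAt_const (0 : ℝ) P).congr_of_eventuallyEq h6)
      have h8 := congrArg (fun L => L h) h7
      simp at h8
      have h9 : fderiv ℝ Θ (Φ P) (B h) (B (ξ, a P ξ))
          = fderiv ℝ Θ (Φ P) (B h) (β ξ) + a P ξ * fderiv ℝ Θ (Φ P) (B h) n := by
        rw [hB ξ (a P ξ), map_add, map_smul, smul_eq_mul]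
      linarith
    intro ξ η
    have e1 := hd (ξ, a P ξ) η
    have e2 := hd (η, a P η) ξ
    rw [hPi _ _ (hrel P hPn ξ) (hrel P hPn η)] at e1
    exact mul_right_cancel₀ hPn (by linarith)
  obtain ⟨z, U, hU, hU0, hz0, hzs, hz⟩ := exists_contDiffOn_of_integrable ha hinta
  have hzc : ContinuousAt (fun x => Φ (x, z x)) 0 :=
    hΦ.continuous.continuousAt.comp (continuousAt_id.prodMk (hz 0 hU0).continuousAt)
  have hψ0 : Φ (0, z 0) = y₀ := by rw [hz0]; exact hΦ0
  have hev : ∀ᶠ x in 𝓝 (0 : E), Θ (Φ (x, z x)) n ≠ 0 :=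
    hzc.eventually (p := fun y => Θ y n ≠ 0) (by
      show ∀ᶠ y in 𝓝 (Φ (0, z 0)), _
      rw [hψ0]
      exact hne)
  obtain ⟨U', hU', hUo', h0'⟩ := eventually_nhds_iff.1 hev
  refine ⟨fun x => Φ (x, z x), U ∩ U', hU.inter hUo', ⟨hU0, h0'⟩, hψ0,
    hΦ.comp_contDiffOn (contDiffOn_id.prodMk (hzs.mono inter_subset_left)), ?_⟩
  intro x hx
  set D : E →L[ℝ] E₁ := B.comp ((ContinuousLinearMap.id ℝ E).prod (a (x, z x))) with hD
  have hfd : fderiv ℝ (fun x => Φ (x, z x)) x = D :=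
    (HasFDerivAt.comp (g := Φ) (f := fun x => (x, z x)) x (hΦd (x, z x))
      ((hasFDerivAt_id x).prodMk (hz x hx.1))).fderiv
  have hDk : ∀ ξ, Θ (Φ (x, z x)) (D ξ) = 0 := fun ξ => hrel (x, z x) (hU' x hx.2) ξ
  have hDi : Function.Injective D := by
    refine (injective_iff_map_eq_zero D).2 fun ξ hξ => ?_
    have h1 : β ξ + a (x, z x) ξ • n = 0 := (hB _ _).symm.trans hξ
    have h2 := congrArg (Θ y₀) h1
    rw [map_add, hβ, map_smul, zero_add, map_zero, smul_eq_mul] at h2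
    rw [(mul_eq_zero.1 h2).resolve_right hn, zero_smul, add_zero] at h1
    exact hβi (h1.trans (map_zero β).symm)
  have hle : D.toLinearMap.range ≤ (Θ (Φ (x, z x))).toLinearMap.ker := by
    rintro _ ⟨ξ, rfl⟩
    exact hDk ξ
  have hfin := Submodule.eq_of_le_of_finrank_eq hle (by
    rw [LinearMap.finrank_range_of_inj hDi, hker]
    intro h
    exact hU' x hx.2 (by rw [h]; rfl))
  rw [hfd]
  ext v
  have := congrArg (fun S => v ∈ S) hfin
  simpa using this

end Frobenius

/-! ### Forms that vanish on a parametrised submanifold. -/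

section FlatIntegral

variable {E E₁ : Type*} [NormedAddCommGroup E] [NormedSpace ℝ E]
  [NormedAddCommGroup E₁] [NormedSpace ℝ E₁]

/-- Differentiate `Θ(dκ η) = 0` along `ξ`; the second derivative of `κ` is symmetric. This is `κ^*
dΘ = d(κ^* Θ) = 0`. -/
lemma fderiv_form_comm {Θ : E₁ → E₁ →L[ℝ] ℝ} {κ : E → E₁} {x : E}
    (hΘ : DifferentiableAt ℝ Θ (κ x)) (hκ : ContDiffAt ℝ ∞ κ x)
    (h : ∀ᶠ z in 𝓝 x, ∀ ξ, Θ (κ z) (fderiv ℝ κ z ξ) = 0) (ξ η : E) :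
    fderiv ℝ Θ (κ x) (fderiv ℝ κ x ξ) (fderiv ℝ κ x η)
      = fderiv ℝ Θ (κ x) (fderiv ℝ κ x η) (fderiv ℝ κ x ξ) := by
  have hκ1 : HasFDerivAt κ (fderiv ℝ κ x) x := (hκ.differentiableAt (by simp)).hasFDerivAt
  have hκ2 : HasFDerivAt (fderiv ℝ κ) (fderiv ℝ (fderiv ℝ κ) x) x :=
    ((hκ.fderiv_right (m := ∞) (by simp)).differentiableAt (by simp)).hasFDerivAt
  have key : ∀ ξ η, fderiv ℝ Θ (κ x) (fderiv ℝ κ x ξ) (fderiv ℝ κ x η)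
      + Θ (κ x) (fderiv ℝ (fderiv ℝ κ) x ξ η) = 0 := by
    intro ξ η
    have h1 := (hΘ.hasFDerivAt.comp x hκ1).clm_apply (hκ2.clm_apply (hasFDerivAt_const η x))
    have h2 : (fun z => (Θ ∘ κ) z (fderiv ℝ κ z η)) =ᶠ[𝓝 x] fun _ => 0 := by
      filter_upwards [h] with z hz using hz η
    have h3 := h1.unique ((hasFDerivAt_const (0 : ℝ) x).congr_of_eventuallyEq h2)
    have h4 := congrArg (fun L => L ξ) h3
    simp at h4
    linarith
  have hsymm : fderiv ℝ (fderiv ℝ κ) x ξ η = fderiv ℝ (fderiv ℝ κ) x η ξ :=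
    (hκ.isSymmSndFDerivAt (by
      rw [minSmoothness_of_isRCLikeNormedField]; exact WithTop.coe_le_coe.2 le_top)) ξ η
  have h1 := key ξ η
  have h2 := key η ξ
  rw [hsymm] at h1
  linarith

lemma symm_on_span {ι : Type*} {T : E →L[ℝ] E →L[ℝ] ℝ} {x : ι → E}
    (h : ∀ a b, T (x a) (x b) = T (x b) (x a)) {u v : E}
    (hu : u ∈ Submodule.span ℝ (Set.range x)) (hv : v ∈ Submodule.span ℝ (Set.range x)) :
    T u v = T v u := by
  induction hu using Submodule.span_induction with
  | mem y hy =>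
    obtain ⟨a, rfl⟩ := hy
    induction hv using Submodule.span_induction with
    | mem z hz =>
      obtain ⟨b, rfl⟩ := hz
      exact h a b
    | zero => simp
    | add z z' _ _ hz hz' => simp only [map_add, add_apply, hz, hz']
    | smul c z _ hz => simp only [map_smul, smul_apply, hz]
  | zero => simp
  | add y y' _ _ hy hy' => simp only [map_add, add_apply, hy, hy']
  | smul c y _ hy => simp only [map_smul, smul_apply, hy]

end FlatIntegral

/-! ### Integrability of `ker θ` as vanishing of `dθ` on `ker θ`. -/

section Integrability

variable {m : ℕ}
  {M : Type*} [TopologicalSpace M] [ChartedSpace (EuclideanSpace ℝ (Fin (m + 2))) M]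
  [IsManifold (𝓡 (m + 2)) ∞ M]
  {V : Type*} [TopologicalSpace V] [ChartedSpace (EuclideanSpace ℝ (Fin (m + 1))) V]
  [IsManifold (𝓡 (m + 1)) ∞ V]
  {g : LorentzMetric (m + 2) M} {f : V → M}
  {N : (q : V) → TangentSpace (𝓡 (m + 1)) q}
  {θ : (q : V) → TangentSpace (𝓡 (m + 1)) q →L[ℝ] ℝ}

/-- The distribution annihilated by the form `θ`. -/
def kernelDistribution (θ : (q : V) → TangentSpace (𝓡 (m + 1)) q →L[ℝ] ℝ) (q : V) :
    Submodule ℝ (TangentSpace (𝓡 (m + 1)) q) := (θ q).toLinearMap.ker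

lemma mem_kernelDistribution {q : V} {v : TangentSpace (𝓡 (m + 1)) q} :
    v ∈ kernelDistribution θ q ↔ θ q v = 0 := Iff.rfl

/-- The differential of `θ` vanishes on its kernel. -/
def IsClosedOnKernel (θ : (q : V) → TangentSpace (𝓡 (m + 1)) q →L[ℝ] ℝ) : Prop :=
  ∀ (p : V), ∀ y ∈ (extChartAt (𝓡 (m + 1)) p).target, ∀ u v : EuclideanSpace ℝ (Fin (m + 1)),
    thetaCoord θ p y u = 0 → thetaCoord θ p y v = 0 →
      fderiv ℝ (thetaCoord θ p) y u v = fderiv ℝ (thetaCoord θ p) y v u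

lemma thetaCoord_chart (θ : (q : V) → TangentSpace (𝓡 (m + 1)) q →L[ℝ] ℝ) {p q : V}
    (hq : q ∈ (extChartAt (𝓡 (m + 1)) p).source) (w : TangentSpace (𝓡 (m + 1)) q) :
    thetaCoord θ p (extChartAt (𝓡 (m + 1)) p q) (chartDeriv p q w) = θ q w := by
  obtain ⟨z, hz, rfl, hzq⟩ := exists_chart_symm_eq hq
  rw [hzq]
  exact thetaCoord_chartDeriv θ hz w

namespace IsCanonicalField

lemma thetaCoord_ne_zero (hθ : ∀ q, θ q (N q) ≠ 0)
    {p : V} {y : EuclideanSpace ℝ (Fin (m + 1))} (hy : y ∈ (extChartAt (𝓡 (m + 1)) p).target) :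
    thetaCoord θ p y ≠ 0 := by
  intro h
  refine hθ ((extChartAt (𝓡 (m + 1)) p).symm y) ?_
  rw [← thetaCoord_chartDeriv θ hy, h]
  rfl

lemma isIntegrable_of_isClosedOnKernel (hc : IsCanonicalField g f N θ)
    (hf : IsLightlikeHypersurface g f) (hθ : ∀ q, θ q (N q) ≠ 0) (h : IsClosedOnKernel θ) :
    IsIntegrable (kernelDistribution θ) := by
  intro p
  set φ := extChartAt (𝓡 (m + 1)) p with hφ
  have hp : p ∈ φ.source := mem_extChartAt_source p
  have hy : φ p ∈ φ.target := φ.map_source hp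
  have hev := eventually_mem_target (m := m) hy
  obtain ⟨ψ, U, hU, h0, hψ0, hψ, hr⟩ := exists_integral_graph (E := EuclideanSpace ℝ (Fin m))
    (Θ := thetaCoord θ p) (by simp) (hev.mono fun y hy => hc.contDiffAt_thetaCoord hf hy)
    (thetaCoord_ne_zero hθ hy) (hev.mono fun y hy => h p y hy)
  refine ⟨U ∩ ψ ⁻¹' φ.target, φ.symm ∘ ψ,
    hψ.continuousOn.isOpen_inter_preimage hU (isOpen_extChartAt_target p),
    ⟨h0, by rw [Set.mem_preimage, hψ0]; exact hy⟩, ?_, ?_, ?_⟩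
  · rw [Function.comp_apply, hψ0]
    exact φ.left_inv hp
  · intro x hx
    exact ((contMDiffAt_chart_symm hx.2).comp x
      (hψ.contDiffAt (hU.mem_nhds hx.1)).contMDiffAt).contMDiffWithinAt
  · intro x hx
    have hψx : DifferentiableAt ℝ ψ x :=
      (hψ.contDiffAt (hU.mem_nhds hx.1)).differentiableAt (by simp)
    have hd : ∀ ξ, mfderiv (𝓡 m) (𝓡 (m + 1)) (φ.symm ∘ ψ) x ξ
        = chartSymmDeriv p (ψ x) (fderiv ℝ ψ x ξ) := by
      intro ξ
      refine (mfderiv_comp_apply x ((contMDiffAt_chart_symm hx.2).mdifferentiableAt (by simp))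
        hψx.mdifferentiableAt ξ).trans ?_
      rw [mfderiv_eq_fderiv]
      rfl
    ext v
    constructor
    · rintro ⟨ξ, rfl⟩
      have h1 : fderiv ℝ ψ x ξ ∈ {v | thetaCoord θ p (ψ x) v = 0} := by
        rw [← hr x hx.1]; exact ⟨ξ, rfl⟩
      rw [hd]
      exact h1
    · intro hv
      have h1 : chartDeriv p (φ.symm (ψ x)) v ∈ {v | thetaCoord θ p (ψ x) v = 0} := by
        rw [Set.mem_ofPred_eq, thetaCoord_chartDeriv θ hx.2]
        exact hv
      rw [← hr x hx.1] at h1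
      obtain ⟨ξ, hξ⟩ := h1
      exact ⟨ξ, (hd ξ).trans ((congrArg (chartSymmDeriv p (ψ x)) hξ).trans
        (chartSymmDeriv_chartDeriv_symm hx.2 v))⟩

/-- In the chart the integral manifold through the point is a map `κ` with `κ^* θ = 0` whose
differential reaches every kernel vector there, so `fderiv_form_comm` applies to arbitrary kernel
vectors. -/
lemma isClosedOnKernel_of_isIntegrable (hc : IsCanonicalField g f N θ)
    (hf : IsLightlikeHypersurface g f) (h : IsIntegrable (kernelDistribution θ)) :
    IsClosedOnKernel θ := by
  intro p y hy u v hu hv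
  set φ := extChartAt (𝓡 (m + 1)) p with hφ
  obtain ⟨U, ψ, hU, h0, hψ0, hψ, hr⟩ := h (φ.symm y)
  have hψs : ∀ x ∈ U, ContMDiffAt (𝓡 m) (𝓡 (m + 1)) ∞ ψ x := fun x hx =>
    hψ.contMDiffAt (hU.mem_nhds hx)
  have hsrc : ψ 0 ∈ φ.source := by rw [hψ0]; exact φ.map_target hy
  have hκ0 : φ (ψ 0) = y := by rw [hψ0]; exact φ.right_inv hy
  have hκs : ContDiffAt ℝ ∞ (fun x => φ (ψ x)) 0 := contDiffAt_chart_comp (hψs 0 h0) hsrc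
  have hκd : ∀ x ∈ U, ψ x ∈ φ.source → ∀ ξ, fderiv ℝ (fun x => φ (ψ x)) x ξ
      = chartDeriv p (ψ x) (mfderiv (𝓡 m) (𝓡 (m + 1)) ψ x ξ) := fun x hx hs ξ =>
    (chartDeriv_mapDir ((hψs x hx).mdifferentiableAt (by simp)) hs ξ).symm
  have hmem : ∀ x ∈ U, ∀ w, w ∈ Set.range (mfderiv (𝓡 m) (𝓡 (m + 1)) ψ x) ↔ θ (ψ x) w = 0 :=
    fun x hx w => by rw [hr x hx]; rfl
  have hev : ∀ᶠ x in 𝓝 (0 : EuclideanSpace ℝ (Fin m)), x ∈ U ∧ ψ x ∈ φ.source :=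
    Filter.Eventually.and (hU.mem_nhds h0) ((hψs 0 h0).continuousAt.eventually_mem
      ((isOpen_extChartAt_source p).mem_nhds hsrc))
  have hker : ∀ᶠ x in 𝓝 (0 : EuclideanSpace ℝ (Fin m)), ∀ ξ,
      thetaCoord θ p (φ (ψ x)) (fderiv ℝ (fun x => φ (ψ x)) x ξ) = 0 := by
    filter_upwards [hev] with x hx ξ
    rw [hκd x hx.1 hx.2]
    exact (thetaCoord_chart θ hx.2 _).trans ((hmem x hx.1 _).1 ⟨ξ, rfl⟩)
  have hsurj : ∀ u, thetaCoord θ p y u = 0 → ∃ ξ, fderiv ℝ (fun x => φ (ψ x)) 0 ξ = u := by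
    intro u hu
    obtain ⟨e, he⟩ := chartDeriv_isInvertible (n := m + 1) hsrc
    obtain ⟨w, hw⟩ := e.surjective u
    have hwu : chartDeriv p (ψ 0) w = u := by rw [← he]; exact hw
    have hw0 : θ (ψ 0) w = 0 := by
      rw [← thetaCoord_chart θ hsrc, hwu]
      exact (congrArg (fun z => thetaCoord θ p z u) hκ0).trans hu
    obtain ⟨ξ, hξ⟩ := (hmem 0 h0 w).2 hw0
    exact ⟨ξ, (hκd 0 h0 hsrc ξ).trans ((congrArg (chartDeriv p (ψ 0)) hξ).trans hwu)⟩
  obtain ⟨ξ, rfl⟩ := hsurj u hu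
  obtain ⟨η, rfl⟩ := hsurj v hv
  have hΘd : DifferentiableAt ℝ (thetaCoord θ p) (φ (ψ 0)) := by
    rw [hκ0]
    exact (hc.contDiffAt_thetaCoord hf hy).differentiableAt (by simp)
  have := fderiv_form_comm (κ := fun x => φ (ψ x)) hΘd hκs hker ξ η
  simp only [hκ0] at this
  exact this

end IsCanonicalField

end Integrability

/-! ### Isotropic frames: reduction and the curvature components. -/

section Frames

variable {m : ℕ}
  {M : Type*} [TopologicalSpace M] [ChartedSpace (EuclideanSpace ℝ (Fin (m + 2))) M]
  [IsManifold (𝓡 (m + 2)) ∞ M]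
  {V : Type*} [TopologicalSpace V] [ChartedSpace (EuclideanSpace ℝ (Fin (m + 1))) V]
  [IsManifold (𝓡 (m + 1)) ∞ V]
  {g : LorentzMetric (m + 2) M} {f : V → M}
  {N : (q : V) → TangentSpace (𝓡 (m + 1)) q}
  {θ : (q : V) → TangentSpace (𝓡 (m + 1)) q →L[ℝ] ℝ}
  {O : Set V} {e₁ : (q : V) → TangentSpace (𝓡 (m + 1)) q}
  {e : Fin m → (q : V) → TangentSpace (𝓡 (m + 1)) q}
  {eₙ : (q : V) → TangentSpace (𝓡 (m + 2)) (f q)}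

lemma omega₁_add (q : V) (u v : TangentSpace (𝓡 (m + 1)) q) :
    omega₁ g f eₙ q (u + v) = omega₁ g f eₙ q u + omega₁ g f eₙ q v := by
  simp only [omega₁, component₁, map_add, add_apply]
  ring

lemma omega₁_smul (q : V) (a : ℝ) (v : TangentSpace (𝓡 (m + 1)) q) :
    omega₁ g f eₙ q (a • v) = a * omega₁ g f eₙ q v := by
  simp only [omega₁, component₁, map_smul, smul_apply, smul_eq_mul]
  ring

namespace IsIsotropicFrameOn

lemma omega₁_null (h : IsIsotropicFrameOn g f O e₁ e eₙ) {q : V} (hq : q ∈ O) :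
    omega₁ g f eₙ q (e₁ q) = 1 := by
  rw [omega₁, component₁, h.normalized q hq, neg_neg]

lemma omega₁_screen (h : IsIsotropicFrameOn g f O e₁ e eₙ) {q : V} (hq : q ∈ O) (a : Fin m) :
    omega₁ g f eₙ q (e a q) = 0 := by
  rw [omega₁, component₁, h.conjugate q hq, neg_zero]

lemma omega₁_span (h : IsIsotropicFrameOn g f O e₁ e eₙ) {q : V} (hq : q ∈ O)
    {w : TangentSpace (𝓡 (m + 1)) q} (hw : w ∈ Submodule.span ℝ (Set.range fun a => e a q)) :
    omega₁ g f eₙ q w = 0 := by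
  induction hw using Submodule.span_induction with
  | mem x hx =>
    obtain ⟨a, rfl⟩ := hx
    exact h.omega₁_screen hq a
  | zero => simp [omega₁, component₁]
  | add x y _ _ hx hy => rw [omega₁_add, hx, hy, add_zero]
  | smul a x _ hx => rw [omega₁_smul, hx, mul_zero]

lemma exists_decomposition (h : IsIsotropicFrameOn g f O e₁ e eₙ) {q : V} (hq : q ∈ O)
    (v : TangentSpace (𝓡 (m + 1)) q) :
    ∃ w ∈ Submodule.span ℝ (Set.range fun a => e a q), v = omega₁ g f eₙ q v • e₁ q + w := by
  have htop := (h.independent q hq).span_eq_top_of_card_eq_finrank'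
    (by rw [Fintype.card_fin, finrank_tangentSpace_euclidean])
  have hv : v ∈ Submodule.span ℝ (Set.range (Fin.cons (e₁ q) (fun a => e a q) :
      Fin (m + 1) → TangentSpace (𝓡 (m + 1)) q)) := by rw [htop]; trivial
  rw [Fin.range_cons, Submodule.mem_span_insert] at hv
  obtain ⟨c, w, hw, rfl⟩ := hv
  refine ⟨w, hw, ?_⟩
  rw [omega₁_add, omega₁_smul, h.omega₁_null hq, h.omega₁_span hq hw, mul_one, add_zero]

lemma mem_span_iff (h : IsIsotropicFrameOn g f O e₁ e eₙ) {q : V} (hq : q ∈ O)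
    (v : TangentSpace (𝓡 (m + 1)) q) :
    v ∈ Submodule.span ℝ (Set.range fun a => e a q) ↔ omega₁ g f eₙ q v = 0 := by
  refine ⟨h.omega₁_span hq, fun hv => ?_⟩
  obtain ⟨w, hw, he⟩ := h.exists_decomposition hq v
  rw [hv, zero_smul, zero_add] at he
  rwa [he]

end IsIsotropicFrameOn

/-- A local frame spanning `S'` is reduced because `S'` is intrinsic; being reduced, it also
describes `S`. Total umbilicity supplies the factor needed to speak of reduction. -/
lemma isIntrinsicScreen_unique (humb : IsTotallyUmbilical g f)
    {S S' : (q : V) → Submodule ℝ (TangentSpace (𝓡 (m + 1)) q)} (hS : IsIntrinsicScreen g f S)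
    (hS' : IsIntrinsicScreen g f S') : S' = S := by
  funext p
  obtain ⟨O, e₁, e, eₙ, hp, h, hspan⟩ := hS'.1 p
  choose! lam hl0 hl using humb O e₁ h.nullField
  have h' : IsGivenByOmega g f S' O eₙ := fun q hq v => by
    rw [hspan q hq]; exact h.mem_span_iff hq v
  have h2 := (hS.2 O e₁ e eₙ lam h hl).2 ((hS'.2 O e₁ e eₙ lam h hl).1 h')
  ext v
  rw [h' p hp v, h2 p hp v]

namespace IsCanonicalField

/-- From `e₁ = λ N` and `ω¹(e₁) = 1` one gets `λ ω¹(N) = 1`. The `e₁`-component of `∇(λ N) = dλ N +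
λ (v + θ N)` is `ω₁¹ = dλ / λ + λ ω¹ + θ`. -/
lemma reduced_form_eq (hc : IsCanonicalField g f N θ) (hf : IsLightlikeHypersurface g f)
    (hm : 1 ≤ m) (h : IsIsotropicFrameOn g f O e₁ e eₙ) {lam : V → ℝ}
    (hl : ∀ q ∈ O, IsUmbilicFactorAt g f e₁ q (lam q)) {q : V} (hq : q ∈ O) :
    lam q ≠ 0 ∧ ∀ v : TangentSpace (𝓡 (m + 1)) q,
      mvfderiv (𝓡 (m + 1)) lam q v - lam q * omega₁₁ g f e₁ eₙ q v
        + lam q ^ 2 * omega₁ g f eₙ q v = -(lam q * θ q v) := by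
  have he : ∀ z ∈ O, e₁ z = lam z • N z := fun z hz =>
    hc.eq_smul hf hm h.nullField hz (hl z hz)
  have ha : lam q * omega₁ g f eₙ q (N q) = 1 := by
    rw [← omega₁_smul, ← he q hq, h.omega₁_null hq]
  refine ⟨left_ne_zero_of_mul (ha.trans_ne one_ne_zero), fun v => ?_⟩
  have hn := hf.nablaTangent_smul (g := g) (hc.smoothAt q)
    (hf.contMDiffAt_umbilicFactor hm h.nullField hl hq)
    (Filter.mem_of_superset (h.nullField.isOpen.mem_nhds hq) he) v
  rw [hc.nabla] at hn
  have h1 : omega₁₁ g f e₁ eₙ q v = mvfderiv (𝓡 (m + 1)) lam q v * omega₁ g f eₙ q (N q)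
      + lam q * (omega₁ g f eₙ q v + θ q v * omega₁ g f eₙ q (N q)) := by
    simp only [omega₁₁, hn, omega₁, component₁, map_add, map_smul, add_apply, smul_apply,
      smul_eq_mul]
    ring
  rw [h1]
  linear_combination (-mvfderiv (𝓡 (m + 1)) lam q v - lam q * θ q v) * ha

lemma isGivenByOmega_iff_isReduced (hc : IsCanonicalField g f N θ)
    (hf : IsLightlikeHypersurface g f) (hm : 1 ≤ m) (hθ : ∀ q, θ q (N q) ≠ 0)
    (h : IsIsotropicFrameOn g f O e₁ e eₙ) {lam : V → ℝ}
    (hl : ∀ q ∈ O, IsUmbilicFactorAt g f e₁ q (lam q)) :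
    IsGivenByOmega g f (kernelDistribution θ) O eₙ ↔ IsReducedFrameOn g f O e₁ eₙ lam := by
  constructor
  · intro hS
    -- Evaluating `-λ θ = μ ω¹` on `e₁` forces this `μ`.
    refine ⟨fun q => -(lam q * θ q (e₁ q)), fun q hq v => ?_⟩
    rw [(hc.reduced_form_eq hf hm h hl hq).2]
    obtain ⟨w, hw, he⟩ := h.exists_decomposition hq v
    have hw0 : θ q w = 0 := (hS q hq w).2 (h.omega₁_span hq hw)
    have : θ q v = omega₁ g f eₙ q v * θ q (e₁ q) := by
      conv_lhs => rw [he, map_add, map_smul, hw0, add_zero, smul_eq_mul]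
    rw [this]; ring
  · rintro ⟨mu, hmu⟩ q hq v
    obtain ⟨hl0, hr⟩ := hc.reduced_form_eq hf hm h hl hq
    have key : ∀ v, -(lam q * θ q v) = mu q * omega₁ g f eₙ q v := fun v => by
      rw [← hr]; exact hmu q hq v
    -- This is where `θ(N) ≠ 0` enters: with `μ = 0` the form `-λ θ` would vanish on `N`.
    have hmu0 : mu q ≠ 0 := by
      intro h0
      have := key (N q)
      rw [h0, zero_mul, neg_eq_zero] at this
      exact mul_ne_zero hl0 (hθ q) this
    have hk := key v
    rw [mem_kernelDistribution]
    constructor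
    · intro hv
      rw [hv, mul_zero, neg_zero] at hk
      exact (mul_eq_zero.1 hk.symm).resolve_left hmu0
    · intro hv
      rw [hv, mul_zero, neg_eq_zero] at hk
      exact (mul_eq_zero.1 hk).resolve_left hl0

/-- The terms `θ(e_b) e_a - θ(e_a) e_b` vanish on the screen, leaving `R(e_a, e_b) N = dθ(e_a, e_b)
N`. Passing to `e₁ = r N` costs a factor that `ω¹(e₁) = 1` cancels. -/
lemma curvatureComponent_eq (hc : IsCanonicalField g f N θ)
    (hf : IsLightlikeHypersurface g f) (hm : 1 ≤ m) (humb : IsTotallyUmbilical g f)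
    (h : IsIsotropicFrameOn g f O e₁ e eₙ) (hS : IsGivenByOmega g f (kernelDistribution θ) O eₙ)
    {p : V} {y : EuclideanSpace ℝ (Fin (m + 1))} (hy : y ∈ (extChartAt (𝓡 (m + 1)) p).target)
    (hq : (extChartAt (𝓡 (m + 1)) p).symm y ∈ O) (a b : Fin m) :
    curvatureComponent g f e₁ e eₙ ((extChartAt (𝓡 (m + 1)) p).symm y) a b
      = fderiv ℝ (thetaCoord θ p) y (fieldCoord (e a) p y) (fieldCoord (e b) p y)
        - fderiv ℝ (thetaCoord θ p) y (fieldCoord (e b) p y) (fieldCoord (e a) p y) := by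
  set q := (extChartAt (𝓡 (m + 1)) p).symm y with hqd
  have hθe : ∀ a, θ q (e a q) = 0 := fun a => (hS q hq _).2 (h.omega₁_screen hq a)
  obtain ⟨r, hr0, hr⟩ := humb O e₁ h.nullField q hq
  have he := hc.eq_smul hf hm h.nullField hq hr
  have hcurv := hc.curvature_eq hf hy (e a q) (e b q)
  rw [← hqd, hθe, hθe, zero_smul, zero_smul, sub_zero, add_zero] at hcurv
  have hscale : ∀ u v w : TangentSpace (𝓡 (m + 2)) (f q),
      curvature g (f q) u v (r • w) = r • curvature g (f q) u v w := by
    intro u v w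
    simp only [curvature, map_smul, curvatureCoord_smul]
  have h1 : omega₁ g f eₙ q (r • N q) = 1 := by rw [← he]; exact h.omega₁_null hq
  rw [omega₁_smul] at h1
  unfold curvatureComponent
  rw [he, map_smul, hscale, hcurv]
  simp only [omega₁, component₁, map_smul, smul_apply, smul_eq_mul] at h1 ⊢
  unfold fieldCoord
  linear_combination (fderiv ℝ (thetaCoord θ p) y (chartDeriv p q (e a q)) (chartDeriv p q (e b q))
        - fderiv ℝ (thetaCoord θ p) y (chartDeriv p q (e b q)) (chartDeriv p q (e a q))) * h1

lemma isClosedOnKernel_iff (hc : IsCanonicalField g f N θ)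
    (hf : IsLightlikeHypersurface g f) (hm : 1 ≤ m) (humb : IsTotallyUmbilical g f)
    (hscreen : IsScreenDistribution g f (kernelDistribution θ)) :
    IsClosedOnKernel θ ↔ ∀ (O : Set V) (e₁ : (q : V) → TangentSpace (𝓡 (m + 1)) q)
          (e : Fin m → (q : V) → TangentSpace (𝓡 (m + 1)) q)
          (eₙ : (q : V) → TangentSpace (𝓡 (m + 2)) (f q)),
          IsIsotropicFrameOn g f O e₁ e eₙ → IsGivenByOmega g f (kernelDistribution θ) O eₙ →
          ∀ q ∈ O, ∀ a b : Fin m, curvatureComponent g f e₁ e eₙ q a b = 0 := by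
  constructor
  · intro hcl O e₁ e eₙ h hS q hq a b
    obtain ⟨p, y, hy, rfl⟩ := exists_chart_point (m := m) q
    rw [hc.curvatureComponent_eq hf hm humb h hS hy hq]
    have h0 : ∀ a, thetaCoord θ p y (fieldCoord (e a) p y) = 0 := fun a =>
      (thetaCoord_chartDeriv θ hy _).trans ((hS _ hq _).2 (h.omega₁_screen hq a))
    exact sub_eq_zero.2 (hcl p y hy _ _ (h0 a) (h0 b))
  · intro hR p y hy u v hu hv
    obtain ⟨O, e₁, e, eₙ, hq, h, hspan⟩ := hscreen ((extChartAt (𝓡 (m + 1)) p).symm y)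
    have hS : IsGivenByOmega g f (kernelDistribution θ) O eₙ := fun q hq v => by
      rw [hspan q hq]; exact h.mem_span_iff hq v
    have hspan' := hspan _ hq
    set q := (extChartAt (𝓡 (m + 1)) p).symm y with hqd
    have hlift : ∀ u, thetaCoord θ p y u = 0 →
        u ∈ Submodule.span ℝ (Set.range fun a => fieldCoord (e a) p y) := by
      intro u hu
      have hw : chartSymmDeriv p y u ∈ Submodule.span ℝ (Set.range fun a => e a q) := by
        rw [← hspan']
        exact hu
      have h1 := Submodule.mem_map_of_mem (f := (chartDeriv p q).toLinearMap) hw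
      rw [Submodule.map_span, ← Set.range_comp] at h1
      have h2 : (chartDeriv p q).toLinearMap (chartSymmDeriv p y u) = u :=
        chartDeriv_chartSymmDeriv hy u
      rw [h2] at h1
      exact h1
    exact symm_on_span (fun a b => sub_eq_zero.1 ((hc.curvatureComponent_eq hf hm humb h hS hy hq
      a b).symm.trans (hR O e₁ e eₙ h hS q hq a b))) (hlift u hu) (hlift v hv)

end IsCanonicalField

end Frames

/-! ### Developments preserve scalar products. -/

section Development

variable {n : ℕ} {M : Type*} [TopologicalSpace M]
  [ChartedSpace (EuclideanSpace ℝ (Fin n)) M] [IsManifold (𝓡 n) ∞ M] {g : LorentzMetric n M}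
  {c : ℝ → M} {t₁ t₂ : ℝ} {b : Fin n → (t : ℝ) → TangentSpace (𝓡 n) (c t)}

/-- By metric compatibility the derivative is a sum of products with `∇b = 0`. -/
lemma IsParallelFrameOn.metric_const (h : IsParallelFrameOn g c (Set.Ioo t₁ t₂) b) (i j : Fin n)
    {s t : ℝ} (hs : s ∈ Set.Ioo t₁ t₂) (ht : t ∈ Set.Ioo t₁ t₂) :
    g.val (c s) (b i s) (b j s) = g.val (c t) (b i t) (b j t) := by
  have hsm : ∀ i, ∀ r ∈ Set.Ioo t₁ t₂, SmoothFieldAt (F := ℝ) c (b i) r := fun i r hr =>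
    (h.smooth i).contMDiffAt (isOpen_Ioo.mem_nhds hr)
  have hd : ∀ r ∈ Set.Ioo t₁ t₂,
      DifferentiableAt ℝ (fun r => g.val (c r) (b i r) (b j r)) r := fun r hr =>
    (contMDiffAt_iff_contDiffAt.1 (contMDiffAt_metric (hsm i r hr) (hsm j r hr))).differentiableAt
      (by simp)
  refine isOpen_Ioo.is_const_of_deriv_eq_zero isPreconnected_Ioo
    (f := fun r => g.val (c r) (b i r) (b j r))
    (fun r hr => (hd r hr).differentiableWithinAt) (fun r hr => ?_) hs ht
  have h1 := fderiv_metric_along g (hsm i r hr) (hsm j r hr) (1 : ℝ)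
  have hp : ∀ i, covDir g c (b i) (1 : ℝ) r = 0 := fun i => h.parallel i r hr
  rw [hp, hp, map_zero, map_zero, zero_apply, add_zero] at h1
  exact (fderiv_apply_one_eq_deriv).symm.trans h1

/-- The velocity of a development is the parallel translate of the covariant velocity. -/
lemma IsDevelopment.exists_hasDerivAt {Y : (t : ℝ) → TangentSpace (𝓡 n) (c t)} {t₀ : ℝ}
    {y : ℝ → TangentSpace (𝓡 n) (c t₀)} (h : IsDevelopment g c Y (Set.Ioo t₁ t₂) t₀ y)
    (ht₀ : t₀ ∈ Set.Ioo t₁ t₂) {t : ℝ} (ht : t ∈ Set.Ioo t₁ t₂) :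
    ∃ y' : TangentSpace (𝓡 n) (c t₀), HasDerivAt y y' t ∧
      g.val (c t₀) y' y' = g.val (c t) (pointDifferential (F := ℝ) g c Y t (1 : ℝ))
        (pointDifferential (F := ℝ) g c Y t (1 : ℝ)) ∧
      (y' = 0 ↔ pointDifferential (F := ℝ) g c Y t (1 : ℝ) = 0) := by
  obtain ⟨b, hb, -, hy⟩ := h
  set X := pointDifferential (F := ℝ) g c Y t (1 : ℝ) with hX
  have htop := (hb.independent t ht).span_eq_top_of_card_eq_finrank'
    (by rw [Fintype.card_fin, finrank_tangentSpace_euclidean])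
  obtain ⟨a, ha⟩ := (Submodule.mem_span_range_iff_exists_fun ℝ).1
    (show X ∈ Submodule.span ℝ (Set.range fun i => b i t) by rw [htop]; trivial)
  refine ⟨_, hy t ht a ha.symm, ?_, ?_⟩
  · rw [← ha]
    simp only [map_sum, map_smul, sum_apply, smul_apply]
    refine Finset.sum_congr rfl fun i _ => ?_
    congr 1
    refine Finset.sum_congr rfl fun j _ => ?_
    rw [hb.metric_const _ _ ht₀ ht]
  · have h0 : ∀ s ∈ Set.Ioo t₁ t₂, ∑ i, a i • b i s = 0 ↔ a = 0 := by
      intro s hs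
      constructor
      · intro h
        funext i
        exact Fintype.linearIndependent_iff.1 (hb.independent s hs) a h i
      · rintro rfl
        simp
    rw [← ha, h0 t₀ ht₀, h0 t ht]

end Development

/-! ### The development of the singular point along a curve. -/

section DevelopmentOfSingularPoint

variable {m : ℕ}
  {M : Type*} [TopologicalSpace M] [ChartedSpace (EuclideanSpace ℝ (Fin (m + 2))) M]
  [IsManifold (𝓡 (m + 2)) ∞ M]
  {V : Type*} [TopologicalSpace V] [ChartedSpace (EuclideanSpace ℝ (Fin (m + 1))) V]
  [IsManifold (𝓡 (m + 1)) ∞ V]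
  {g : LorentzMetric (m + 2) M} {f : V → M}
  {N : (q : V) → TangentSpace (𝓡 (m + 1)) q}
  {θ : (q : V) → TangentSpace (𝓡 (m + 1)) q →L[ℝ] ℝ}

namespace IsCanonicalField

lemma smoothFieldAt_neg (hc : IsCanonicalField g f N θ) (hf : IsLightlikeHypersurface g f) (q : V) :
    SmoothFieldAt (F := EuclideanSpace ℝ (Fin (m + 1))) f (fun q => -pushforward f q (N q)) q :=
  (hf.smoothFieldAt_push (hc.smoothAt q)).neg

lemma pointDifferential_curve (hc : IsCanonicalField g f N θ) (hf : IsLightlikeHypersurface g f)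
    {γ : ℝ → V} {t : ℝ} (hγ : ContMDiffAt 𝓘(ℝ, ℝ) (𝓡 (m + 1)) ∞ γ t) :
    pointDifferential (F := ℝ) g (fun t => f (γ t)) (fun t => -pushforward f (γ t) (N (γ t))) t
        (1 : ℝ)
      = -(θ (γ t) (mfderiv 𝓘(ℝ, ℝ) (𝓡 (m + 1)) γ t (1 : ℝ)) • pushforward f (γ t) (N (γ t))) := by
  have hγd : MDifferentiableAt 𝓘(ℝ, ℝ) (𝓡 (m + 1)) γ t := hγ.mdifferentiableAt (by simp)
  have h1 : mfderiv 𝓘(ℝ, ℝ) (𝓡 (m + 2)) (fun t => f (γ t)) t (1 : ℝ)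
      = pushforward f (γ t) (mfderiv 𝓘(ℝ, ℝ) (𝓡 (m + 1)) γ t (1 : ℝ)) :=
    mfderiv_comp_apply t (hf.smooth.contMDiffAt.mdifferentiableAt (by simp)) hγd (1 : ℝ)
  have h2 := covAlong_comp g (F' := ℝ) (F := EuclideanSpace ℝ (Fin (m + 1))) (γ := γ) hγd
    (hc.smoothFieldAt_neg hf (γ t)) (1 : ℝ)
  rw [← hc.pointDifferential_eq]
  exact congrArg₂ (fun a b : EuclideanSpace ℝ (Fin (m + 2)) => a + b) h1 h2

/-- Along `γ` the covariant velocity of the singular point is `-θ(γ') N`. The development keeps its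
square, which is zero, and its vanishing. -/
lemma development (hc : IsCanonicalField g f N θ) (hf : IsLightlikeHypersurface g f)
    {γ : ℝ → V} {t₁ t₂ t₀ : ℝ} (ht₀ : t₀ ∈ Set.Ioo t₁ t₂)
    (hγ : ContMDiffOn 𝓘(ℝ, ℝ) (𝓡 (m + 1)) ∞ γ (Set.Ioo t₁ t₂))
    {y : ℝ → TangentSpace (𝓡 (m + 2)) (f (γ t₀))}
    (h : IsDevelopment g (fun t => f (γ t)) (fun t => -pushforward f (γ t) (N (γ t)))
      (Set.Ioo t₁ t₂) t₀ y) {t : ℝ} (ht : t ∈ Set.Ioo t₁ t₂) :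
    ∃ y' : TangentSpace (𝓡 (m + 2)) (f (γ t₀)),
      HasDerivAt y y' t ∧ g.val (f (γ t₀)) y' y' = 0 ∧
      (y' = 0 ↔ θ (γ t) (mfderiv 𝓘(ℝ, ℝ) (𝓡 (m + 1)) γ t (1 : ℝ)) = 0) := by
  obtain ⟨y', hy', hg, h0⟩ := h.exists_hasDerivAt ht₀ ht
  rw [hc.pointDifferential_curve hf (hγ.contMDiffAt (isOpen_Ioo.mem_nhds ht))] at hg h0
  refine ⟨y', hy', ?_, ?_⟩
  · rw [hg]
    simp only [map_neg, map_smul, neg_apply, smul_apply, hc.mem_radical (γ t) (N (γ t)), smul_zero,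
      neg_zero]
  · rw [h0, neg_eq_zero, smul_eq_zero, or_iff_left (hf.pushforward_ne_zero (hc.ne_zero _))]

end IsCanonicalField

end DevelopmentOfSingularPoint

/-! ### Fields along a map with prescribed components. -/

section FieldAlong

variable {n : ℕ} {M : Type*} [TopologicalSpace M]
  [ChartedSpace (EuclideanSpace ℝ (Fin n)) M] [IsManifold (𝓡 n) ∞ M]
  {F : Type*} [NormedAddCommGroup F] [NormedSpace ℝ F]
  {W : Type*} [TopologicalSpace W] [ChartedSpace F W]

/-- The field along `c` with given components in the preferred chart at `x`. -/
def fieldAlong (x : M) (c : W → M) (χ : W → EuclideanSpace ℝ (Fin n)) (q : W) :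
    TangentSpace (𝓡 n) (c q) :=
  (chartDeriv x (c q)).inverse (χ q)

lemma inverse_chartDeriv {x q : M} (hq : q ∈ (extChartAt (𝓡 n) x).source)
    (v : TangentSpace (𝓡 n) q) : (chartDeriv x q).inverse (chartDeriv x q v) = v :=
  chartDeriv_injective hq (chartDeriv_inverse hq _)

lemma smoothFieldAt_fieldAlong {x : M} {c : W → M} {χ : W → EuclideanSpace ℝ (Fin n)} {q : W}
    (hc : ContMDiffAt 𝓘(ℝ, F) (𝓡 n) ∞ c q) (hx : c q ∈ (extChartAt (𝓡 n) x).source)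
    (hχ : ContMDiffAt 𝓘(ℝ, F) 𝓘(ℝ, EuclideanSpace ℝ (Fin n)) ∞ χ q) :
    SmoothFieldAt (F := F) c (fieldAlong x c χ) q := by
  refine (contMDiffAt_totalSpace_iff x hx).2 ⟨hc, hχ.congr_of_eventuallyEq ?_⟩
  filter_upwards [hc.continuousAt.eventually_mem ((isOpen_extChartAt_source x).mem_nhds hx)] with z
      hz
  exact chartDeriv_inverse hz _

end FieldAlong

/-! ### The isotropic transversal `eₙ`. -/

section Transversal

variable {m : ℕ}
  {M : Type*} [TopologicalSpace M] [ChartedSpace (EuclideanSpace ℝ (Fin (m + 2))) M]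
  [IsManifold (𝓡 (m + 2)) ∞ M]
  {V : Type*} [TopologicalSpace V] [ChartedSpace (EuclideanSpace ℝ (Fin (m + 1))) V]
  [IsManifold (𝓡 (m + 1)) ∞ V]
  {g : LorentzMetric (m + 2) M} {f : V → M}
  {N : (q : V) → TangentSpace (𝓡 (m + 1)) q}

/-- A smooth isotropic field transversal to the hypersurface, with prescribed scalar products with
the tangent vectors. -/
lemma IsLightlikeHypersurface.exists_transversal (hf : IsLightlikeHypersurface g f)
    (hN : IsNullFieldOn g f Set.univ N) (p : V)
    {α : EuclideanSpace ℝ (Fin (m + 1)) → EuclideanSpace ℝ (Fin (m + 1)) →L[ℝ] ℝ}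
    (hα : ∀ y ∈ (extChartAt (𝓡 (m + 1)) p).target, ContDiffAt ℝ ∞ α y)
    (hα1 : ∀ y ∈ (extChartAt (𝓡 (m + 1)) p).target, α y (fieldCoord N p y) = 1) :
    ∃ (U : Set (EuclideanSpace ℝ (Fin (m + 1))))
      (X : (y : EuclideanSpace ℝ (Fin (m + 1))) → TangentSpace (𝓡 (m + 2)) (chartMap f p y)),
      IsOpen U ∧ extChartAt (𝓡 (m + 1)) p p ∈ U ∧ ∀ y ∈ U,
        y ∈ (extChartAt (𝓡 (m + 1)) p).target ∧
        chartMap f p y ∈ (extChartAt (𝓡 (m + 2)) (f p)).source ∧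
        SmoothFieldAt (F := EuclideanSpace ℝ (Fin (m + 1))) (chartMap f p) X y ∧
        g.val (chartMap f p y) (X y) (X y) = 0 ∧
        ∀ v, g.val (chartMap f p y) (X y) (mapDir (chartMap f p) v y) = -α y v := by
  set φ := extChartAt (𝓡 (m + 1)) p with hφ
  set y₀ := φ p with hy₀
  have hp : p ∈ φ.source := mem_extChartAt_source p
  have hy : y₀ ∈ φ.target := φ.map_source hp
  set c := chartMap (m := m) f p with hcdef
  have hc0 : c y₀ = f p := congrArg f (φ.left_inv hp)
  have hcs : ∀ y ∈ φ.target,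
      ContMDiffAt 𝓘(ℝ, EuclideanSpace ℝ (Fin (m + 1))) (𝓡 (m + 2)) ∞ c y :=
    fun y hy => hf.contMDiffAt_chartMap hy
  have hsrc0 : c y₀ ∈ (extChartAt (𝓡 (m + 2)) (f p)).source := by
    rw [hc0]; exact mem_extChartAt_source _
  have hev : ∀ᶠ y in 𝓝 y₀, y ∈ φ.target ∧ c y ∈ (extChartAt (𝓡 (m + 2)) (f p)).source :=
    (eventually_mem_target hy).and ((hcs y₀ hy).continuousAt.eventually_mem
      ((isOpen_extChartAt_source (f p)).mem_nhds hsrc0))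
  let E := chartField f N p
  have hE0 : ∀ y, E y ≠ 0 := fun y => hf.pushforward_ne_zero (hN.ne_zero _ trivial)
  have hEm : ∀ y ∈ φ.target, E y = mapDir (n := m + 2) c (fieldCoord N p y) y := fun y hy =>
    (hf.mapDir_chartMap_chartDeriv hy _).symm
  have hEr : ∀ y ∈ φ.target, ∀ v, g.val (c y) (E y) (mapDir (n := m + 2) c v y) = 0 := by
    intro y hy v
    rw [hf.mapDir_chartMap hy]
    exact hN.null _ trivial _
  obtain ⟨Z, hZ⟩ : ∃ Z, g.val (c y₀) (E y₀) Z ≠ 0 := by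
    by_contra! h
    exact hE0 y₀ (g.nondegenerate h)
  let Zf := fieldAlong (f p) c (fun _ : EuclideanSpace ℝ (Fin (m + 1)) => chartDeriv (f p) (c y₀) Z)
  have hZf : Zf y₀ = Z := inverse_chartDeriv hsrc0 Z
  let ι : (y : EuclideanSpace ℝ (Fin (m + 1))) →
      EuclideanSpace ℝ (Fin (m + 2)) →L[ℝ] TangentSpace (𝓡 (m + 2)) (c y) :=
    fun y => (chartDeriv (f p) (c y)).inverse
  -- `Q` records the scalar products of a vector with the tangent hyperplane and with an auxiliary
  -- `Z` satisfying `(E, Z) ≠ 0`. A vector in its kernel is orthogonal to the hyperplane, hence a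
  -- multiple of `E`, and the product with `Z` makes it zero. So prescribed products can be realised
  -- smoothly.
  let Q : EuclideanSpace ℝ (Fin (m + 1)) → EuclideanSpace ℝ (Fin (m + 2)) →L[ℝ]
      (EuclideanSpace ℝ (Fin (m + 1)) →L[ℝ] ℝ) × ℝ := fun y =>
    (ContinuousLinearMap.bilinearComp (E := EuclideanSpace ℝ (Fin (m + 2)))
      (F := EuclideanSpace ℝ (Fin (m + 2))) (E' := EuclideanSpace ℝ (Fin (m + 2)))
      (F' := EuclideanSpace ℝ (Fin (m + 1))) (g.val (c y)) (ι y)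
      (mfderiv 𝓘(ℝ, EuclideanSpace ℝ (Fin (m + 1))) (𝓡 (m + 2)) c y)).prod
    ((g.val (c y) (Zf y)).comp (ι y))
  have hQ1 : ∀ y χ v, (Q y χ).1 v = g.val (c y) (ι y χ) (mapDir (n := m + 2) c v y) :=
    fun _ _ _ => rfl
  have hQ2 : ∀ y χ, (Q y χ).2 = g.val (c y) (ι y χ) (Zf y) :=
    fun _ _ => g.symm _ _ _
  have hconst : ∀ y, y ∈ φ.target ∧ c y ∈ (extChartAt (𝓡 (m + 2)) (f p)).source → ∀ χ,
      SmoothFieldAt (F := EuclideanSpace ℝ (Fin (m + 1))) c (fun y => ι y χ) y := fun y hy χ =>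
    smoothFieldAt_fieldAlong (χ := fun _ => χ) (hcs y hy.1) hy.2 contMDiffAt_const
  have hQs : ∀ y, y ∈ φ.target ∧ c y ∈ (extChartAt (𝓡 (m + 2)) (f p)).source →
      ContDiffAt ℝ ∞ Q y := by
    intro y hy
    refine contDiffAt_clm_of_apply fun χ => ContDiffAt.prodMk (f := fun y => (Q y χ).1)
      (g := fun y => (Q y χ).2) (contDiffAt_clm_of_apply fun v => ?_) ?_
    · exact contMDiffAt_iff_contDiffAt.1 (contMDiffAt_metric (hconst y hy χ)
        (smoothFieldAt_mapDir (hf.eventually_contMDiffAt_chartMap hy.1) v))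
    · exact contMDiffAt_iff_contDiffAt.1 (contMDiffAt_metric (hconst y hy _)
        (hconst y hy χ))
  have hQ0 : (Q y₀).IsInvertible := by
    refine isInvertible_of_injective _ ((injective_iff_map_eq_zero _).2 fun χ hχ => ?_) ?_
    · have h1 : ∀ w, g.val (c y₀) (ι y₀ χ) (pushforward f (φ.symm y₀) w) = 0 := by
        intro w
        have h := congrArg (fun P => P.1 (chartDeriv p (φ.symm y₀) w)) hχ
        have h' : g.val (c y₀) (ι y₀ χ)
          (mapDir (n := m + 2) c (chartDeriv p (φ.symm y₀) w) y₀) = 0 := h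
        rwa [hf.mapDir_chartMap_chartDeriv hy] at h'
      obtain ⟨a, ha⟩ := hf.orthogonal_tangent (hN.null (φ.symm y₀) trivial)
        (hN.ne_zero _ trivial) h1
      have ha' : ι y₀ χ = a • E y₀ := ha
      have h2 : (Q y₀ χ).2 = 0 := congrArg Prod.snd hχ
      rw [hQ2, hZf, ha', map_smul, smul_apply, smul_eq_mul] at h2
      rw [(mul_eq_zero.1 h2).resolve_right hZ, zero_smul] at ha'
      have h3 := chartDeriv_inverse hsrc0 χ
      rw [← h3]
      exact (congrArg (chartDeriv (f p) (c y₀)) ha').trans (map_zero _)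
    · rw [Module.finrank_prod, ← finrank_clm_real, finrank_euclideanSpace_fin,
        finrank_euclideanSpace_fin, Module.finrank_self]
  obtain ⟨U, hU, hUo, hyU⟩ := eventually_nhds_iff.1 (hev.and
    (eventually_isInvertible (hQs y₀ ⟨hy, hsrc0⟩).continuousAt hQ0))
  -- The product with `Z` is free and set to `0`; it only fixes the multiple of `E`, which is
  -- corrected afterwards.
  let χ : EuclideanSpace ℝ (Fin (m + 1)) → EuclideanSpace ℝ (Fin (m + 2)) :=
    fun y => (Q y).inverse (-α y, 0)
  let X₀ := fieldAlong (f p) c χ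
  have hX₀ : ∀ y ∈ U, SmoothFieldAt (F := EuclideanSpace ℝ (Fin (m + 1))) c X₀ y := fun y hy =>
    smoothFieldAt_fieldAlong (hcs y (hU y hy).1.1) (hU y hy).1.2
      (contMDiffAt_iff_contDiffAt.2 ((contDiffAt_inverse_clm (hQs y (hU y hy).1) (hU y
          hy).2).clm_apply
        ((hα y (hU y hy).1.1).neg.prodMk contDiffAt_const)))
  have hX₀v : ∀ y ∈ U, ∀ v, g.val (c y) (X₀ y) (mapDir (n := m + 2) c v y) = -α y v := by
    intro y hy v
    have h1 : Q y (χ y) = (-α y, 0) := by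
      obtain ⟨e, he⟩ := (hU y hy).2
      simp only [χ]
      rw [← he]
      simp
    exact (hQ1 y (χ y) v).symm.trans (by rw [h1]; rfl)
  have hX₀E : ∀ y ∈ U, g.val (c y) (X₀ y) (E y) = -1 := by
    intro y hy
    rw [hEm y (hU y hy).1.1, hX₀v y hy, hα1 y (hU y hy).1.1]
  -- Since `(X₀, E) = -1` and `(E, E) = 0`, the square of `X₀ + s E` is `(X₀, X₀) - 2 s`. Adding a
  -- multiple of `E` does not change the products with tangent vectors.
  refine ⟨U, fun y => X₀ y + (g.val (c y) (X₀ y) (X₀ y) / 2) • E y, hUo, hyU, fun y hy =>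
    ⟨(hU y hy).1.1, (hU y hy).1.2, ?_, ?_, fun v => ?_⟩⟩
  · have hs := contMDiffAt_metric (g := g) (hX₀ y hy) (hX₀ y hy)
    have h2 : ContMDiffAt 𝓘(ℝ, EuclideanSpace ℝ (Fin (m + 1))) 𝓘(ℝ, ℝ) ∞
        (fun y => g.val (c y) (X₀ y) (X₀ y) / 2) y :=
      contMDiffAt_iff_contDiffAt.2 ((contMDiffAt_iff_contDiffAt.1 hs).div_const 2)
    exact (hX₀ y hy).add (SmoothFieldAt.smul h2
      (hf.smoothFieldAt_chartMap (hU y hy).1.1 (hN.smoothAt trivial)))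
  · have hEE : g.val (c y) (E y) (E y) = 0 := hN.null _ trivial _
    have h3 : g.val (c y) (E y) (X₀ y) = -1 := by rw [g.symm]; exact hX₀E y hy
    simp only [map_add, map_smul, add_apply, smul_apply, smul_eq_mul, hEE, h3, hX₀E y hy]
    ring
  · simp only [map_add, map_smul, add_apply, smul_apply, smul_eq_mul, hEr y (hU y hy).1.1,
      hX₀v y hy]
    ring

end Transversal

/-! ### The screen distribution `ker θ`. -/

section Screen

variable {m : ℕ}
  {M : Type*} [TopologicalSpace M] [ChartedSpace (EuclideanSpace ℝ (Fin (m + 2))) M]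
  [IsManifold (𝓡 (m + 2)) ∞ M]
  {V : Type*} [TopologicalSpace V] [ChartedSpace (EuclideanSpace ℝ (Fin (m + 1))) V]
  [IsManifold (𝓡 (m + 1)) ∞ V]
  {g : LorentzMetric (m + 2) M} {f : V → M}
  {N : (q : V) → TangentSpace (𝓡 (m + 1)) q}
  {θ : (q : V) → TangentSpace (𝓡 (m + 1)) q →L[ℝ] ℝ}

namespace IsCanonicalField

/-- With `α = θ / θ(N)`, so that `α(N) = 1`, the transversal with `(eₙ, ·) = -α` on tangent vectors
has `ω¹ = α`. The screen of the resulting frame is therefore `ker θ`. -/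
lemma isScreenDistribution (hc : IsCanonicalField g f N θ) (hf : IsLightlikeHypersurface g f)
    (hθ : ∀ q, θ q (N q) ≠ 0) : IsScreenDistribution g f (kernelDistribution θ) := by
  intro p
  set φ := extChartAt (𝓡 (m + 1)) p with hφ
  set y₀ := φ p with hy₀
  have hp : p ∈ φ.source := mem_extChartAt_source p
  have hy : y₀ ∈ φ.target := φ.map_source hp
  let ν := fieldCoord N p
  have hνs : ∀ y ∈ φ.target, ContDiffAt ℝ ∞ ν y := fun y hy =>
      contDiffAt_fieldCoord hy (hc.smoothAt _)
  have hΘν : ∀ y ∈ φ.target, thetaCoord θ p y (ν y) ≠ 0 := fun y hy => by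
    have h : thetaCoord θ p y (ν y) = θ (φ.symm y) (N (φ.symm y)) := thetaCoord_chartDeriv θ hy _
    rw [h]
    exact hθ _
  let α : EuclideanSpace ℝ (Fin (m + 1)) → EuclideanSpace ℝ (Fin (m + 1)) →L[ℝ] ℝ :=
    fun y => (thetaCoord θ p y (ν y))⁻¹ • thetaCoord θ p y
  have hαs : ∀ y ∈ φ.target, ContDiffAt ℝ ∞ α y := fun y hy =>
    (((hc.contDiffAt_thetaCoord hf hy).clm_apply (hνs y hy)).inv (hΘν y hy)).smul
      (hc.contDiffAt_thetaCoord hf hy)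
  have hα1 : ∀ y ∈ φ.target, α y (ν y) = 1 := fun y hy => inv_mul_cancel₀ (hΘν y hy)
  obtain ⟨U, X, hU, hyU, hX⟩ := hf.exists_transversal hc.null p hαs hα1
  have hker : Module.finrank ℝ (α y₀).toLinearMap.ker = m := by
    have h := Module.Dual.finrank_ker_add_one_of_ne_zero (f := (α y₀).toLinearMap) (by
      intro h
      have h1 := LinearMap.congr_fun h (ν y₀)
      exact one_ne_zero ((hα1 y₀ hy).symm.trans h1))
    rw [finrank_euclideanSpace_fin] at h
    omega
  let b := Module.finBasisOfFinrankEq ℝ (α y₀).toLinearMap.ker hker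
  -- A fixed basis of `ker α` at `y₀` is projected along `N` into the kernel at `y`. At `y₀` nothing
  -- changes, and linear independence is an open condition.
  let ε : Fin m → EuclideanSpace ℝ (Fin (m + 1)) → EuclideanSpace ℝ (Fin (m + 1)) :=
    fun a y => (b a : EuclideanSpace ℝ (Fin (m + 1))) - α y (b a) • ν y
  have hεs : ∀ a, ∀ y ∈ φ.target, ContDiffAt ℝ ∞ (ε a) y := fun a y hy =>
    contDiffAt_const.sub (((hαs y hy).clm_apply contDiffAt_const).smul (hνs y hy))
  have hαε : ∀ a, ∀ y ∈ φ.target, α y (ε a y) = 0 := fun a y hy => by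
    simp only [ε, map_sub, map_smul, smul_eq_mul]
    rw [hα1 y hy, mul_one, sub_self]
  let B : EuclideanSpace ℝ (Fin (m + 1)) → Fin (m + 1) → EuclideanSpace ℝ (Fin (m + 1)) :=
    fun y => Fin.cons (ν y) fun a => ε a y
  have hB : ContinuousAt B y₀ := by
    refine continuousAt_pi.2 fun i => ?_
    refine Fin.cases ?_ (fun a => ?_) i
    · exact (hνs y₀ hy).continuousAt
    · exact (hεs a y₀ hy).continuousAt
  have hB0 : LinearIndependent ℝ (B y₀) := by
    have h0 : (fun a => ε a y₀) = fun a => (b a : EuclideanSpace ℝ (Fin (m + 1))) := by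
      funext a
      have : α y₀ (b a) = 0 := (b a).2
      simp only [ε]
      rw [this, zero_smul, sub_zero]
    simp only [B]
    rw [linearIndependent_finCons, h0]
    refine ⟨b.linearIndependent.map' (Submodule.subtype _) (Submodule.ker_subtype _), fun h => ?_⟩
    have hle : Submodule.span ℝ (Set.range fun a => (b a : EuclideanSpace ℝ (Fin (m + 1))))
        ≤ (α y₀).toLinearMap.ker := by
      rw [Submodule.span_le]
      rintro _ ⟨a, rfl⟩
      exact (b a).2
    exact one_ne_zero ((hα1 y₀ hy).symm.trans (hle h))
  obtain ⟨U', hU', hUo', hyU'⟩ := eventually_nhds_iff.1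
    (hB.eventually_mem (isOpen_setOfPred_linearIndependent.mem_nhds hB0))
  set O : Set V := φ.source ∩ φ ⁻¹' (U ∩ U') with hO
  let χ : EuclideanSpace ℝ (Fin (m + 1)) → EuclideanSpace ℝ (Fin (m + 2)) :=
    fun y => chartDeriv (f p) (chartMap f p y) (X y)
  -- The points `chartMap f p (φ q)` and `f q` agree only propositionally, so `X` is carried over to
  -- a field along `f` through its components.
  let eₙ := fieldAlong (f p) f (fun q => χ (φ q))
  have hOpen : IsOpen O := isOpen_extChartAt_preimage' p (hU.inter hUo')
  have hcoord : ∀ q ∈ O, ∃ y ∈ U, y ∈ U' ∧ φ.symm y = q ∧ φ q = y := fun q hq =>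
    ⟨φ q, hq.2.1, hq.2.2, φ.left_inv hq.1, rfl⟩
  have hen : ∀ y ∈ U, eₙ (φ.symm y) = X y := by
    intro y hy
    have h1 : χ (φ (φ.symm y)) = χ y := congrArg χ (φ.right_inv (hX y hy).1)
    show (chartDeriv (f p) (f (φ.symm y))).inverse (χ (φ (φ.symm y))) = X y
    rw [h1]
    exact inverse_chartDeriv (hX y hy).2.1 _
  have hena : ∀ y ∈ U, ∀ v : TangentSpace (𝓡 (m + 1)) (φ.symm y),
      g.val (f (φ.symm y)) (pushforward f (φ.symm y) v) (eₙ (φ.symm y))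
        = -α y (chartDeriv p (φ.symm y) v) := by
    intro y hy v
    have h1 := (hX y hy).2.2.2.2 (chartDeriv p (φ.symm y) v)
    rw [hf.mapDir_chartMap_chartDeriv (hX y hy).1] at h1
    exact (g.symm _ _ _).trans ((congrArg (fun Z => g.val (f (φ.symm y)) Z
      (pushforward f (φ.symm y) v)) (hen y hy)).trans h1)
  have heε : ∀ y ∈ U, ∀ a, chartDeriv p (φ.symm y) (fieldOfCoord p (ε a) (φ.symm y)) = ε a y := by
    intro y hy a
    rw [chartDeriv_fieldOfCoord (φ.map_target (hX y hy).1)]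
    exact congrArg (ε a) (φ.right_inv (hX y hy).1)
  have hframe : IsIsotropicFrameOn g f O N (fun a => fieldOfCoord p (ε a)) eₙ := by
    refine ⟨⟨hOpen, hc.null.smooth.mono (Set.subset_univ _), fun q _ => hc.ne_zero q,
      fun q _ => hc.mem_radical q⟩, fun a q hq => ?_, fun q hq => ?_, fun q hq => ?_, fun q hq =>
          ?_,
      fun q hq a => ?_, fun q hq => ?_⟩
    · exact (contMDiffAt_fieldOfCoord hq.1 (hεs a _ (hX _ hq.2.1).1)).contMDiffWithinAt
    · obtain ⟨hy1, hy2, hy3, -, -⟩ := hX _ hq.2.1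
      have hsrc : f q ∈ (extChartAt (𝓡 (m + 2)) (f p)).source := by
        have h : chartMap f p (φ q) = f q := congrArg f (φ.left_inv hq.1)
        rw [← h]
        exact hy2
      exact (smoothFieldAt_fieldAlong (F := EuclideanSpace ℝ (Fin (m + 1))) hf.smooth.contMDiffAt
          hsrc
        (ContMDiffAt.comp (g := χ) q (hy3.coord hy2) (contMDiffAt_chart hq.1))).contMDiffWithinAt
    · obtain ⟨y, hy, hy', rfl, -⟩ := hcoord q hq
      refine LinearIndependent.of_comp (chartDeriv p (φ.symm y)).toLinearMap ?_
      have hfun : (chartDeriv p (φ.symm y)).toLinearMap ∘ (Fin.cons (N (φ.symm y))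
          (fun a => fieldOfCoord p (ε a) (φ.symm y)) :
            Fin (m + 1) → TangentSpace (𝓡 (m + 1)) (φ.symm y)) = B y := by
        funext i
        refine Fin.cases ?_ (fun a => ?_) i
        · rfl
        · exact heε y hy a
      rw [hfun]
      exact hU' y hy'
    · obtain ⟨y, hy, hy', rfl, -⟩ := hcoord q hq
      rw [hen y hy]
      exact (hX y hy).2.2.2.1
    · obtain ⟨y, hy, hy', rfl, -⟩ := hcoord q hq
      rw [hena y hy, heε y hy, hαε a y (hX y hy).1, neg_zero]
    · obtain ⟨y, hy, hy', rfl, -⟩ := hcoord q hq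
      rw [hena y hy]
      exact congrArg Neg.neg (hα1 y (hX y hy).1)
  refine ⟨O, N, _, eₙ, ⟨hp, hyU, hyU'⟩, hframe, fun q hq => ?_⟩
  ext v
  rw [hframe.mem_span_iff hq, mem_kernelDistribution]
  obtain ⟨y, hy, hy', rfl, -⟩ := hcoord q hq
  have h1 : omega₁ g f eₙ (φ.symm y) v
      = (thetaCoord θ p y (ν y))⁻¹ * θ (φ.symm y) v := by
    rw [omega₁, component₁, hena y hy, neg_neg, ← thetaCoord_chartDeriv θ (hX y hy).1]
    rfl
  rw [h1, mul_eq_zero, or_iff_right (inv_ne_zero (hΘν y (hX y hy).1))]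

lemma isIntrinsicScreen (hc : IsCanonicalField g f N θ) (hf : IsLightlikeHypersurface g f)
    (hm : 1 ≤ m) (hθ : ∀ q, θ q (N q) ≠ 0) : IsIntrinsicScreen g f (kernelDistribution θ) :=
  ⟨hc.isScreenDistribution hf hθ, fun _ _ _ _ _ h hl =>
    hc.isGivenByOmega_iff_isReduced hf hm hθ h hl⟩

/-- `dF = -θ N` always lands in the null line; reaching `a N` takes the vector `-(a / θ(N)) N`,
hence `θ(N) ≠ 0`. -/
lemma range_pointDifferential (hc : IsCanonicalField g f N θ) (hf : IsLightlikeHypersurface g f)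
    (hθ : ∀ q, θ q (N q) ≠ 0) (q : V) :
    Set.range (pointDifferential (F := EuclideanSpace ℝ (Fin (m + 1))) g f
        (fun q => -pushforward f q (N q)) q)
      = pushforward f q '' (radical g f q : Set (TangentSpace (𝓡 (m + 1)) q)) := by
  ext Y
  constructor
  · rintro ⟨v, rfl⟩
    refine ⟨-(θ q v • N q), Submodule.neg_mem _ (Submodule.smul_mem _ _ (hc.mem_radical q)), ?_⟩
    rw [hc.pointDifferential_eq, map_neg, map_smul]
  · rintro ⟨u, hu, rfl⟩
    obtain ⟨a, rfl⟩ := (hf.mem_radical_iff (hc.mem_radical q) (hc.ne_zero q)).1 hu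
    refine ⟨(-(a / θ q (N q))) • N q, ?_⟩
    rw [hc.pointDifferential_eq, map_smul, map_smul, smul_eq_mul, neg_mul,
      div_mul_cancel₀ _ (hθ q), neg_smul, neg_neg]

end IsCanonicalField

end Screen

end Lightlike

end

/-! ### The theorem, with `F = -N` and `S = ker θ`. -/

theorem theorem11 {m : ℕ} (hm : 1 ≤ m)
    {M : Type*} [TopologicalSpace M] [ChartedSpace (EuclideanSpace ℝ (Fin (m + 2))) M]
    [IsManifold (𝓡 (m + 2)) ∞ M]
    {V : Type*} [TopologicalSpace V] [ChartedSpace (EuclideanSpace ℝ (Fin (m + 1))) V]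
    [IsManifold (𝓡 (m + 1)) ∞ V]
    (g : Lightlike.LorentzMetric (m + 2) M) (f : V → M)
    (hf : Lightlike.IsLightlikeHypersurface g f)
    (humb : Lightlike.IsTotallyUmbilical g f)
    (hK : Lightlike.HasNonvanishingIsotropicCurvature g f) :
    ∃ (F : (p : V) → TangentSpace (𝓡 (m + 2)) (f p))
      (S : (p : V) → Submodule ℝ (TangentSpace (𝓡 (m + 1)) p)),
      -- `x + F` is the only singular point of the isotropic geodesic through `x`
      (∀ (p : V) (Y : TangentSpace (𝓡 (m + 2)) (f p)),
        Lightlike.IsSingularPoint g f p Y ↔ Y = F p) ∧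
      ContMDiff (𝓡 (m + 1)) (𝓡 (m + 2)).tangent ∞
        (fun p => (⟨f p, F p⟩ : TangentBundle (𝓡 (m + 2)) M)) ∧
      -- the differential of the singular point sweeps out exactly the isotropic direction of `V`
      (∀ p : V, Set.range (Lightlike.pointDifferential (F := EuclideanSpace ℝ (Fin (m + 1))) g f F p)
        = Lightlike.pushforward f p ''
            (Lightlike.radical g f p : Set (TangentSpace (𝓡 (m + 1)) p))) ∧
      -- the singular point is fixed exactly in the directions of `S`
      (∀ (p : V) (v : TangentSpace (𝓡 (m + 1)) p),
        Lightlike.pointDifferential (F := EuclideanSpace ℝ (Fin (m + 1))) g f F p v = 0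
          ↔ v ∈ S p) ∧
      -- along every curve in `V`, the singular point describes, in the development, a curve with
      -- isotropic velocity, which is regular wherever the curve is transversal to `S`
      (∀ (γ : ℝ → V) (t₁ t₂ t₀ : ℝ), t₀ ∈ Set.Ioo t₁ t₂ →
        ContMDiffOn 𝓘(ℝ, ℝ) (𝓡 (m + 1)) ∞ γ (Set.Ioo t₁ t₂) →
        ∀ y : ℝ → TangentSpace (𝓡 (m + 2)) (f (γ t₀)),
          Lightlike.IsDevelopment g (fun t => f (γ t)) (fun t => F (γ t)) (Set.Ioo t₁ t₂) t₀ y →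
          ∀ t ∈ Set.Ioo t₁ t₂, ∃ y' : TangentSpace (𝓡 (m + 2)) (f (γ t₀)),
            HasDerivAt y y' t ∧ g.val (f (γ t₀)) y' y' = 0 ∧
            (y' = 0 ↔ (mfderiv 𝓘(ℝ, ℝ) (𝓡 (m + 1)) γ t (1 : ℝ) :
              TangentSpace (𝓡 (m + 1)) (γ t)) ∈ S (γ t))) ∧
      -- `S` is an invariant screen distribution, given by `ω¹ = 0` in the reduced frames
      (Lightlike.IsIntrinsicScreen g f S ∧
        ∀ S' : (p : V) → Submodule ℝ (TangentSpace (𝓡 (m + 1)) p),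
          Lightlike.IsIntrinsicScreen g f S' → S' = S) ∧
      -- integrability
      (Lightlike.IsIntegrable S ↔
        ∀ (O : Set V) (e₁ : (q : V) → TangentSpace (𝓡 (m + 1)) q)
          (e : Fin m → (q : V) → TangentSpace (𝓡 (m + 1)) q)
          (eₙ : (q : V) → TangentSpace (𝓡 (m + 2)) (f q)),
          Lightlike.IsIsotropicFrameOn g f O e₁ e eₙ → Lightlike.IsGivenByOmega g f S O eₙ →
          ∀ q ∈ O, ∀ a b : Fin m, Lightlike.curvatureComponent g f e₁ e eₙ q a b = 0) := by
  obtain ⟨N, θ, hc⟩ := hf.exists_canonicalField hm humb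
  have hθ := hc.theta_ne_zero hf hm hK
  refine ⟨fun p => -Lightlike.pushforward f p (N p), Lightlike.kernelDistribution θ,
    hc.isSingularPoint_iff hf hm humb, fun p => hc.smoothFieldAt_neg hf p,
    hc.range_pointDifferential hf hθ, fun p v => ?_,
    fun γ t₁ t₂ t₀ ht₀ hγ y hy t ht => hc.development hf ht₀ hγ hy ht,
    ⟨hc.isIntrinsicScreen hf hm hθ, fun S' hS' =>
      Lightlike.isIntrinsicScreen_unique humb (hc.isIntrinsicScreen hf hm hθ) hS'⟩, ?_⟩
  · rw [hc.pointDifferential_eq, neg_eq_zero, smul_eq_zero,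
      or_iff_left (hf.pushforward_ne_zero (hc.ne_zero p)), Lightlike.mem_kernelDistribution]
  · rw [← hc.isClosedOnKernel_iff hf hm humb (hc.isScreenDistribution hf hθ)]
    exact ⟨hc.isClosedOnKernel_of_isIntegrable hf, hc.isIntegrable_of_isClosedOnKernel hf hθ⟩
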